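/- A cyclic braid is a finite simple graph $B$ whose vertex set has a partition $B_1,\dots,B_k$, with $k\ge 3$, into nonempty sets (its clusters) such that for every $i$ and every $x\in B_i$ the neighbourhood $N(x)$ satisfies $B_{i-1}\cup B_{i+1}\subseteq N(x)\subseteq B_{i-1}\cup B_i\cup B_{i+1}$, indices taken modulo $k$; $k$ is its length. It is called empty if no edge joins two vertices of the same cluster. For $k\ge 3$ let $H_{3k}$ be the empty cyclic braid with $k$ clusters, all of size $3$; let $H_{3k+1}$ be the empty cyclic braid with $k$ clusters, one of size $4$ and the other $k-1$ of size $3$; and let $H_{3k-1}$ be the empty cyclic braid with $k$ clusters, one of size $2$ and the other $k-1$ of size $3$. This defines, up to isomorphism, an $n$-vertex graph $H_n$ for every $n\ge 8$. Let $m(n)$ be the maximum number of induced cycles (of any length at least $3$) in a simple graph on $n$ vertices. **Theorem.** There exists $n_0$ such that, for all $n\ge n_0$, $H_n$ is, up to isomorphism, the unique graph on $n$ vertices containing $m(n)$ induced cycles. That is, a graph $G$ on $n\ge n_0$ vertices has exactly $m(n)$ induced cycles if and only if $G$ is isomorphic to $H_n$. -/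

import Mathlib

/-- `G` is a cyclic braid `(B 0, …, B (k - 1))`: `k ≥ 3`, the sets `B i` (the clusters) partition
the vertex set, and `B (i - 1) ∪ B (i + 1) ⊆ N(x) ⊆ B (i - 1) ∪ B i ∪ B (i + 1)` for all `i` and
all `x ∈ B i`, indices taken modulo `k`. -/
structure IsCyclicBraid {V : Type*} (G : SimpleGraph V) {k : ℕ} [NeZero k]
    (B : Fin k → Set V) : Prop where
  three_le : 3 ≤ k
  nonempty : ∀ i, (B i).Nonempty
  disjoint : ∀ i j, i ≠ j → Disjoint (B i) (B j)
  cover : ⋃ i, B i = Set.univ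
  subset_nbhd : ∀ i, ∀ x ∈ B i, B (i - 1) ∪ B (i + 1) ⊆ G.neighborSet x
  nbhd_subset : ∀ i, ∀ x ∈ B i, G.neighborSet x ⊆ B (i - 1) ∪ B i ∪ B (i + 1)

/-- A cyclic braid is empty if it has no edges within its clusters. -/
structure IsEmptyCyclicBraid {V : Type*} (G : SimpleGraph V) {k : ℕ} [NeZero k]
    (B : Fin k → Set V) : Prop extends IsCyclicBraid G B where
  no_edge : ∀ i, ∀ x ∈ B i, ∀ y ∈ B i, ¬ G.Adj x y

/-- The empty cyclic braid of length `k` (for `k ≥ 3`) whose `i`-th cluster is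
`{i} × {0, …, s i - 1}`: two vertices are adjacent iff their clusters are consecutive in the
cyclic order. -/
def emptyCyclicBraid (k : ℕ) (s : Fin k → ℕ) : SimpleGraph (Σ i : Fin k, Fin (s i)) :=
  (SimpleGraph.cycleGraph k).comap Sigma.fst

/-- The graph is indeed an empty cyclic braid, in the sense of the general definition. -/
theorem emptyCyclicBraid_isEmptyCyclicBraid (k : ℕ) [NeZero k] (hk : 3 ≤ k) (s : Fin k → ℕ)
    (hs : ∀ i, 0 < s i) :
    IsEmptyCyclicBraid (emptyCyclicBraid k s) (fun i => {x | x.1 = i}) := by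
  obtain ⟨k, rfl⟩ : ∃ l, k = l + 2 := ⟨k - 2, by omega⟩
  have key : ∀ x y, (emptyCyclicBraid (k + 2) s).Adj x y ↔ (y.1 = x.1 - 1 ∨ y.1 = x.1 + 1) := by
    intro x y
    change (SimpleGraph.cycleGraph (k + 2)).Adj x.1 y.1 ↔ _
    rw [SimpleGraph.cycleGraph_adj]
    constructor
    · rintro (h | h)
      · left; rw [← h]; abel
      · right; rw [← h]; abel
    · rintro (h | h)
      · left; rw [h]; abel
      · right; rw [h]; abel
  refine ⟨⟨hk, fun i => ⟨⟨i, 0, hs i⟩, rfl⟩, ?_, ?_, ?_, ?_⟩, ?_⟩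
  · intro i j hij
    refine Set.disjoint_left.mpr ?_
    intro x hx hx'
    exact hij (hx.symm.trans hx')
  · ext x; simp
  · rintro i x rfl y hy
    exact (key x y).mpr hy
  · rintro i x rfl y hy
    rcases (key x y).mp hy with h | h
    · exact Or.inl (Or.inl h)
    · exact Or.inr h
  · rintro i x rfl y hy hxy
    exact (SimpleGraph.cycleGraph (k + 2)).loopless.irrefl x.1
      (by have : (SimpleGraph.cycleGraph (k + 2)).Adj x.1 y.1 := hxy
          rwa [show y.1 = x.1 from hy] at this)

/-- The number `k` of clusters of `H n`, where `n` is `3k`, `3k + 1` or `3k - 1`. -/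
def hLength (n : ℕ) : ℕ := (n + 1) / 3

/-- The sizes of the clusters of `H n`: all are `3`, except that the first one is `4` when
`n ≡ 1` modulo `3`, and `2` when `n ≡ 2` modulo `3`. -/
def hSize (n : ℕ) (i : Fin (hLength n)) : ℕ :=
  if i.val = 0 then (if n % 3 = 0 then 3 else if n % 3 = 1 then 4 else 2) else 3

/-- The graph `H n`, meaningful for `n ≥ 8`. -/
def H (n : ℕ) : SimpleGraph (Σ i : Fin (hLength n), Fin (hSize n i)) :=
  emptyCyclicBraid (hLength n) (hSize n)

/-- `H n` has `n` vertices. -/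
theorem card_H (n : ℕ) (hn : 8 ≤ n) :
    Fintype.card (Σ i : Fin (hLength n), Fin (hSize n i)) = n := by
  rw [Fintype.card_sigma]
  simp only [Fintype.card_fin]
  obtain ⟨k, hk⟩ : ∃ k, hLength n = k + 1 := ⟨hLength n - 1, by unfold hLength; omega⟩
  have h : ∑ i : Fin (hLength n), hSize n i
      = ∑ i ∈ Finset.range (hLength n),
        if i = 0 then (if n % 3 = 0 then 3 else if n % 3 = 1 then 4 else 2) else 3 :=
    Fin.sum_univ_eq_sum_range
      (fun i : ℕ => if i = 0 then (if n % 3 = 0 then 3 else if n % 3 = 1 then 4 else 2) else 3) _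
  rw [h, hk, Finset.sum_range_succ']
  simp only [Nat.succ_ne_zero, if_false, if_true, Finset.sum_const, Finset.card_range, smul_eq_mul]
  unfold hLength at hk
  split_ifs <;> omega

/-- The number of induced cycles of `G`. An induced cycle is determined by its vertex set, so we
count the vertex sets that induce a cycle (of some length `l ≥ 3`). -/
noncomputable def numInducedCycles {V : Type*} (G : SimpleGraph V) : ℕ :=
  {S : Set V | ∃ l, 3 ≤ l ∧ Nonempty (G.induce S ≃g SimpleGraph.cycleGraph l)}.ncard

/-- The maximum number of induced cycles in a graph on `n` vertices. -/
noncomputable def m (n : ℕ) : ℕ := ⨆ G : SimpleGraph (Fin n), numInducedCycles G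

/-- `m n` is a maximum: it is attained, and it bounds all the values. -/
theorem m_isGreatest (n : ℕ) :
    IsGreatest (Set.range fun G : SimpleGraph (Fin n) => numInducedCycles G) (m n) :=
  ⟨Nat.sSup_mem (Set.range_nonempty _) (Set.finite_range _).bddAbove,
    fun _ h => le_csSup (Set.finite_range _).bddAbove h⟩

/-! Grow an induced path towards `z` from a state `(u, R)`: choose a neighbour of `u` in `R` and
delete all neighbours of `u` from `R`. With `d` choices the path count is at most `d` times the best
count for `|R| - d` vertices, so there are at most `maxProd |R|` paths, which is about `3 ^ (|R| /
3)` (`pathCount_le`). A cycle minus a vertex and its two neighbours is such a path, so `maxProd n`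
bounds the number of cycles up to a polynomial factor. Conversely, the cycles of `H n` with one
vertex in each cluster already number `maxProd n`, so an extremal graph has at least that many.

The polynomial slack hides the structure, and it is removed by finding a piece of braid first. By an
entropy estimate, an average path spends only a logarithmic cost on steps that are not roughly
uniform three-way choices (`accum_unbalancedCost_le`). Cycles through vertices of more than
logarithmic degree are negligible (`card_inducedCycles_le_lowDegreePart`). With bounded degree,
siblings that disagree about their continuations are rare too (`accum_discordCost_le`). So some path
runs through a long sequence of completely joined triples without other neighbours, a stretch
(`exists_stretch`).

A cycle of length at least five that meets the interior of the stretch crosses all of it, with one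
vertex in each inner triple. Up to negligible terms the count is therefore at most `3 ^ L` times a
count of paths between fixed ends outside the stretch, with no polynomial factor left. Now stability
by a constant factor suffices: either a fraction `1 / 32` is lost, or the outside is a chain of
completely joined levels with optimal sizes (`pathCount_gap`), and the graph is a cyclic braid with
optimal cluster sizes (`IsStretch.isOptimalBraid_or`).

Such a braid has all clusters of size 3, except for one cluster or for two clusters of size 2. The
main term is then fixed and only cycles within at most three consecutive clusters remain to be
compared. Edges inside clusters replace 4-cycles by fewer triangles
(`card_inducedCycles_lt_of_adj`), and one cluster of size 4 beats two of size 2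
(`lt_card_inducedCycles_H`, `card_inducedCycles_le_of_le_three`). -/

/-! ### Maximal products of partitions -/

/-- The largest product of a partition of `n` into positive integers. -/
def maxProd : ℕ → ℕ
  | 0 => 1
  | 1 => 1
  | 2 => 2
  | 3 => 3
  | 4 => 4
  | (n + 5) => 3 * maxProd (n + 2)

theorem maxProd_add_three {n : ℕ} (hn : 2 ≤ n) : maxProd (n + 3) = 3 * maxProd n := by
  obtain ⟨k, rfl⟩ : ∃ k, n = k + 2 := ⟨n - 2, by omega⟩
  rfl

theorem maxProd_pos (n : ℕ) : 0 < maxProd n := by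
  fun_induction maxProd n <;> omega

/-- Induction in steps of three, for statements that follow the recursion of `maxProd`. -/
theorem three_step_induction {P : ℕ → Prop} (base : ∀ n < 5, P n)
    (step : ∀ n, 2 ≤ n → P n → P (n + 3)) (n : ℕ) : P n := by
  induction n using Nat.strong_induction_on with
  | _ n ih =>
    by_cases h : n < 5
    · exact base n h
    · obtain ⟨k, rfl⟩ : ∃ k, n = k + 3 := ⟨n - 3, by omega⟩
      exact step k (by omega) (ih k (by omega))

theorem maxProd_le_succ (n : ℕ) : maxProd n ≤ maxProd (n + 1) := by
  induction n using three_step_induction with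
  | base n hn => interval_cases n <;> decide
  | step n hn ih =>
    rw [maxProd_add_three hn, show n + 3 + 1 = (n + 1) + 3 by ring,
      maxProd_add_three (by omega)]
    omega

theorem maxProd_mono : Monotone maxProd := monotone_nat_of_le_succ maxProd_le_succ

theorem three_mul_maxProd_le (n : ℕ) : 3 * maxProd n ≤ maxProd (n + 3) := by
  induction n using three_step_induction with
  | base n hn => interval_cases n <;> decide
  | step n hn ih =>
    rw [maxProd_add_three hn, maxProd_add_three (show 2 ≤ n + 3 by omega), maxProd_add_three hn]

/-- Both alternatives survive adding 3 to `r ≥ 2`, so finitely many cases decide. The ratio 8/9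
comes from replacing `3 + 3` by `2 + 4`. -/
theorem mul_maxProd_gap_of_lt_five {d : ℕ} (hd : d < 5) (r : ℕ) :
    9 * (d * maxProd r) ≤ 8 * maxProd (d + r) ∨ d * maxProd r = maxProd (d + r) := by
  induction r using three_step_induction with
  | base n hn => interval_cases d <;> interval_cases n <;> decide
  | step n hn ih =>
    rw [← add_assoc, maxProd_add_three hn, maxProd_add_three (show 2 ≤ d + n by omega)]
    rcases ih with ih | ih
    · left; nlinarith
    · right; rw [← ih]; ring

/-- A part `d ≥ 5` is better split: `5 < 2 * 3` gives the ratio 5/6, the values 6 and 7 are no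
worse, and passing from `d` to `d + 3` at most triples the left side while it triples the right. -/
theorem mul_maxProd_le_of_five_le {d : ℕ} (hd : 5 ≤ d) (r : ℕ) :
    6 * (d * maxProd r) ≤ 5 * maxProd (d + r) := by
  have two : ∀ r, 2 * maxProd r ≤ maxProd (r + 2) := fun r => by
    rw [add_comm r]; rcases mul_maxProd_gap_of_lt_five (show 2 < 5 by omega) r with h | h <;> omega
  have four : ∀ r, 4 * maxProd r ≤ maxProd (r + 4) := fun r => by
    rw [add_comm r]; rcases mul_maxProd_gap_of_lt_five (show 4 < 5 by omega) r with h | h <;> omega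
  have key : ∀ d, 6 * ((d + 5) * maxProd r) ≤ 5 * maxProd (d + 5 + r) := by
    intro d
    induction d using Nat.strong_induction_on with
    | _ d ih =>
      rcases d with _ | _ | _ | d
      · have := two r
        have h := maxProd_add_three (show 2 ≤ r + 2 by omega)
        rw [show 0 + 5 + r = r + 2 + 3 by ring]
        omega
      · have := three_mul_maxProd_le r
        have h := maxProd_add_three (show 2 ≤ r + 3 by omega)
        rw [show 0 + 1 + 5 + r = r + 3 + 3 by ring]
        omega
      · have := four r
        have h := maxProd_add_three (show 2 ≤ r + 4 by omega)
        rw [show 0 + 1 + 1 + 5 + r = r + 4 + 3 by ring]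
        omega
      · have := ih d (by omega)
        have h := maxProd_add_three (show 2 ≤ d + 5 + r by omega)
        rw [show d + 1 + 1 + 1 + 5 + r = d + 5 + r + 3 by ring, h]
        nlinarith [maxProd_pos r]
  obtain ⟨e, rfl⟩ : ∃ e, d = e + 5 := ⟨d - 5, by omega⟩
  exact key e

/-- A part of size `d` either can belong to an optimal partition, or loses a constant factor. -/
theorem mul_maxProd_gap (d r : ℕ) :
    9 * (d * maxProd r) ≤ 8 * maxProd (d + r) ∨ d * maxProd r = maxProd (d + r) := by
  by_cases hd : d < 5
  · exact mul_maxProd_gap_of_lt_five hd r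
  · left
    have := mul_maxProd_le_of_five_le (not_lt.mp hd) r
    omega

theorem maxProd_lt_succ {n : ℕ} (hn : 1 ≤ n) : maxProd n < maxProd (n + 1) := by
  induction n using three_step_induction with
  | base n h => interval_cases n <;> decide
  | step n h ih =>
    rw [maxProd_add_three h, show n + 3 + 1 = (n + 1) + 3 by ring, maxProd_add_three (by omega)]
    have := ih (by omega)
    omega

/-- The parts of an optimal partition have sizes `2`, `3`, `4`. -/
theorem bounds_of_mul_maxProd_eq {d r : ℕ} (h : d * maxProd r = maxProd (d + r))
    (hdr : 2 ≤ d + r) : 2 ≤ d ∧ d ≤ 4 := by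
  have hp := maxProd_pos (d + r)
  refine ⟨?_, ?_⟩
  · by_contra! hd
    interval_cases d
    · omega
    · have := maxProd_lt_succ (n := r) (by omega)
      rw [add_comm r] at this
      omega
  · by_contra! hd
    have := mul_maxProd_le_of_five_le hd r
    omega

theorem mul_maxProd_le (d r : ℕ) : d * maxProd r ≤ maxProd (d + r) := by
  rcases mul_maxProd_gap d r with h | h <;> omega

/-- This shows that the recursion for `maxProd` does bound all products of partitions, by splitting
off one part at a time. -/
theorem prod_le_maxProd {ι : Type*} (s : Finset ι) (b : ι → ℕ) :
    ∏ i ∈ s, b i ≤ maxProd (∑ i ∈ s, b i) := by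
  classical
  induction s using Finset.induction_on with
  | empty => simp [maxProd]
  | insert a s ha ih =>
    rw [Finset.prod_insert ha, Finset.sum_insert ha]
    exact (Nat.mul_le_mul_left _ ih).trans (mul_maxProd_le _ _)

theorem bounds_of_prod_eq_maxProd {ι : Type*} (s : Finset ι) (b : ι → ℕ)
    (h : ∏ i ∈ s, b i = maxProd (∑ i ∈ s, b i)) (hs : 2 ≤ ∑ i ∈ s, b i) {i : ι} (hi : i ∈ s) :
    2 ≤ b i ∧ b i ≤ 4 := by
  classical
  rw [← Finset.mul_prod_erase s b hi, ← Finset.add_sum_erase s b hi] at h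
  rw [← Finset.add_sum_erase s b hi] at hs
  refine bounds_of_mul_maxProd_eq (le_antisymm (mul_maxProd_le _ _) ?_) hs
  rw [← h]
  exact Nat.mul_le_mul_left _ (prod_le_maxProd _ _)

theorem maxProd_add_mul {n : ℕ} (hn : 2 ≤ n) (l : ℕ) : maxProd (n + 3 * l) = 3 ^ l * maxProd n := by
  induction l with
  | zero => simp
  | succ l ih =>
    rw [show n + 3 * (l + 1) = n + 3 * l + 3 by ring, maxProd_add_three (by omega), ih]
    ring

/-- This is `3 ^ (n / 3) ≤ 2 * maxProd n` without roots. It links `maxProd` to the entropy bound,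
which is stated with `log 3 / 3`. -/
theorem three_pow_le_maxProd (n : ℕ) : 3 ^ n ≤ 8 * maxProd n ^ 3 := by
  induction n using three_step_induction with
  | base n hn => interval_cases n <;> decide
  | step n hn ih =>
    rw [maxProd_add_three hn, pow_add]
    nlinarith

/-! ### Counting induced paths by branching -/

namespace SimpleGraph

variable {V : Type*} (G : SimpleGraph V) [DecidableRel G.Adj]

/-- The neighbours of `u` in `R`. -/
def fwd (u : V) (R : Finset V) : Finset V := {w ∈ R | G.Adj u w}

/-- The vertices of `R` that are not adjacent to `u`. -/
def rem (u : V) (R : Finset V) : Finset V := {w ∈ R | ¬ G.Adj u w}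

variable {G}

@[simp] theorem mem_fwd {u w : V} {R : Finset V} : w ∈ G.fwd u R ↔ w ∈ R ∧ G.Adj u w := by
  simp [fwd]

@[simp] theorem mem_rem {u w : V} {R : Finset V} : w ∈ G.rem u R ↔ w ∈ R ∧ ¬ G.Adj u w := by
  simp [rem]

theorem card_fwd_add_card_rem (u : V) (R : Finset V) :
    (G.fwd u R).card + (G.rem u R).card = R.card :=
  Finset.card_filter_add_card_filter_not _

theorem rem_subset (u : V) (R : Finset V) : G.rem u R ⊆ R := Finset.filter_subset _ _

theorem card_rem_lt {u w : V} {R : Finset V} (h : w ∈ G.fwd u R) :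
    (G.rem u R).card < R.card := by
  have := card_fwd_add_card_rem (G := G) u R
  have := Finset.card_pos.mpr ⟨w, h⟩
  omega

/-- Induction along the branching process: a state that has a continuation `w` loses at least `w`
from `R`, so the hypothesis is available at all its successors. -/
theorem fwd_induction {P : V → Finset V → Prop}
    (h : ∀ u R, (∀ w ∈ G.fwd u R, P w (G.rem u R)) → P u R) (u : V) (R : Finset V) : P u R := by
  induction hn : R.card using Nat.strong_induction_on generalizing u R with
  | _ n ih =>
    exact h u R fun w hw => ih _ (hn ▸ card_rem_lt hw) _ _ rfl

variable (G)

/-- The sum of `c` over all states `(u, R)` met while growing induced paths towards `z`: a path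
ends when it reaches a neighbour of `z`, otherwise its end `u` is extended by a neighbour in `R`
and all neighbours of `u` are removed from `R`. -/
def accum (z : V) (c : V → Finset V → ℕ) (u : V) (R : Finset V) : ℕ :=
  c u R + if G.Adj u z then 0 else ∑ w : {w // w ∈ G.fwd u R}, accum z c w.1 (G.rem u R)
termination_by R.card
decreasing_by exact card_rem_lt w.2

variable {G}

theorem accum_of_adj {z u : V} (h : G.Adj u z) (c : V → Finset V → ℕ) (R : Finset V) :
    G.accum z c u R = c u R := by
  rw [accum, if_pos h, add_zero]

theorem accum_of_not_adj {z u : V} (h : ¬ G.Adj u z) (c : V → Finset V → ℕ) (R : Finset V) :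
    G.accum z c u R = c u R + ∑ w ∈ G.fwd u R, G.accum z c w (G.rem u R) := by
  rw [accum, if_neg h, Finset.sum_coe_sort (G.fwd u R) fun w => G.accum z c w (G.rem u R)]

variable (G)

/-- The number of induced paths from `u` to `z` with all interior vertices in `R`. -/
def pathCount (z u : V) (R : Finset V) : ℕ := G.accum z (fun u _ => if G.Adj u z then 1 else 0) u R

variable {G}

theorem pathCount_of_adj {z u : V} (h : G.Adj u z) (R : Finset V) : G.pathCount z u R = 1 := by
  rw [pathCount, accum_of_adj h, if_pos h]

theorem pathCount_of_not_adj {z u : V} (h : ¬ G.Adj u z) (R : Finset V) :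
    G.pathCount z u R = ∑ w ∈ G.fwd u R, G.pathCount z w (G.rem u R) := by
  simp only [pathCount]
  rw [accum_of_not_adj h, if_neg h, zero_add]

/-- `fwd` and `rem` partition `R`, so the recursion for `pathCount` is dominated by splitting off a
part of size `|fwd|`. -/
theorem pathCount_le (z u : V) (R : Finset V) : G.pathCount z u R ≤ maxProd R.card := by
  induction u, R using fwd_induction (G := G) with
  | h u R ih =>
    by_cases h : G.Adj u z
    · rw [pathCount_of_adj h]; exact maxProd_pos _
    · rw [pathCount_of_not_adj h]
      refine (Finset.sum_le_card_nsmul _ _ _ ih).trans ?_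
      rw [smul_eq_mul, ← card_fwd_add_card_rem (G := G) u R]
      exact mul_maxProd_le _ _

variable [DecidableEq V]

/-- `P` is the set of interior vertices of an induced path from `u` to `z`. -/
inductive IndPath (G : SimpleGraph V) (z : V) : V → Finset V → Prop
  | nil {u : V} (h : G.Adj u z) : IndPath G z u ∅
  | cons {u w : V} {P : Finset V} (hz : ¬ G.Adj u z) (hw : G.Adj u w) (hwP : w ∉ P)
      (hP : ∀ p ∈ P, ¬ G.Adj u p) (h : IndPath G z w P) : IndPath G z u (insert w P)

/-- The first interior vertex `w` lies in `fwd u R`, and the others avoid the neighbours of `u` and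
hence form a path from `w` inside `rem u R`. Only an inequality is needed, so different orders
giving the same set do no harm. -/
theorem card_indPath_le (z u : V) (R : Finset V) (F : Finset (Finset V))
    (hF : ∀ P ∈ F, P ⊆ R ∧ IndPath G z u P) : F.card ≤ G.pathCount z u R := by
  classical
  induction u, R using fwd_induction (G := G) generalizing F with
  | h u R ih =>
    by_cases h : G.Adj u z
    · rw [pathCount_of_adj h]
      refine Finset.card_le_one.mpr ?_
      have : ∀ P ∈ F, P = ∅ := by
        intro P hP
        cases (hF P hP).2 with
        | nil => rfl
        | cons hz => exact absurd h hz
      intro P hP P' hP'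
      rw [this P hP, this P' hP']
    · rw [pathCount_of_not_adj h]
      have hsub : F ⊆ (G.fwd u R).biUnion fun w =>
          ({P ∈ (G.rem u R).powerset | IndPath G z w P ∧ insert w P ∈ F}).image (insert w) := by
        intro P hP
        obtain ⟨hPR, hPi⟩ := hF P hP
        cases hPi with
        | nil h' => exact absurd h' h
        | @cons _ w P' hz hw hwP hP' hi =>
          simp only [Finset.mem_biUnion, Finset.mem_image, Finset.mem_filter, Finset.mem_powerset]
          refine ⟨w, ?_, P', ⟨?_, hi, hP⟩, rfl⟩
          · simp [hw, hPR (Finset.mem_insert_self _ _)]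
          · intro p hp
            simp [hP' p hp, hPR (Finset.mem_insert_of_mem hp)]
      refine (Finset.card_le_card hsub).trans (Finset.card_biUnion_le.trans ?_)
      refine Finset.sum_le_sum fun w hw => Finset.card_image_le.trans (ih w hw _ ?_)
      intro P hP
      simp only [Finset.mem_filter, Finset.mem_powerset] at hP
      exact ⟨hP.1, hP.2.1⟩

end SimpleGraph

/-! ### Stability of the path bound: optimal chains -/

namespace SimpleGraph

/-- Choose one of `n i + r i` objects at each place and classify the choices by the last place `j`
where one of the `n j` objects is taken. The left side replaces the free choices before `j` by the
factor 1. -/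
theorem sum_mul_prod_add_prod_le (n r : ℕ → ℕ) (M : ℕ) (h : ∀ i < M, 1 ≤ n i + r i)
    (a : ℕ) (ha : a ≤ M) :
    ∑ j ∈ Finset.Ico a M, n j * ∏ i ∈ Finset.Ico (j + 1) M, r i + ∏ i ∈ Finset.Ico a M, r i
      ≤ ∏ i ∈ Finset.Ico a M, (n i + r i) := by
  induction ha using Nat.decreasingInduction with
  | self => simp
  | of_succ a ha ih =>
    have ha' : a < M := ha
    rw [Finset.sum_eq_sum_Ico_succ_bot ha', Finset.prod_eq_prod_Ico_succ_bot ha',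
      Finset.prod_eq_prod_Ico_succ_bot ha' fun i => n i + r i]
    have h1 : ∏ i ∈ Finset.Ico (a + 1) M, r i ≤ ∏ i ∈ Finset.Ico (a + 1) M, (n i + r i) :=
      Finset.prod_le_prod' fun i _ => by omega
    obtain ⟨c, hc⟩ : ∃ c, n a + r a = c + 1 := ⟨n a + r a - 1, by have := h a ha'; omega⟩
    rw [hc]
    generalize ∏ i ∈ Finset.Ico (a + 1) M, (n i + r i) = Q at *
    generalize ∏ i ∈ Finset.Ico (a + 1) M, r i = P at *
    have : n a * P + r a * P = c * P + P := by rw [← add_mul, hc]; ring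
    nlinarith [Nat.mul_le_mul_left c h1]

/-- Here `n i` and `r i` count the neighbours and non-neighbours of a vertex in level `i` of a
chain. If some non-neighbour is in level 0, at most 3/4 of that level is usable. Otherwise a
neighbour in a later level gives the factor 3/4 to all but one of the `n 0` shares, and `n 0 = 2`
yields the worst value `(3/4 + 1) / 2 = 7/8`. -/
theorem sum_mul_prod_gap (n r : ℕ → ℕ) (M : ℕ) (hM : 0 < M)
    (h : ∀ i < M, 2 ≤ n i + r i ∧ n i + r i ≤ 4) (hne : r 0 ≠ 0 ∨ ∃ i < M, 0 < i ∧ n i ≠ 0) :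
    8 * ∑ j ∈ Finset.range M, n j * ∏ i ∈ Finset.Ico (j + 1) M, r i
      ≤ 7 * ∏ i ∈ Finset.range M, (n i + r i) := by
  have hb := sum_mul_prod_add_prod_le n r M (fun i hi => by have := h i hi; omega) 1 hM
  rw [← Nat.Ico_zero_eq_range, Finset.sum_eq_sum_Ico_succ_bot hM,
    Finset.prod_eq_prod_Ico_succ_bot hM fun i => n i + r i]
  have h1 : ∏ i ∈ Finset.Ico 1 M, r i ≤ ∏ i ∈ Finset.Ico 1 M, (n i + r i) :=
    Finset.prod_le_prod' fun i _ => by omega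
  have h2 : (∃ i < M, 0 < i ∧ n i ≠ 0) →
      4 * ∏ i ∈ Finset.Ico 1 M, r i ≤ 3 * ∏ i ∈ Finset.Ico 1 M, (n i + r i) := by
    rintro ⟨i, hi, h0, hn⟩
    have him : i ∈ Finset.Ico 1 M := by simp; omega
    rw [← Finset.mul_prod_erase _ _ him, ← Finset.mul_prod_erase _ (fun i => n i + r i) him]
    have h3 : ∏ j ∈ (Finset.Ico 1 M).erase i, r j ≤ ∏ j ∈ (Finset.Ico 1 M).erase i, (n j + r j) :=
      Finset.prod_le_prod' fun j _ => by omega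
    have h4 := h i hi
    calc 4 * (r i * ∏ j ∈ (Finset.Ico 1 M).erase i, r j)
        = (4 * r i) * ∏ j ∈ (Finset.Ico 1 M).erase i, r j := by ring
      _ ≤ (3 * (n i + r i)) * ∏ j ∈ (Finset.Ico 1 M).erase i, (n j + r j) :=
          Nat.mul_le_mul (by omega) h3
      _ = _ := by ring
  have h0 := h 0 hM
  simp only [zero_add] at *
  generalize ∏ i ∈ Finset.Ico 1 M, (n i + r i) = Q at *
  generalize ∏ i ∈ Finset.Ico 1 M, r i = P at *
  generalize ∑ j ∈ Finset.Ico 1 M, n j * ∏ i ∈ Finset.Ico (j + 1) M, r i = S at *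
  generalize n 0 = x at *
  generalize r 0 = y at *
  obtain ⟨h01, h02⟩ := h0
  by_cases hy : y = 0
  · have := h2 (by tauto)
    subst hy
    have : x ≤ 4 := by omega
    interval_cases x <;> omega
  · have hx : x ≤ 4 := by omega
    have hy' : y ≤ 4 := by omega
    interval_cases x <;> interval_cases y <;> omega

variable {V : Type*}

/-- The levels `0, …, M - 1` of `h` on `R` form a chain of completely joined consecutive sets,
the last of which consists of the neighbours of `z`, and the product of their sizes is
maximal. -/
structure IsOptimalChain (G : SimpleGraph V) (z : V) (R : Finset V) (h : V → ℕ) (M : ℕ) :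
    Prop where
  lt : ∀ v ∈ R, h v < M
  adj : ∀ v ∈ R, ∀ w ∈ R, h v < h w → (G.Adj v w ↔ h w = h v + 1)
  adj_end : ∀ v ∈ R, (G.Adj v z ↔ h v + 1 = M)
  prod : ∏ i ∈ Finset.range M, ({v ∈ R | h v = i} : Finset V).card = maxProd R.card

/-- An optimal chain in `R` whose first level consists of the neighbours of `u`. -/
structure IsOptimalChainFrom (G : SimpleGraph V) (z u : V) (R : Finset V) (h : V → ℕ) (M : ℕ) :
    Prop extends IsOptimalChain G z R h M where
  adj_start : ∀ v ∈ R, (G.Adj u v ↔ h v = 0)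
  adj_start_end : G.Adj u z ↔ M = 0

variable {G : SimpleGraph V} {z : V} {R : Finset V} {h : V → ℕ} {M : ℕ}

theorem IsOptimalChain.sum_card (hc : IsOptimalChain G z R h M) :
    ∑ i ∈ Finset.range M, ({v ∈ R | h v = i} : Finset V).card = R.card := by
  rw [Finset.card_eq_sum_card_fiberwise (s := R) (t := Finset.range M) (f := h)]
  intro v hv
  simpa using hc.lt v hv

theorem IsOptimalChain.card_level (hc : IsOptimalChain G z R h M) (hR : 2 ≤ R.card) {i : ℕ}
    (hi : i < M) : 2 ≤ ({v ∈ R | h v = i} : Finset V).card ∧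
      ({v ∈ R | h v = i} : Finset V).card ≤ 4 :=
  bounds_of_prod_eq_maxProd (Finset.range M) _ (by rw [hc.sum_card, hc.prod])
    (by rw [hc.sum_card]; exact hR) (by simpa using hi)

variable [DecidableRel G.Adj]

/-- A path climbs at most one level per step and `z` is only adjacent to the last level, so an
emptied level above the current vertex is a barrier. -/
theorem IsOptimalChain.pathCount_eq_zero (hc : IsOptimalChain G z R h M) {i : ℕ} (hi : i < M)
    (u : V) (R' : Finset V) (hu : u ∈ R) (hui : h u < i) (hR : R' ⊆ R)
    (hRi : ∀ v ∈ R', h v ≠ i) : G.pathCount z u R' = 0 := by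
  induction u, R' using fwd_induction (G := G) with
  | h u R' ih =>
    have hz : ¬ G.Adj u z := by rw [hc.adj_end u hu]; omega
    rw [pathCount_of_not_adj hz]
    refine Finset.sum_eq_zero fun w hw => ?_
    have hw' := hw
    rw [mem_fwd] at hw'
    refine ih w hw (hR hw'.1) ?_ ((rem_subset _ _).trans hR)
      fun v hv => hRi v (rem_subset _ _ hv)
    have h1 := hRi w hw'.1
    by_contra hlt
    have := (hc.adj u hu w (hR hw'.1) (by omega)).mp hw'.2
    omega

/-- Leaving `u` deletes the whole next level. A step that does not enter that level is therefore
stuck below it, and only the steps that climb contribute. -/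
theorem IsOptimalChain.pathCount_le (hc : IsOptimalChain G z R h M)
    (u : V) (R' : Finset V) (hu : u ∈ R) (hR : R' ⊆ R) :
    G.pathCount z u R' ≤
      ∏ i ∈ Finset.Ico (h u + 1) M, ({v ∈ R' | h v = i} : Finset V).card := by
  induction u, R' using fwd_induction (G := G) with
  | h u R' ih =>
    have hlt := hc.lt u hu
    by_cases hz : G.Adj u z
    · rw [pathCount_of_adj hz, (hc.adj_end u hu).mp hz]
      simp
    · rw [pathCount_of_not_adj hz]
      have hM : h u + 1 < M := by
        have := (hc.adj_end u hu).not.mp hz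
        omega
      rw [Finset.prod_eq_prod_Ico_succ_bot hM]
      calc ∑ w ∈ G.fwd u R', G.pathCount z w (G.rem u R')
          = ∑ w ∈ G.fwd u R' with h w = h u + 1, G.pathCount z w (G.rem u R') := by
            rw [Finset.sum_filter_of_ne]
            intro w hw hne
            rw [mem_fwd] at hw
            by_contra hwu
            refine hne (hc.pathCount_eq_zero hM w _ (hR hw.1) ?_ ((rem_subset _ _).trans hR) ?_)
            · by_contra hge
              have := (hc.adj u hu w (hR hw.1) (by omega)).mp hw.2
              omega
            · intro v hv hvu
              rw [mem_rem] at hv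
              exact hv.2 ((hc.adj u hu v (hR hv.1) (by omega)).mpr hvu)
        _ ≤ ∑ w ∈ G.fwd u R' with h w = h u + 1,
              ∏ i ∈ Finset.Ico (h u + 1 + 1) M, ({v ∈ R' | h v = i} : Finset V).card := by
            refine Finset.sum_le_sum fun w hw => ?_
            rw [Finset.mem_filter] at hw
            have hw' := hw.1
            rw [mem_fwd] at hw'
            refine (ih w hw.1 (hR hw'.1) ((rem_subset _ _).trans hR)).trans ?_
            rw [hw.2]
            exact Finset.prod_le_prod' fun i _ =>
              Finset.card_le_card (Finset.filter_subset_filter _ (rem_subset _ _))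
        _ ≤ _ := by
            rw [Finset.sum_const, smul_eq_mul]
            refine Nat.mul_le_mul_right _ (Finset.card_le_card ?_)
            intro w hw
            simp only [Finset.mem_filter, mem_fwd] at hw ⊢
            exact ⟨hw.1.1, hw.2⟩

/-- If `w` enters the chain at level `j`, the path must climb through non-neighbours of `w` in all
later levels. Summing over `j` gives the expression of `sum_mul_prod_gap`, whose side condition says
precisely that the neighbours of `w` are not just level 0. -/
theorem IsOptimalChain.pathCount_gap (hc : IsOptimalChain G z R h M) (hR : 2 ≤ R.card) (w : V)
    (hz : ¬ G.Adj w z) (hw : ¬ ∀ v ∈ R, (G.Adj w v ↔ h v = 0)) :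
    8 * G.pathCount z w R ≤ 7 * maxProd R.card := by
  have hM : 0 < M := by
    obtain ⟨v, hv⟩ := Finset.card_pos.mp (show 0 < R.card by omega)
    have := hc.lt v hv
    omega
  have hsplit : ∀ i, ({v ∈ G.fwd w R | h v = i} : Finset V).card +
      ({v ∈ G.rem w R | h v = i} : Finset V).card = ({v ∈ R | h v = i} : Finset V).card := by
    intro i
    have := Finset.card_filter_add_card_filter_not (s := {v ∈ R | h v = i}) (p := G.Adj w)
    simp only [Finset.filter_filter] at this
    rw [← this, fwd, rem, Finset.filter_filter, Finset.filter_filter]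
    simp only [and_comm]
  have hle : G.pathCount z w R ≤ ∑ j ∈ Finset.range M, ({v ∈ G.fwd w R | h v = j} : Finset V).card *
      ∏ i ∈ Finset.Ico (j + 1) M, ({v ∈ G.rem w R | h v = i} : Finset V).card := by
    rw [pathCount_of_not_adj hz]
    have hmaps : ∀ v ∈ G.fwd w R, h v ∈ Finset.range M := by
      intro v hv
      rw [mem_fwd] at hv
      simpa using hc.lt v hv.1
    rw [← Finset.sum_fiberwise_of_maps_to hmaps]
    refine Finset.sum_le_sum fun j _ => ?_
    rw [← smul_eq_mul]
    refine Finset.sum_le_card_nsmul _ _ _ fun c hcm => ?_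
    rw [Finset.mem_filter, mem_fwd] at hcm
    rw [← hcm.2]
    exact hc.pathCount_le c _ hcm.1.1 (rem_subset _ _)
  have hgap := sum_mul_prod_gap (fun i => ({v ∈ G.fwd w R | h v = i} : Finset V).card)
    (fun i => ({v ∈ G.rem w R | h v = i} : Finset V).card) M hM
    (fun i hi => by simp only [hsplit]; exact hc.card_level hR hi) ?_
  · simp only [hsplit, hc.prod] at hgap
    omega
  · push Not at hw
    obtain ⟨v, hv, hvw⟩ := hw
    rcases hvw with ⟨h1, h2⟩ | ⟨h1, h2⟩
    · right
      refine ⟨h v, hc.lt v hv, by omega, ?_⟩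
      exact (Finset.card_pos.mpr ⟨v, by simp [hv, h1]⟩).ne'
    · left
      exact (Finset.card_pos.mpr ⟨v, by simp [hv, h1, h2]⟩).ne'

theorem IsOptimalChain.cons [DecidableEq V] {u : V} (hc : IsOptimalChain G z (G.rem u R) h M)
    (hz : ¬ G.Adj u z) (hfwd : ∀ w ∈ G.fwd u R, (∀ v ∈ G.rem u R, (G.Adj w v ↔ h v = 0)) ∧
      (G.Adj w z ↔ M = 0))
    (hcard : (G.fwd u R).card * maxProd (G.rem u R).card = maxProd R.card) :
    IsOptimalChainFrom G z u R (fun v => if G.Adj u v then 0 else h v + 1) (M + 1) := by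
  refine ⟨⟨?_, ?_, ?_, ?_⟩, ?_, ?_⟩
  · intro v hv
    split_ifs with hu
    · omega
    · have := hc.lt v (by simp [hv, hu])
      omega
  · intro v hv w hw
    split_ifs with hu hu' hu'
    · omega
    · intro _
      rw [(hfwd v (by simp [hv, hu])).1 w (by simp [hw, hu'])]
      omega
    · omega
    · intro hlt
      rw [hc.adj v (by simp [hv, hu]) w (by simp [hw, hu']) (by omega)]
      omega
  · intro v hv
    split_ifs with hu
    · rw [(hfwd v (by simp [hv, hu])).2]
      omega
    · rw [hc.adj_end v (by simp [hv, hu])]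
      omega
  · rw [Finset.prod_range_succ', ← hcard, ← hc.prod, mul_comm]
    congr 1
    · congr 1
      ext v
      simp
    · refine Finset.prod_congr rfl fun i _ => ?_
      congr 1
      ext v
      by_cases hu : G.Adj u v <;> simp [hu]
  · intro v hv
    simp
  · simp [hz]

/-- The number of induced paths is at most the fraction `31 / 32` of the bound `maxProd`, unless
the graph is an optimal chain. -/
theorem pathCount_gap [DecidableEq V] (z u : V) (R : Finset V) (hR : R.card ≠ 1) :
    32 * G.pathCount z u R ≤ 31 * maxProd R.card ∨ ∃ h M, IsOptimalChainFrom G z u R h M := by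
  induction u, R using fwd_induction (G := G) with
  | h u R ih =>
    by_cases hz : G.Adj u z
    · rw [pathCount_of_adj hz]
      rcases Nat.eq_zero_or_pos R.card with h0 | h0
      · right
        rw [Finset.card_eq_zero] at h0
        subst h0
        exact ⟨fun _ => 0, 0, ⟨⟨by simp, by simp, by simp, by simp [maxProd]⟩, by simp, by simp [hz]⟩⟩
      · left
        have := maxProd_mono (show 2 ≤ R.card by omega)
        have h2 : maxProd 2 = 2 := rfl
        omega
    · have hsum := pathCount_of_not_adj hz R
      have hle : G.pathCount z u R ≤ (G.fwd u R).card * maxProd (G.rem u R).card := by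
        rw [hsum, ← smul_eq_mul]
        exact Finset.sum_le_card_nsmul _ _ _ fun w _ => SimpleGraph.pathCount_le _ _ _
      have hcards := card_fwd_add_card_rem (G := G) u R
      rcases mul_maxProd_gap (G.fwd u R).card (G.rem u R).card with hg | hg
      · left
        rw [hcards] at hg
        omega
      rw [hcards] at hg
      rcases Nat.eq_zero_or_pos R.card with h0 | h0
      · left
        have : (G.fwd u R).card = 0 := by omega
        rw [this] at hle
        omega
      have hd := bounds_of_mul_maxProd_eq (hcards.symm ▸ hg) (by omega)
      -- One leftover vertex is the exceptional case of the statement: a direct edge to `z` attains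
      -- `maxProd 1 = 1`, yet the vertex belongs to no chain. An optimal first step never leaves
      -- exactly one vertex.
      have hr : (G.rem u R).card ≠ 1 := by
        intro hr
        rw [hr] at hg hcards
        rw [← hcards] at hg
        obtain ⟨h2, h4⟩ := hd
        generalize (G.fwd u R).card = d at *
        interval_cases d <;> simp [maxProd] at hg
      by_cases hall : ∀ w ∈ G.fwd u R, 32 * G.pathCount z w (G.rem u R) ≤
          31 * maxProd (G.rem u R).card
      · left
        rw [← hg, hsum, Finset.mul_sum]
        refine (Finset.sum_le_card_nsmul _ _ _ hall).trans ?_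
        rw [smul_eq_mul]
        nlinarith
      · push Not at hall
        obtain ⟨w₁, hw₁, hlt⟩ := hall
        obtain ⟨h, M, hc⟩ := (ih w₁ hw₁ hr).resolve_left (by omega)
        by_cases hsame : ∀ w ∈ G.fwd u R, (∀ v ∈ G.rem u R, (G.Adj w v ↔ h v = 0)) ∧
            (G.Adj w z ↔ M = 0)
        · exact Or.inr ⟨_, _, hc.toIsOptimalChain.cons hz hsame hg⟩
        · left
          push Not at hsame
          obtain ⟨w₂, hw₂, hne⟩ := hsame
          have hM : (G.rem u R).card = 0 → M = 0 := by
            intro h0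
            by_contra hM
            have := hc.prod
            rw [Finset.card_eq_zero] at h0
            rw [h0, Finset.prod_eq_zero (i := 0) (by simpa using Nat.pos_of_ne_zero hM) (by simp)]
              at this
            exact absurd this (maxProd_pos _).ne
          -- The sibling `w₂` is attached to the chain found from `w₁` in a different way and loses
          -- 1/8 of its share. There are at most four siblings, which leaves a total loss of at
          -- least 1/32.
          have h7 : 8 * G.pathCount z w₂ (G.rem u R) ≤ 7 * maxProd (G.rem u R).card := by
            by_cases hz₂ : G.Adj w₂ z
            · rw [pathCount_of_adj hz₂]
              rcases Nat.eq_zero_or_pos (G.rem u R).card with h0 | h0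
              · exfalso
                have hM0 := hM h0
                rw [Finset.card_eq_zero] at h0
                have := hne (by simp [h0])
                tauto
              · have := maxProd_mono (show 2 ≤ (G.rem u R).card by omega)
                have h2 : maxProd 2 = 2 := rfl
                omega
            · rcases Nat.eq_zero_or_pos (G.rem u R).card with h0 | h0
              · rw [pathCount_of_not_adj hz₂]
                rw [Finset.card_eq_zero] at h0
                simp [h0, fwd]
              · refine hc.toIsOptimalChain.pathCount_gap (by omega) w₂ hz₂ fun hv => ?_
                obtain ⟨v, hvR⟩ := Finset.card_pos.mp h0
                have := hc.lt v hvR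
                have hM0 : M = 0 := by
                  have := hne hv
                  tauto
                omega
          have herase : ∑ w ∈ (G.fwd u R).erase w₂, G.pathCount z w (G.rem u R) ≤
              ((G.fwd u R).card - 1) * maxProd (G.rem u R).card := by
            rw [← Finset.card_erase_of_mem hw₂, ← smul_eq_mul]
            exact Finset.sum_le_card_nsmul _ _ _ fun w _ => SimpleGraph.pathCount_le _ _ _
          rw [← Finset.add_sum_erase _ _ hw₂] at hsum
          obtain ⟨d, hd'⟩ : ∃ d, (G.fwd u R).card = d + 1 := ⟨(G.fwd u R).card - 1, by omega⟩
          rw [hd'] at herase hg hd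
          simp only [Nat.add_sub_cancel] at herase
          rw [← hg]
          generalize maxProd (G.rem u R).card = g at *
          have : d ≤ 3 := by omega
          interval_cases d <;> omega

end SimpleGraph

/-! ### Balanced and perfect states, and their cost along paths -/

namespace SimpleGraph

variable {V : Type*} {G : SimpleGraph V} [DecidableRel G.Adj] {z : V}

theorem accum_mono {c c' : V → Finset V → ℕ} (h : ∀ u R, c u R ≤ c' u R) (u : V) (R : Finset V) :
    G.accum z c u R ≤ G.accum z c' u R := by
  induction u, R using fwd_induction (G := G) with
  | h u R ih =>
    by_cases hz : G.Adj u z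
    · rw [accum_of_adj hz, accum_of_adj hz]; exact h u R
    · rw [accum_of_not_adj hz, accum_of_not_adj hz]
      exact Nat.add_le_add (h u R) (Finset.sum_le_sum ih)

theorem accum_sum {ι : Type*} (s : Finset ι) (c : ι → V → Finset V → ℕ) (u : V) (R : Finset V) :
    ∑ i ∈ s, G.accum z (c i) u R = G.accum z (fun u R => ∑ i ∈ s, c i u R) u R := by
  induction u, R using fwd_induction (G := G) with
  | h u R ih =>
    by_cases hz : G.Adj u z
    · simp only [accum_of_adj hz]
    · simp only [accum_of_not_adj hz]
      rw [Finset.sum_add_distrib, Finset.sum_comm, Finset.sum_congr rfl ih]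

theorem accum_add (c c' : V → Finset V → ℕ) (u : V) (R : Finset V) :
    G.accum z (fun u R => c u R + c' u R) u R = G.accum z c u R + G.accum z c' u R := by
  have := accum_sum (G := G) (z := z) (Finset.univ : Finset Bool)
    (fun b => if b then c else c') u R
  simpa using this.symm

theorem accum_mul (k : ℕ) (c : V → Finset V → ℕ) (u : V) (R : Finset V) :
    G.accum z (fun u R => k * c u R) u R = k * G.accum z c u R := by
  have := accum_sum (G := G) (z := z) (Finset.range k) (fun _ => c) u R
  simpa using this.symm

/-- The sum of `c` over the states that follow the state `(u, R)`. -/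
def nextSum (G : SimpleGraph V) [DecidableRel G.Adj] (z : V) (c : V → Finset V → ℕ) (u : V)
    (R : Finset V) : ℕ :=
  if G.Adj u z then 0 else ∑ w ∈ G.fwd u R, c w (G.rem u R)

theorem accum_eq_add_nextSum (c : V → Finset V → ℕ) (u : V) (R : Finset V) :
    G.accum z c u R = c u R + G.nextSum z (G.accum z c) u R := by
  by_cases hz : G.Adj u z
  · rw [accum_of_adj hz, nextSum, if_pos hz, add_zero]
  · rw [accum_of_not_adj hz, nextSum, if_neg hz]

/-- In the tree of states every state except the root follows exactly one other, so the left side is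
the total of `c` without the root. -/
theorem accum_nextSum_le (c : V → Finset V → ℕ) (u : V) (R : Finset V) :
    G.accum z (G.nextSum z c) u R ≤ G.accum z c u R := by
  have key : G.accum z (G.nextSum z c) u R = G.nextSum z (G.accum z c) u R := by
    induction u, R using fwd_induction (G := G) with
    | h u R ih =>
      by_cases hz : G.Adj u z
      · simp [accum_of_adj hz, nextSum, hz]
      · rw [accum_of_not_adj hz, Finset.sum_congr rfl ih]
        simp only [nextSum, if_neg hz]
        rw [← Finset.sum_add_distrib]
        exact Finset.sum_congr rfl fun w _ => (accum_eq_add_nextSum c w _).symm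
  rw [key, accum_eq_add_nextSum c]
  omega

/-- There are three ways to continue from the state `(u, R)`, none of which carries much less
than its share of the paths. -/
structure IsBalanced (G : SimpleGraph V) [DecidableRel G.Adj] (z u : V) (R : Finset V) :
    Prop where
  card : (G.fwd u R).card = 3
  balanced : ∀ w ∈ G.fwd u R, G.pathCount z u R ≤ 6 * G.pathCount z w (G.rem u R)

/-- A balanced state for which there are three ways to continue in each of the next two steps. -/
structure IsPerfect (G : SimpleGraph V) [DecidableRel G.Adj] (z u : V) (R : Finset V) :
    Prop extends IsBalanced G z u R where
  child : ∀ w ∈ G.fwd u R, (G.fwd w (G.rem u R)).card = 3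
  grandchild : ∀ w ∈ G.fwd u R, ∀ x ∈ G.fwd w (G.rem u R),
    (G.fwd x (G.rem w (G.rem u R))).card = 3

open scoped Classical in
/-- The cost of a state that is not balanced. -/
noncomputable def unbalancedCost (G : SimpleGraph V) [DecidableRel G.Adj] (z u : V)
    (R : Finset V) : ℕ :=
  if G.Adj u z then R.card + 1 else
    if G.IsBalanced z u R then 0 else G.pathCount z u R * ((G.fwd u R).card + 1)

open scoped Classical in
/-- The number of vertices lost in a state that is not perfect, weighted with the number of
paths. -/
noncomputable def imperfectCost (G : SimpleGraph V) [DecidableRel G.Adj] (z u : V)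
    (R : Finset V) : ℕ :=
  if G.Adj u z then R.card else
    if G.IsPerfect z u R then 0 else G.pathCount z u R * (G.fwd u R).card

/-- The summands 1 in `unbalancedCost` ensure this bound, in particular when a path ends with `R`
empty. -/
theorem pathCount_le_unbalancedCost {u : V} {R : Finset V}
    (h : G.Adj u z ∨ ¬ G.IsBalanced z u R) : G.pathCount z u R ≤ G.unbalancedCost z u R := by
  unfold unbalancedCost
  split_ifs with h1 h2
  · rw [pathCount_of_adj h1]; omega
  · tauto
  · exact Nat.le_mul_of_pos_right _ (by omega)

theorem le_nextSum {u w : V} {R : Finset V} (hz : ¬ G.Adj u z) (hw : w ∈ G.fwd u R)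
    (c : V → Finset V → ℕ) : c w (G.rem u R) ≤ G.nextSum z c u R := by
  rw [nextSum, if_neg hz]
  exact Finset.single_le_sum (f := fun w => c w (G.rem u R)) (fun _ _ => Nat.zero_le _) hw

/-- An imperfect state is unbalanced or final itself, or has such a child, or has a grandchild
without exactly three continuations. Going down from a balanced state loses at most a factor 6, and
the balanced state has three continuations, whence `108 = 3 * 6 * 6`. -/
theorem imperfectCost_le (u : V) (R : Finset V) :
    G.imperfectCost z u R ≤ 108 * (G.unbalancedCost z u R + (G.nextSum z (G.unbalancedCost z) u R +
      G.nextSum z (G.nextSum z (G.unbalancedCost z)) u R)) := by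
  by_cases hz : G.Adj u z
  · simp only [imperfectCost, unbalancedCost, if_pos hz]
    omega
  by_cases hp : G.IsPerfect z u R
  · simp [imperfectCost, hz, hp]
  by_cases hb : G.IsBalanced z u R
  · rw [imperfectCost, if_neg hz, if_neg hp, hb.card]
    have hchild : ∀ w ∈ G.fwd u R, G.Adj w z ∨ ¬ G.IsBalanced z w (G.rem u R) →
        G.pathCount z u R ≤ 6 * G.nextSum z (G.unbalancedCost z) u R := fun w hw h =>
      (hb.balanced w hw).trans (Nat.mul_le_mul_left _
        ((pathCount_le_unbalancedCost h).trans (le_nextSum hz hw _)))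
    by_cases hex : ∃ w ∈ G.fwd u R, G.Adj w z ∨ ¬ G.IsBalanced z w (G.rem u R)
    · obtain ⟨w, hw, h⟩ := hex
      have := hchild w hw h
      omega
    · push Not at hex
      have : ∃ w ∈ G.fwd u R, ∃ x ∈ G.fwd w (G.rem u R),
          (G.fwd x (G.rem w (G.rem u R))).card ≠ 3 := by
        by_contra! hcon
        exact hp ⟨hb, fun w hw => (hex w hw).2.card, hcon⟩
      obtain ⟨w, hw, x, hx, hne⟩ := this
      have h1 := hb.balanced w hw
      have h2 := (hex w hw).2.balanced x hx
      have h3 := pathCount_le_unbalancedCost (G := G) (z := z)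
        (Or.inr fun h => hne h.card : G.Adj x z ∨ ¬ G.IsBalanced z x (G.rem w (G.rem u R)))
      have h4 := le_nextSum (hex w hw).1 hx (G.unbalancedCost z)
      have h5 := le_nextSum hz hw (G.nextSum z (G.unbalancedCost z))
      omega
  · rw [imperfectCost, unbalancedCost, if_neg hz, if_neg hp, if_neg hz, if_neg hb]
    nlinarith [Nat.zero_le (G.nextSum z (G.unbalancedCost z) u R),
      Nat.zero_le (G.nextSum z (G.nextSum z (G.unbalancedCost z)) u R),
      Nat.zero_le (G.pathCount z u R * (G.fwd u R).card), Nat.zero_le (G.pathCount z u R)]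

theorem accum_imperfectCost_le (u : V) (R : Finset V) :
    G.accum z (G.imperfectCost z) u R ≤ 324 * G.accum z (G.unbalancedCost z) u R := by
  refine (accum_mono imperfectCost_le u R).trans ?_
  rw [accum_mul, accum_add, accum_add]
  have h1 := accum_nextSum_le (G := G) (z := z) (G.unbalancedCost z) u R
  have h2 := accum_nextSum_le (G := G) (z := z) (G.nextSum z (G.unbalancedCost z)) u R
  omega

/-! ### The entropy bound -/

theorem log_ge_one_sub_inv {x : ℝ} (hx : 0 < x) : 1 - x⁻¹ ≤ Real.log x := by
  have := Real.log_le_sub_one_of_pos (inv_pos.mpr hx)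
  rw [Real.log_inv] at this
  linarith

/-- Gibbs' inequality for the weights `a i / A`, multiplied by `A` to avoid normalisation. Zero
weights are harmless. -/
theorem gibbs {ι : Type*} (s : Finset ι) (a q : ι → ℝ) (ha : ∀ i ∈ s, 0 ≤ a i)
    (hq : ∀ i ∈ s, 0 < q i) (hq1 : ∑ i ∈ s, q i ≤ 1) :
    ∑ i ∈ s, a i * (Real.log (∑ j ∈ s, a j) - Real.log (a i)) ≤
      ∑ i ∈ s, a i * (- Real.log (q i)) := by
  set A := ∑ j ∈ s, a j with hA
  have hA0 : 0 ≤ A := Finset.sum_nonneg ha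
  have key : ∀ i ∈ s, a i * (Real.log A - Real.log (a i)) - a i * (- Real.log (q i))
      ≤ A * q i - a i := by
    intro i hi
    rcases (ha i hi).eq_or_lt with h | h
    · rw [← h]
      have := mul_nonneg hA0 (hq i hi).le
      simp only [zero_mul, sub_zero]
      linarith
    · have hAp : 0 < A := h.trans_le (Finset.single_le_sum ha hi)
      have := Real.log_le_sub_one_of_pos (show 0 < A * q i / a i by
        have := hq i hi; positivity)
      rw [Real.log_div (mul_pos hAp (hq i hi)).ne' h.ne', Real.log_mul hAp.ne' (hq i hi).ne'] at this
      have h2 := mul_le_mul_of_nonneg_left this h.le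
      have h3 : a i * (A * q i / a i - 1) = A * q i - a i := by field_simp
      rw [h3] at h2
      linarith
  have := Finset.sum_le_sum key
  rw [Finset.sum_sub_distrib, Finset.sum_sub_distrib, ← Finset.mul_sum, ← hA] at this
  nlinarith

/-- Among positive integers `d * log 3 / 3 - log d` vanishes only at `d = 3` and grows linearly, so
a constant multiple of it pays for the cost `d + 1`. Small `d` follow from `log x ≥ 1 - 1 / x` with
`x = 3 ^ d / d ^ 3`. -/
theorem log_le_of_ne_three {d : ℕ} (h1 : 1 ≤ d) (h3 : d ≠ 3) :
    (d + 1 : ℝ) ≤ 100 * (d * (Real.log 3 / 3) - Real.log d) := by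
  have hl3 : 1 ≤ Real.log 3 := by
    rw [Real.le_log_iff_exp_le (by norm_num)]
    have := Real.exp_one_lt_d9
    linarith
  have small : ∀ (d : ℕ) (x : ℝ), 1 ≤ d → x = 3 ^ d / d ^ 3 → 3 * (d + 1 : ℝ) ≤ 100 * (1 - x⁻¹) →
      (d + 1 : ℝ) ≤ 100 * (d * (Real.log 3 / 3) - Real.log d) := by
    intro d x hd hx h
    have hd' : (0 : ℝ) < d := by exact_mod_cast hd
    have hxp : 0 < x := by rw [hx]; positivity
    have := log_ge_one_sub_inv hxp
    rw [hx, Real.log_div (by positivity) (by positivity), Real.log_pow, Real.log_pow, ← hx] at this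
    push_cast at this
    linarith
  have big : ∀ e : ℕ, ((e + 5 : ℕ) + 1 : ℝ) ≤
      100 * ((e + 5 : ℕ) * (Real.log 3 / 3) - Real.log (e + 5 : ℕ)) := by
    intro e
    induction e with
    | zero => exact small 5 _ (by norm_num) rfl (by norm_num)
    | succ e ih =>
      have hp : (0 : ℝ) < (e + 5 : ℕ) := by positivity
      have hq : (0 : ℝ) < (e + 1 + 5 : ℕ) := by positivity
      have := Real.log_le_sub_one_of_pos (div_pos hq hp)
      rw [Real.log_div hq.ne' hp.ne'] at this
      have h5 : ((e + 1 + 5 : ℕ) : ℝ) / (e + 5 : ℕ) - 1 ≤ 1 / 5 := by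
        rw [sub_le_iff_le_add, div_le_iff₀ hp]
        push_cast
        have : (0 : ℝ) ≤ e := by positivity
        linarith
      push_cast at *
      nlinarith
  rcases lt_or_ge d 5 with h | h
  · interval_cases d
    · exact small 1 _ (by norm_num) rfl (by norm_num)
    · exact small 2 _ (by norm_num) rfl (by norm_num)
    · exact absurd rfl h3
    · exact small 4 _ (by norm_num) rfl (by norm_num)
  · obtain ⟨e, rfl⟩ : ∃ e, d = e + 5 := ⟨d - 5, by omega⟩
    exact big e

/-- The left side increases with `a`, since `log 6 > log (12 / 5)`, so `a = A / 6` is the worst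
case. The gap 4/100 is what the factor 100 needs to pay the cost `3 + 1` of an unbalanced state with
three continuations. -/
theorem log_balanced_gap {a A : ℝ} (ha : 6 * a ≤ A) (hA : 0 ≤ A) :
    a * (- Real.log (1 / 6)) + (A - a) * (- Real.log (5 / 12)) + A * (4 / 100) ≤ A * Real.log 3 := by
  have h6 : Real.log (1 / 6) ≤ Real.log (5 / 12) := Real.log_le_log (by norm_num) (by norm_num)
  have h := log_ge_one_sub_inv (show (0 : ℝ) < 3 ^ 6 * (1 / 6) * (5 / 12) ^ 5 by norm_num)
  rw [Real.log_mul (by norm_num) (by norm_num), Real.log_mul (by norm_num) (by norm_num),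
    Real.log_pow, Real.log_pow] at h
  norm_num at h h6 ⊢
  nlinarith

/-- The logarithm of the path count is the entropy of a uniform random path, a sum of entropies of
single steps. A step with `d` choices has entropy at most `log d ≤ d * log 3 / 3`, and it falls
short by an amount proportional to its cost unless it is balanced. Hence the average cost is at most
proportional to the total deficit `|R| * log 3 / 3 - log A`; the summand 1 pays for the end of the
path. -/
theorem accum_unbalancedCost_le (u : V) (R : Finset V) :
    (G.accum z (G.unbalancedCost z) u R : ℝ) ≤ 100 * (G.pathCount z u R *
      (R.card * (Real.log 3 / 3) - Real.log (G.pathCount z u R) + 1)) := by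
  classical
  have hl3 : 1 ≤ Real.log 3 := by
    rw [Real.le_log_iff_exp_le (by norm_num)]
    have := Real.exp_one_lt_d9
    linarith
  induction u, R using fwd_induction (G := G) with
  | h u R ih =>
    by_cases hz : G.Adj u z
    · rw [accum_of_adj hz, pathCount_of_adj hz, unbalancedCost, if_pos hz]
      push_cast
      rw [Real.log_one]
      have : (0 : ℝ) ≤ R.card := by positivity
      nlinarith
    · rw [accum_of_not_adj hz]
      push_cast
      set a : V → ℝ := fun w => (G.pathCount z w (G.rem u R) : ℝ) with ha
      have hA : (G.pathCount z u R : ℝ) = ∑ w ∈ G.fwd u R, a w := by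
        rw [pathCount_of_not_adj hz]; push_cast; rfl
      set A := (G.pathCount z u R : ℝ) with hAdef
      have ha0 : ∀ w ∈ G.fwd u R, 0 ≤ a w := fun w _ => by positivity
      have hA0 : 0 ≤ A := by positivity
      have hcard : ((G.fwd u R).card : ℝ) + (G.rem u R).card = R.card := by
        exact_mod_cast card_fwd_add_card_rem (G := G) u R
      set d := ((G.fwd u R).card : ℝ) with hd
      have hsum : ∑ w ∈ G.fwd u R, (G.accum z (G.unbalancedCost z) w (G.rem u R) : ℝ) ≤
          100 * (∑ w ∈ G.fwd u R, a w * (Real.log A - Real.log (a w)) +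
            A * ((G.rem u R).card * (Real.log 3 / 3) - Real.log A + 1)) := by
        refine (Finset.sum_le_sum ih).trans (le_of_eq ?_)
        rw [← Finset.mul_sum, hA, Finset.sum_mul, ← Finset.sum_add_distrib]
        congr 1
        refine Finset.sum_congr rfl fun w _ => ?_
        ring
      have hcost : (G.unbalancedCost z u R : ℝ) + 100 * ∑ w ∈ G.fwd u R,
          a w * (Real.log A - Real.log (a w)) ≤ 100 * (A * (d * (Real.log 3 / 3))) := by
        rcases hA0.eq_or_lt with h0 | hpos
        · have hn : G.pathCount z u R = 0 := by
            have : (G.pathCount z u R : ℝ) = 0 := h0.symm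
            exact_mod_cast this
          have hw0 : ∀ w ∈ G.fwd u R, a w = 0 := by
            rw [← h0] at hA
            exact fun w hw => (Finset.sum_eq_zero_iff_of_nonneg ha0).mp hA.symm w hw
          rw [unbalancedCost, if_neg hz, hn, Finset.sum_eq_zero fun w hw => by rw [hw0 w hw, zero_mul],
            ← h0]
          simp
        · have hdpos : 0 < (G.fwd u R).card := by
            rw [Finset.card_pos]
            by_contra he
            rw [Finset.not_nonempty_iff_eq_empty] at he
            rw [hA, he] at hpos
            simp at hpos
          have hdpos' : 0 < d := by rw [hd]; exact_mod_cast hdpos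
          have hunif := gibbs (G.fwd u R) a (fun _ => d⁻¹) ha0 (fun _ _ => by positivity)
            (by rw [Finset.sum_const, nsmul_eq_mul, ← hd, mul_inv_cancel₀ hdpos'.ne'])
          rw [← hA, ← Finset.sum_mul, ← hA, Real.log_inv, neg_neg] at hunif
          by_cases hd3 : (G.fwd u R).card = 3
          · have hd3' : d = 3 := by rw [hd, hd3]; norm_num
            by_cases hb : G.IsBalanced z u R
            · rw [unbalancedCost, if_neg hz, if_pos hb, hd3']
              rw [hd3'] at hunif
              push_cast
              linarith
            · have : ∃ w ∈ G.fwd u R, 6 * a w ≤ A := by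
                by_contra! hcon
                refine hb ⟨hd3, fun w hw => ?_⟩
                have := (hcon w hw).le
                simp only [ha, hAdef] at this
                exact_mod_cast this
              obtain ⟨w₀, hw₀, h6⟩ := this
              have hcard2 : (((G.fwd u R).erase w₀).card : ℝ) = 2 := by
                rw [Finset.card_erase_of_mem hw₀, hd3]; norm_num
              -- The comparison distribution gives 1/6 to the light continuation and splits the
              -- remaining 5/6 equally between the other two.
              have hg := gibbs (G.fwd u R) a (fun w => if w = w₀ then 1 / 6 else 5 / 12) ha0
                (fun w _ => by split_ifs <;> norm_num) (by
                  rw [← Finset.add_sum_erase _ _ hw₀, if_pos rfl,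
                    Finset.sum_congr rfl fun w hw => if_neg (Finset.ne_of_mem_erase hw),
                    Finset.sum_const, nsmul_eq_mul, hcard2]
                  norm_num)
              rw [← hA] at hg
              rw [← Finset.add_sum_erase _ (fun i => a i * -Real.log (if i = w₀ then 1 / 6 else 5 / 12))
                hw₀] at hg
              simp only [if_true] at hg
              rw [Finset.sum_congr (rfl : (G.fwd u R).erase w₀ = _) fun w hw => by
                rw [if_neg (Finset.ne_of_mem_erase hw)], ← Finset.sum_mul] at hg
              have he : ∑ w ∈ (G.fwd u R).erase w₀, a w = A - a w₀ := by
                rw [hA, ← Finset.add_sum_erase _ _ hw₀]; ring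
              rw [he] at hg
              have hgap := log_balanced_gap h6 hA0
              rw [unbalancedCost, if_neg hz, if_neg hb, hd3, hd3']
              push_cast
              rw [← hAdef]
              linarith
          · have hl := log_le_of_ne_three hdpos hd3
            rw [← hd] at hl
            have hb : ¬ G.IsBalanced z u R := fun h => hd3 h.card
            rw [unbalancedCost, if_neg hz, if_neg hb]
            push_cast
            rw [← hAdef, ← hd]
            have := mul_le_mul_of_nonneg_left hl hA0
            linarith
      rw [← hcard]
      nlinarith

end SimpleGraph

/-! ### Missed vertices and siblings with different continuations -/

namespace SimpleGraph

variable {V : Type*} [DecidableEq V] {G : SimpleGraph V} [DecidableRel G.Adj] {z : V}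

open scoped Classical in
/-- The number of paths for which `q` is never removed, or removed in a state that is not
perfect: the contribution of a single state. -/
noncomputable def missCost (G : SimpleGraph V) [DecidableRel G.Adj] (z q u : V)
    (R : Finset V) : ℕ :=
  if q ∈ R ∧ (G.Adj u z ∨ G.Adj u q ∧ ¬ G.IsPerfect z u R) then G.pathCount z u R else 0

/-- The number of induced paths from `u` to `z` in `R` for which `q` is never removed, or removed
in a state that is not perfect. -/
noncomputable def missCount (G : SimpleGraph V) [DecidableRel G.Adj] (z q u : V)
    (R : Finset V) : ℕ :=
  G.accum z (G.missCost z q) u R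

/-- Double counting: an imperfect state removes `|fwd u R|` vertices on each of its paths, and a
final state leaves `|R|` vertices that are never removed. -/
theorem sum_missCount [Fintype V] (u : V) (R : Finset V) :
    ∑ q, G.missCount z q u R = G.accum z (G.imperfectCost z) u R := by
  classical
  unfold missCount
  rw [accum_sum]
  congr 1
  funext u R
  simp only [missCost]
  rw [← Finset.sum_filter, Finset.sum_const, smul_eq_mul, imperfectCost]
  split_ifs with h1 h2
  · rw [pathCount_of_adj h1, mul_one]
    congr 1
    ext q
    simp [h1]
  · simp [h1, h2]
  · rw [mul_comm]
    congr 2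
    ext q
    simp [h1, h2]

theorem missCount_of_adj {q u : V} {R : Finset V} (hz : G.Adj u z) (hq : q ∈ R) :
    G.missCount z q u R = G.pathCount z u R := by
  rw [missCount, accum_of_adj hz, missCost, if_pos ⟨hq, Or.inl hz⟩]

theorem missCount_of_not_adj {q u : V} {R : Finset V} (hz : ¬ G.Adj u z) :
    G.missCount z q u R = G.missCost z q u R + ∑ w ∈ G.fwd u R, G.missCount z q w (G.rem u R) := by
  rw [missCount, accum_of_not_adj hz]
  rfl

theorem pathCount_le_missCount {q u : V} {R : Finset V} (hq : q ∈ R) (hu : G.Adj u q)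
    (hp : ¬ G.IsPerfect z u R) : G.pathCount z u R ≤ G.missCount z q u R := by
  rw [missCount, accum_eq_add_nextSum, missCost, if_pos ⟨hq, Or.inr ⟨hu, hp⟩⟩]
  omega

theorem sum_missCount_le {Q R : Finset V} {u w : V} (hz : ¬ G.Adj u z) (hw : w ∈ G.fwd u R) :
    ∑ q ∈ Q, G.missCount z q w (G.rem u R) ≤ ∑ q ∈ Q, G.missCount z q u R := by
  refine Finset.sum_le_sum fun q _ => ?_
  rw [missCount_of_not_adj hz]
  have := Finset.single_le_sum (f := fun w => G.missCount z q w (G.rem u R))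
    (fun _ _ => Nat.zero_le _) hw
  omega

/-- If each vertex of `Q ∩ R` has at most three neighbours in `R ∪ {u}` outside `Q`, then a constant
fraction of the paths misses a vertex of `Q`. -/
theorem pathCount_le_sum_missCount {Q : Finset V} (hQ : Q.card ≤ 3) (u : V) (R : Finset V)
    (hu : u ∉ Q) (hne : (Q ∩ R).Nonempty)
    (hdeg : ∀ q ∈ Q ∩ R, (G.fwd q (insert u R \ Q)).card ≤ 3) (huR : u ∉ R) :
    G.pathCount z u R ≤ 6 ^ ((Q ∩ R).card - 1) * ∑ q ∈ Q ∩ R, G.missCount z q u R := by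
  induction u, R using fwd_induction (G := G) with
  | h u R ih =>
    by_cases hz : G.Adj u z
    · obtain ⟨q, hq⟩ := hne
      have h1 := Finset.single_le_sum (f := fun q => G.missCount z q u R)
        (fun _ _ => Nat.zero_le _) hq
      rw [missCount_of_adj hz (Finset.mem_inter.mp hq).2] at h1
      exact h1.trans (Nat.le_mul_of_pos_left _ (by positivity))
    have hdeg' : ∀ w ∈ G.fwd u R, ∀ q ∈ Q ∩ G.rem u R,
        (G.fwd q (insert w (G.rem u R) \ Q)).card ≤ 3 := by
      intro w hw q hq
      rw [Finset.mem_inter, mem_rem] at hq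
      refine le_trans (Finset.card_le_card ?_) (hdeg q (Finset.mem_inter.mpr ⟨hq.1, hq.2.1⟩))
      intro x hx
      rw [mem_fwd, Finset.mem_sdiff, Finset.mem_insert, mem_rem] at hx
      rw [mem_fwd, Finset.mem_sdiff, Finset.mem_insert]
      rw [mem_fwd] at hw
      refine ⟨⟨Or.inr ?_, hx.1.2⟩, hx.2⟩
      rcases hx.1.1 with rfl | h
      · exact hw.1
      · exact h.1
    by_cases htouch : ∃ q ∈ Q ∩ R, G.Adj u q
    · by_cases hp : G.IsPerfect z u R
      · -- some continuation avoids `Q` but a vertex of `Q` survives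
        have hsurv : ∃ q ∈ Q ∩ R, ¬ G.Adj u q := by
          by_contra! hcon
          obtain ⟨q, hq, huq⟩ := htouch
          have hqR := Finset.mem_inter.mp hq
          have h3 := hp.child q (by simp [hqR.2, huq])
          -- If all of `Q ∩ R` were removed at once, the three continuations of `q` would lie
          -- outside `Q`, and `u` would be a fourth neighbour of `q`, against `hdeg`.
          have hlt : (G.fwd q (G.rem u R)).card < (G.fwd q (insert u R \ Q)).card := by
            refine Finset.card_lt_card (Finset.ssubset_iff_of_subset ?_ |>.mpr ⟨u, ?_, ?_⟩)
            · intro x hx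
              rw [mem_fwd, mem_rem] at hx
              rw [mem_fwd, Finset.mem_sdiff, Finset.mem_insert]
              refine ⟨⟨Or.inr hx.1.1, fun hxQ => ?_⟩, hx.2⟩
              exact hx.1.2 (hcon x (Finset.mem_inter.mpr ⟨hxQ, hx.1.1⟩))
            · simp [hu, huq.symm]
            · simp [huR]
          have := hdeg q hq
          omega
        have hcardlt : ((Q ∩ R).filter (G.Adj u)).card < (Q ∩ R).card := by
          obtain ⟨q, hq, hnq⟩ := hsurv
          exact Finset.card_lt_card (Finset.filter_ssubset.mpr ⟨q, hq, hnq⟩)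
        have hQR : (Q ∩ R).card ≤ 3 := (Finset.card_le_card Finset.inter_subset_left).trans hQ
        obtain ⟨w, hw, hwQ⟩ : ∃ w ∈ G.fwd u R, w ∉ (Q ∩ R).filter (G.Adj u) := by
          by_contra! hcon
          have := Finset.card_le_card (show G.fwd u R ⊆ (Q ∩ R).filter (G.Adj u) from hcon)
          rw [hp.card] at this
          omega
        have hw' := hw
        rw [mem_fwd] at hw'
        have hwnQ : w ∉ Q := fun h => hwQ (by simp [h, hw'.1, hw'.2])
        have hrem : Q ∩ G.rem u R = (Q ∩ R).filter fun q => ¬ G.Adj u q := by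
          ext q; simp [and_assoc]
        have hsplit := Finset.card_filter_add_card_filter_not (s := Q ∩ R) (G.Adj u)
        have hpos : 0 < ((Q ∩ R).filter (G.Adj u)).card := by
          obtain ⟨q, hq, huq⟩ := htouch
          exact Finset.card_pos.mpr ⟨q, by simp only [Finset.mem_filter]; exact ⟨hq, huq⟩⟩
        have hI := ih w hw hwnQ (by
          obtain ⟨q, hq, hnq⟩ := hsurv
          exact ⟨q, by rw [hrem, Finset.mem_filter]; exact ⟨hq, hnq⟩⟩) (hdeg' w hw)
          (by simp [hw'.2])
        rw [← hrem] at hsplit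
        -- Moving to `w` costs a factor 6, which is paid for by the loss of at least one vertex of
        -- `Q ∩ R`.
        calc G.pathCount z u R ≤ 6 * G.pathCount z w (G.rem u R) := hp.balanced w hw
          _ ≤ 6 * (6 ^ ((Q ∩ G.rem u R).card - 1) *
                ∑ q ∈ Q ∩ G.rem u R, G.missCount z q w (G.rem u R)) := Nat.mul_le_mul_left _ hI
          _ = 6 ^ ((Q ∩ G.rem u R).card - 1 + 1) *
                ∑ q ∈ Q ∩ G.rem u R, G.missCount z q w (G.rem u R) := by ring
          _ ≤ _ := by
            refine Nat.mul_le_mul (Nat.pow_le_pow_right (by norm_num) ?_) ?_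
            · have : 0 < (Q ∩ G.rem u R).card := by omega
              omega
            · refine (sum_missCount_le hz hw).trans (Finset.sum_le_sum_of_subset ?_)
              exact Finset.inter_subset_inter_left (rem_subset _ _)
      · obtain ⟨q, hq, huq⟩ := htouch
        have h1 := Finset.single_le_sum (f := fun q => G.missCount z q u R)
          (fun _ _ => Nat.zero_le _) hq
        have h2 := pathCount_le_missCount (z := z) (Finset.mem_inter.mp hq).2 huq hp
        exact h2.trans (h1.trans (Nat.le_mul_of_pos_left _ (by positivity)))
    · push Not at htouch
      have hrem : Q ∩ G.rem u R = Q ∩ R := by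
        ext q
        simp only [Finset.mem_inter, mem_rem]
        refine ⟨fun h => ⟨h.1, h.2.1⟩, fun h => ⟨h.1, h.2, htouch q (Finset.mem_inter.mpr h)⟩⟩
      rw [pathCount_of_not_adj hz]
      have hle : ∑ w ∈ G.fwd u R, G.pathCount z w (G.rem u R) ≤ ∑ w ∈ G.fwd u R,
          6 ^ ((Q ∩ R).card - 1) * ∑ q ∈ Q ∩ R, G.missCount z q w (G.rem u R) := by
        refine Finset.sum_le_sum fun w hw => ?_
        have hw' := hw
        rw [mem_fwd] at hw'
        have := ih w hw (fun h => htouch w (Finset.mem_inter.mpr ⟨h, hw'.1⟩) hw'.2)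
          (by rw [hrem]; exact hne) (hdeg' w hw) (by simp [hw'.2])
        rwa [hrem] at this
      refine hle.trans ?_
      rw [← Finset.mul_sum, Finset.sum_comm]
      refine Nat.mul_le_mul_left _ (Finset.sum_le_sum fun q _ => ?_)
      rw [missCount_of_not_adj hz]
      omega

/-- If `Q` is a set of three vertices that could be the set of continuations, but is not, then a
constant fraction of the paths misses a vertex of `Q`. -/
theorem pathCount_le_sum_missCount_of_ne {Q : Finset V} (hQ : Q.card = 3) (u : V) (R : Finset V)
    (hQR : Q ⊆ R) (hdeg : ∀ q ∈ Q, (G.fwd q (R \ Q)).card ≤ 3) (hne : Q ≠ G.fwd u R) :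
    G.pathCount z u R ≤ 36 * ∑ q ∈ Q, G.missCount z q u R := by
  have hQne : Q.Nonempty := Finset.card_pos.mp (by omega)
  by_cases hz : G.Adj u z
  · obtain ⟨q, hq⟩ := hQne
    have h1 := Finset.single_le_sum (f := fun q => G.missCount z q u R)
      (fun _ _ => Nat.zero_le _) hq
    rw [missCount_of_adj hz (hQR hq)] at h1
    omega
  -- After one step the current vertex belongs to `R`, so the degree bound in `R \ Q` already
  -- includes it. At the start `u` itself is not counted, and `Q ≠ fwd u R` takes over its role.
  have hdeg' : ∀ w ∈ G.fwd u R, ∀ q ∈ Q ∩ G.rem u R,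
      (G.fwd q (insert w (G.rem u R) \ Q)).card ≤ 3 := by
    intro w hw q hq
    refine le_trans (Finset.card_le_card ?_) (hdeg q (Finset.mem_inter.mp hq).1)
    intro x hx
    rw [mem_fwd, Finset.mem_sdiff, Finset.mem_insert, mem_rem] at hx
    rw [mem_fwd, Finset.mem_sdiff]
    rw [mem_fwd] at hw
    refine ⟨⟨?_, hx.1.2⟩, hx.2⟩
    rcases hx.1.1 with rfl | h
    · exact hw.1
    · exact h.1
  have hrem : Q ∩ G.rem u R = Q.filter fun q => ¬ G.Adj u q := by
    ext q
    simp only [Finset.mem_inter, mem_rem, Finset.mem_filter]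
    exact ⟨fun h => ⟨h.1, h.2.2⟩, fun h => ⟨h.1, hQR h.1, h.2⟩⟩
  have hsplit := Finset.card_filter_add_card_filter_not (s := Q) (G.Adj u)
  rw [← hrem] at hsplit
  have hstep : ∀ w ∈ G.fwd u R, w ∉ Q → (Q ∩ G.rem u R).Nonempty →
      G.pathCount z w (G.rem u R) ≤ 6 ^ ((Q ∩ G.rem u R).card - 1) *
        ∑ q ∈ Q, G.missCount z q w (G.rem u R) := by
    intro w hw hwQ hn
    have hw' := hw
    rw [mem_fwd] at hw'
    refine (pathCount_le_sum_missCount hQ.le w _ hwQ hn (hdeg' w hw) (by simp [hw'.2])).trans ?_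
    exact Nat.mul_le_mul_left _ (Finset.sum_le_sum_of_subset Finset.inter_subset_left)
  by_cases htouch : ∃ q ∈ Q, G.Adj u q
  · obtain ⟨q, hq, huq⟩ := htouch
    by_cases hp : G.IsPerfect z u R
    · have hpos : 0 < (Q.filter (G.Adj u)).card := Finset.card_pos.mpr ⟨q, by simp [hq, huq]⟩
      -- If `u` were adjacent to all of `Q`, then `Q` would be contained in the three-element set
      -- `fwd u R` and equal to it.
      have hlt : (Q.filter (G.Adj u)).card < 3 := by
        by_contra! hge
        have h1 : Q.filter (G.Adj u) = Q :=
          Finset.eq_of_subset_of_card_le (Finset.filter_subset _ _) (by omega)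
        refine hne (Finset.eq_of_subset_of_card_le ?_ (by rw [hp.card, hQ]))
        intro x hx
        have := hx
        rw [← h1, Finset.mem_filter] at this
        simp [hQR hx, this.2]
      obtain ⟨w, hw, hwQ⟩ : ∃ w ∈ G.fwd u R, w ∉ Q.filter (G.Adj u) := by
        by_contra! hcon
        have := Finset.card_le_card (show G.fwd u R ⊆ Q.filter (G.Adj u) from hcon)
        rw [hp.card] at this
        omega
      have hw' := hw
      rw [mem_fwd] at hw'
      have h1 := hstep w hw (fun h => hwQ (by simp [h, hw'.2])) (Finset.card_pos.mp (by omega))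
      have h2 := hp.balanced w hw
      have h3 := sum_missCount_le (Q := Q) hz hw
      have h4 : 6 ^ ((Q ∩ G.rem u R).card - 1) ≤ 6 ^ 1 :=
        Nat.pow_le_pow_right (by norm_num) (by omega)
      calc G.pathCount z u R ≤ 6 * (6 ^ 1 * ∑ q ∈ Q, G.missCount z q u R) :=
            h2.trans (Nat.mul_le_mul_left _ (h1.trans (Nat.mul_le_mul h4 h3)))
        _ = _ := by ring
    · have h1 := Finset.single_le_sum (f := fun q => G.missCount z q u R)
        (fun _ _ => Nat.zero_le _) hq
      have h2 := pathCount_le_missCount (z := z) (hQR hq) huq hp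
      omega
  · push Not at htouch
    have hrem' : Q ∩ G.rem u R = Q := by
      rw [hrem, Finset.filter_true_of_mem htouch]
    rw [hrem', hQ] at hstep
    rw [pathCount_of_not_adj hz]
    refine (Finset.sum_le_sum fun w hw => hstep w hw (fun h => ?_) hQne).trans ?_
    · rw [mem_fwd] at hw
      exact htouch w h hw.2
    · rw [← Finset.mul_sum, Finset.sum_comm]
      refine Nat.mul_le_mul_left _ (Finset.sum_le_sum fun q _ => ?_)
      rw [missCount_of_not_adj hz]
      omega

/-- The number of siblings of `w` whose continuations differ from those of `w`. -/
def discord (G : SimpleGraph V) [DecidableRel G.Adj] (u w : V) (R : Finset V) : ℕ :=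
  ((G.fwd u R).filter fun v => G.fwd v (G.rem u R) ≠ G.fwd w (G.rem u R)).card

open scoped Classical in
/-- The number of discordant pairs of siblings in a perfect state, weighted with paths. -/
noncomputable def discordCost (G : SimpleGraph V) [DecidableRel G.Adj] (z u : V)
    (R : Finset V) : ℕ :=
  if G.Adj u z ∨ ¬ G.IsPerfect z u R then 0 else
    ∑ w ∈ G.fwd u R, G.discord u w R * G.pathCount z w (G.rem u R)

theorem sum_sum_missCount_fwd [Fintype V] (S : Finset V) (w : V) (R : Finset V) :
    ∑ v ∈ S, ∑ q ∈ G.fwd v R, G.missCount z q w R =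
      ∑ q ∈ R, (G.fwd q S).card * G.missCount z q w R := by
  simp only [fwd, Finset.sum_filter]
  rw [Finset.sum_comm]
  refine Finset.sum_congr rfl fun q _ => ?_
  rw [← Finset.sum_filter, Finset.sum_const, smul_eq_mul]
  simp only [G.adj_comm]

/-- For a discordant sibling `v` of `w`, the set `Q` of continuations of `v` is not that of `w`, so
a constant fraction of the paths through `w` misses a vertex of `Q`. Perfectness of `(u, R)` bounds
the degrees outside `Q`: removing `Q` leaves exactly the vertices on which the grandchildren have
three continuations. -/
theorem discord_mul_pathCount_le [Fintype V] {u : V} {R : Finset V} (hp : G.IsPerfect z u R)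
    (w : V) :
    G.discord u w R * G.pathCount z w (G.rem u R) ≤
      36 * ∑ q, (G.fwd q (G.fwd u R)).card * G.missCount z q w (G.rem u R) := by
  calc G.discord u w R * G.pathCount z w (G.rem u R)
      ≤ ∑ v ∈ G.fwd u R with G.fwd v (G.rem u R) ≠ G.fwd w (G.rem u R),
          36 * ∑ q ∈ G.fwd v (G.rem u R), G.missCount z q w (G.rem u R) := by
        rw [discord, ← smul_eq_mul]
        refine Finset.card_nsmul_le_sum _ _ _ fun v hv => ?_
        rw [Finset.mem_filter] at hv
        refine pathCount_le_sum_missCount_of_ne (hp.child v hv.1) w _ (Finset.filter_subset _ _)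
          (fun q hq => ?_) hv.2
        have hsdiff : G.rem u R \ G.fwd v (G.rem u R) = G.rem v (G.rem u R) := by
          ext x
          simp only [Finset.mem_sdiff, mem_rem, mem_fwd]
          tauto
        rw [hsdiff]
        exact (hp.grandchild v hv.1 q hq).le
    _ ≤ ∑ v ∈ G.fwd u R, 36 * ∑ q ∈ G.fwd v (G.rem u R), G.missCount z q w (G.rem u R) :=
        Finset.sum_le_sum_of_subset (Finset.filter_subset _ _)
    _ ≤ _ := by
        rw [← Finset.mul_sum, sum_sum_missCount_fwd]
        exact Nat.mul_le_mul_left _ (Finset.sum_le_sum_of_subset (Finset.subset_univ _))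

/-- A missed vertex `q` is charged once for each neighbour among the siblings. The sibling sets
along a path are disjoint, so the weights `|fwd q (fwd u R)|` and `|fwd q (rem u R)|` add up to
`|fwd q R|`, and the total charge is bounded by the degree of `q`. -/
theorem accum_discordCost_le_sum [Fintype V] (u : V) (R : Finset V) :
    G.accum z (G.discordCost z) u R ≤ 36 * ∑ q, (G.fwd q R).card * G.missCount z q u R := by
  induction u, R using fwd_induction (G := G) with
  | h u R ih =>
    by_cases hz : G.Adj u z
    · rw [accum_of_adj hz, discordCost, if_pos (Or.inl hz)]
      omega
    · rw [accum_of_not_adj hz]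
      have hd : G.discordCost z u R ≤ ∑ w ∈ G.fwd u R,
          36 * ∑ q, (G.fwd q (G.fwd u R)).card * G.missCount z q w (G.rem u R) := by
        rw [discordCost]
        split_ifs with h
        · exact Nat.zero_le _
        · push Not at h
          exact Finset.sum_le_sum fun w _ => discord_mul_pathCount_le h.2 w
      refine (Nat.add_le_add hd (Finset.sum_le_sum ih)).trans ?_
      rw [← Finset.sum_add_distrib]
      have hsplit : ∀ q, (G.fwd q (G.fwd u R)).card + (G.fwd q (G.rem u R)).card =
          (G.fwd q R).card := by
        intro q
        rw [← Finset.card_filter_add_card_filter_not (s := G.fwd q R) (G.Adj u)]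
        simp only [fwd, rem, Finset.filter_filter, and_comm]
      simp only [← mul_add, ← Finset.sum_add_distrib, ← add_mul, hsplit]
      rw [← Finset.mul_sum, Finset.sum_comm]
      refine Nat.mul_le_mul_left _ (Finset.sum_le_sum fun q _ => ?_)
      rw [← Finset.mul_sum, missCount_of_not_adj hz]
      exact Nat.mul_le_mul_left _ (by omega)

theorem accum_discordCost_le [Fintype V] {Δ : ℕ} (hΔ : ∀ v, (G.fwd v Finset.univ).card ≤ Δ) (u : V)
    (R : Finset V) : G.accum z (G.discordCost z) u R ≤
      36 * Δ * G.accum z (G.imperfectCost z) u R := by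
  refine (accum_discordCost_le_sum u R).trans ?_
  rw [← sum_missCount, mul_assoc, Finset.mul_sum (a := Δ)]
  refine Nat.mul_le_mul_left _ (Finset.sum_le_sum fun q _ => Nat.mul_le_mul_right _ ?_)
  exact (Finset.card_le_card (Finset.filter_subset_filter _ (Finset.subset_univ _))).trans (hΔ q)

end SimpleGraph

/-! ### From a cheap path to a long stretch -/

namespace SimpleGraph

variable {V : Type*} [DecidableEq V] {G : SimpleGraph V} [DecidableRel G.Adj] {z : V}

open scoped Classical in
/-- The cost of continuing a path from the state `(u, R)` to `w`. -/
noncomputable def stepCost (G : SimpleGraph V) [DecidableRel G.Adj] (z u : V) (R : Finset V)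
    (w : V) : ℕ :=
  if G.IsPerfect z u R then G.discord u w R else (G.fwd u R).card

/-- Distributing the cost of a state over its continuations turns the accumulated cost into an
average over paths of a sum of step costs. -/
theorem imperfectCost_add_discordCost {u : V} {R : Finset V} (hz : ¬ G.Adj u z) :
    G.imperfectCost z u R + G.discordCost z u R =
      ∑ w ∈ G.fwd u R, G.stepCost z u R w * G.pathCount z w (G.rem u R) := by
  by_cases hp : G.IsPerfect z u R
  · simp [imperfectCost, discordCost, stepCost, hz, hp]
  · simp only [imperfectCost, discordCost, stepCost, hz, hp, not_false_eq_true, or_true, if_true,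
      if_false, add_zero]
    rw [← Finset.mul_sum, ← pathCount_of_not_adj hz, mul_comm]

/-- Some path has at most the average cost. -/
theorem exists_path_of_accum_le (u : V) (R : Finset V) (K : ℕ) (hA : 0 < G.pathCount z u R)
    (hK : G.accum z (G.imperfectCost z) u R + G.accum z (G.discordCost z) u R ≤
      K * G.pathCount z u R) :
    ∃ (T : ℕ) (p : ℕ → V) (Q : ℕ → Finset V), p 0 = u ∧ Q 0 = R ∧
      (∀ l < T, p (l + 1) ∈ G.fwd (p l) (Q l) ∧ Q (l + 1) = G.rem (p l) (Q l)) ∧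
      ∑ l ∈ Finset.range T, G.stepCost z (p l) (Q l) (p (l + 1)) + (Q T).card ≤ K := by
  induction u, R using fwd_induction (G := G) generalizing K with
  | h u R ih =>
    by_cases hz : G.Adj u z
    · refine ⟨0, fun _ => u, fun _ => R, rfl, rfl, by simp, ?_⟩
      rw [accum_of_adj hz, accum_of_adj hz, pathCount_of_adj hz, imperfectCost, if_pos hz] at hK
      simp only [Finset.range_zero, Finset.sum_empty]
      omega
    · have hex : ∃ w ∈ G.fwd u R, 0 < G.pathCount z w (G.rem u R) ∧
          G.stepCost z u R w * G.pathCount z w (G.rem u R) +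
            (G.accum z (G.imperfectCost z) w (G.rem u R) +
              G.accum z (G.discordCost z) w (G.rem u R)) ≤ K * G.pathCount z w (G.rem u R) := by
        by_contra! hcon
        have hle : ∀ w ∈ G.fwd u R, K * G.pathCount z w (G.rem u R) ≤
            G.stepCost z u R w * G.pathCount z w (G.rem u R) +
            (G.accum z (G.imperfectCost z) w (G.rem u R) +
              G.accum z (G.discordCost z) w (G.rem u R)) := by
          intro w hw
          rcases Nat.eq_zero_or_pos (G.pathCount z w (G.rem u R)) with h0 | h0
          · rw [h0]; omega
          · exact (hcon w hw h0).le
        have hlt : ∃ w ∈ G.fwd u R, 0 < G.pathCount z w (G.rem u R) := by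
          by_contra! hzero
          rw [pathCount_of_not_adj hz, Finset.sum_eq_zero fun w hw => by
            have := hzero w hw; omega] at hA
          exact absurd hA (lt_irrefl 0)
        obtain ⟨w, hw, hwp⟩ := hlt
        have := Finset.sum_lt_sum hle ⟨w, hw, hcon w hw hwp⟩
        rw [← Finset.mul_sum, ← pathCount_of_not_adj hz, Finset.sum_add_distrib,
          ← imperfectCost_add_discordCost hz, Finset.sum_add_distrib] at this
        rw [accum_of_not_adj hz, accum_of_not_adj hz] at hK
        omega
      obtain ⟨w, hw, hwp, hwK⟩ := hex
      have hcK : G.stepCost z u R w ≤ K := by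
        by_contra! hlt
        have := Nat.mul_lt_mul_of_pos_right hlt hwp
        omega
      obtain ⟨T, p, Q, hp, hQ, hstep, hcost⟩ := ih w hw (K - G.stepCost z u R w) hwp (by
        rw [Nat.sub_mul]; omega)
      refine ⟨T + 1, fun l => l.casesOn u p, fun l => l.casesOn R Q, rfl, rfl, ?_, ?_⟩
      · intro l hl
        rcases l with _ | l
        · change p 0 ∈ G.fwd u R ∧ Q 0 = G.rem u R
          rw [hp, hQ]
          exact ⟨hw, rfl⟩
        · exact hstep l (by omega)
      · rw [Finset.sum_range_succ']
        change ∑ l ∈ Finset.range T, G.stepCost z (p l) (Q l) (p (l + 1)) +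
          G.stepCost z u R (p 0) + (Q T).card ≤ K
        rw [hp]
        omega

/-- A sequence of `L + 2` triples, consecutive ones completely joined, such that the inner triples
have no neighbours outside the adjacent triples. -/
structure IsStretch (G : SimpleGraph V) (L : ℕ) (E : ℕ → Finset V) : Prop where
  card : ∀ j ≤ L + 1, (E j).card = 3
  disj : ∀ i ≤ L + 1, ∀ j ≤ L + 1, i ≠ j → Disjoint (E i) (E j)
  adj : ∀ j ≤ L, ∀ v ∈ E j, ∀ w ∈ E (j + 1), G.Adj v w
  nbr : ∀ j, 1 ≤ j → j ≤ L → ∀ v ∈ E j, ∀ w, G.Adj v w → w ∈ E (j - 1) ∨ w ∈ E j ∨ w ∈ E (j + 1)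

theorem exists_block_avoiding (s : Finset ℕ) (k m : ℕ) (hs : s.card < m) :
    ∃ i < m, ∀ l ∈ s, l / k ≠ i := by
  by_contra! hcon
  have : Finset.range m ⊆ s.image (· / k) := by
    intro i hi
    obtain ⟨l, hl, hli⟩ := hcon i (by simpa using hi)
    exact Finset.mem_image.mpr ⟨l, hl, hli⟩
  have := (Finset.card_le_card this).trans Finset.card_image_le
  rw [Finset.card_range] at this
  omega

/-- The sets removed along the path are disjoint layers. All but a few vertices lie in good layers,
those of perfect states whose siblings all continue to the next layer. Since degrees are bounded,
few layers contain or touch a bad vertex, so by pigeonhole `L + 2` consecutive layers avoid them;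
these layers form the stretch. -/
theorem exists_stretch_of_path [Fintype V] {Δ K L T : ℕ} {p : ℕ → V} {Q : ℕ → Finset V}
    (hΔ : ∀ v, (G.fwd v Finset.univ).card ≤ Δ)
    (hQ : (Finset.univ \ Q 0).card ≤ Δ + 1)
    (hstep : ∀ l < T, p (l + 1) ∈ G.fwd (p l) (Q l) ∧ Q (l + 1) = G.rem (p l) (Q l))
    (hcost : ∑ l ∈ Finset.range T, G.stepCost z (p l) (Q l) (p (l + 1)) + (Q T).card ≤ K)
    (hV : (Δ + 1 + 3 * K) + 3 * ((L + 2) * ((Δ + 1) * (Δ + 1 + 3 * K) + 1)) ≤ Fintype.card V) :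
    ∃ E, G.IsStretch L E := by
  classical
  set B : ℕ → Finset V := fun l => G.fwd (p l) (Q l) with hB
  set ok : ℕ → Prop := fun l => G.IsPerfect z (p l) (Q l) ∧ G.discord (p l) (p (l + 1)) (Q l) = 0
    with hok
  have hanti : ∀ l l', l ≤ l' → l' ≤ T → Q l' ⊆ Q l := by
    intro l l' h
    induction h with
    | refl => exact fun _ => subset_rfl
    | step h ih =>
      intro hT
      rw [Nat.succ_eq_add_one, (hstep _ hT).2]
      exact (rem_subset _ _).trans (ih (by omega))
  have hBQ : ∀ l l', l < l' → l' ≤ T → ∀ v ∈ B l, v ∉ Q l' := by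
    intro l l' h hT v hv hv'
    have := hanti (l + 1) l' h hT hv'
    rw [(hstep l (by omega)).2, mem_rem] at this
    exact this.2 (mem_fwd.mp hv).2
  have hBuniq : ∀ l l' v, l ≤ T → l' ≤ T → v ∈ B l → v ∈ B l' → l = l' := by
    intro l l' v hl hl' hv hv'
    rcases lt_trichotomy l l' with h | h | h
    · exact absurd (mem_fwd.mp hv').1 (hBQ l l' h hl' v hv)
    · exact h
    · exact absurd (mem_fwd.mp hv).1 (hBQ l' l h hl v hv')
  have hcover : ∀ t ≤ T, ∀ v ∈ Q 0, v ∈ Q t ∨ ∃ l < t, v ∈ B l := by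
    intro t
    induction t with
    | zero => exact fun _ v hv => Or.inl hv
    | succ t ih =>
      intro ht v hv
      rcases ih (by omega) v hv with h | ⟨l, hl, h⟩
      · by_cases hadj : G.Adj (p t) v
        · exact Or.inr ⟨t, by omega, mem_fwd.mpr ⟨h, hadj⟩⟩
        · left
          rw [(hstep t ht).2]
          exact mem_rem.mpr ⟨h, hadj⟩
      · exact Or.inr ⟨l, by omega, h⟩
  have hokB : ∀ l < T, ok l → ∀ v ∈ B l, G.fwd v (Q (l + 1)) = B (l + 1) := by
    intro l hl ho v hv
    have h0 := ho.2
    rw [discord, Finset.card_eq_zero, Finset.filter_eq_empty_iff] at h0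
    have := h0 hv
    rw [not_not, ← (hstep l hl).2] at this
    exact this
  -- The bad vertices: those outside the initial set, those never removed, and those in layers that
  -- are not good. A bad layer contains at most three times as many vertices as its step costs.
  set X : Finset V := (Finset.univ \ Q 0) ∪ Q T ∪ ({l ∈ Finset.range T | ¬ ok l} : Finset ℕ).biUnion B with hX
  have hXcard : X.card ≤ Δ + 1 + 3 * K := by
    have h1 : (({l ∈ Finset.range T | ¬ ok l} : Finset ℕ).biUnion B).card ≤
        3 * ∑ l ∈ Finset.range T, G.stepCost z (p l) (Q l) (p (l + 1)) := by
      rw [Finset.mul_sum]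
      refine Finset.card_biUnion_le.trans ((Finset.sum_le_sum ?_).trans
        (Finset.sum_le_sum_of_subset (Finset.filter_subset _ _)))
      intro l hl
      rw [Finset.mem_filter] at hl
      by_cases hp : G.IsPerfect z (p l) (Q l)
      · have : G.discord (p l) (p (l + 1)) (Q l) ≠ 0 := fun h => hl.2 ⟨hp, h⟩
        have h3 : (B l).card = 3 := hp.card
        rw [stepCost, if_pos hp]
        omega
      · rw [stepCost, if_neg hp]
        exact Nat.le_mul_of_pos_left _ (by omega)
    have h2 := Finset.card_union_le ((Finset.univ \ Q 0) ∪ Q T)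
      (({l ∈ Finset.range T | ¬ ok l} : Finset ℕ).biUnion B)
    have h3 := Finset.card_union_le (Finset.univ \ Q 0) (Q T)
    rw [hX]
    omega
  set S : Finset V := X.biUnion fun y => insert y (G.fwd y Finset.univ) with hS
  have hScard : S.card ≤ (Δ + 1) * (Δ + 1 + 3 * K) := by
    refine (Finset.card_biUnion_le_card_mul _ _ (Δ + 1) fun y _ => ?_).trans ?_
    · exact (Finset.card_insert_le _ _).trans (by have := hΔ y; omega)
    · rw [mul_comm]
      exact Nat.mul_le_mul_left _ hXcard
  set blocked : Finset ℕ := {l ∈ Finset.range T | ∃ v ∈ B l, v ∈ S} with hblocked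
  have hbcard : blocked.card ≤ S.card := by
    have hsub : blocked ⊆ S.biUnion fun v => {l ∈ Finset.range T | v ∈ B l} := by
      intro l hl
      rw [hblocked, Finset.mem_filter] at hl
      obtain ⟨hlT, v, hv, hvS⟩ := hl
      exact Finset.mem_biUnion.mpr ⟨v, hvS, Finset.mem_filter.mpr ⟨hlT, hv⟩⟩
    refine (Finset.card_le_card hsub).trans ((Finset.card_biUnion_le_card_mul _ _ 1 ?_).trans
      (by rw [mul_one]))
    intro v _
    refine Finset.card_le_one.mpr fun l hl l' hl' => ?_
    rw [Finset.mem_filter, Finset.mem_range] at hl hl'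
    exact hBuniq l l' v hl.1.le hl'.1.le hl.2 hl'.2
  have hXS : ∀ v ∈ X, v ∈ S := fun v hv =>
    Finset.mem_biUnion.mpr ⟨v, hv, Finset.mem_insert_self _ _⟩
  have hT : (L + 2) * ((Δ + 1) * (Δ + 1 + 3 * K) + 1) ≤ T := by
    have hsub : (Finset.univ : Finset V) ⊆ X ∪ ({l ∈ Finset.range T | ok l} : Finset ℕ).biUnion B := by
      intro v _
      rw [hX]
      simp only [Finset.mem_union, Finset.mem_sdiff, Finset.mem_univ, true_and, Finset.mem_biUnion,
        Finset.mem_filter, Finset.mem_range]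
      by_cases hv : v ∈ Q 0
      · rcases hcover T le_rfl v hv with h | ⟨l, hl, h⟩
        · tauto
        · by_cases ho : ok l
          · exact Or.inr ⟨l, ⟨hl, ho⟩, h⟩
          · exact Or.inl (Or.inr ⟨l, ⟨hl, ho⟩, h⟩)
      · tauto
    have h1 := (Finset.card_le_card hsub).trans (Finset.card_union_le _ _)
    have h2 : (({l ∈ Finset.range T | ok l} : Finset ℕ).biUnion B).card ≤ T * 3 := by
      refine (Finset.card_biUnion_le_card_mul _ _ 3 fun l hl => ?_).trans
        (Nat.mul_le_mul_right _ ((Finset.card_filter_le _ _).trans (by rw [Finset.card_range])))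
      rw [Finset.mem_filter] at hl
      exact hl.2.1.card.le
    rw [Finset.card_univ] at h1
    omega
  obtain ⟨i, hi, hfree⟩ := exists_block_avoiding blocked (L + 2)
    ((Δ + 1) * (Δ + 1 + 3 * K) + 1) (by omega)
  have hrange : ∀ j ≤ L + 1, (L + 2) * i + j < T := by
    intro j hj
    have : (L + 2) * (i + 1) ≤ (L + 2) * ((Δ + 1) * (Δ + 1 + 3 * K) + 1) :=
      Nat.mul_le_mul_left _ hi
    rw [mul_add, mul_one] at this
    omega
  have hunb : ∀ j ≤ L + 1, ∀ v ∈ B ((L + 2) * i + j), v ∉ S := by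
    intro j hj v hv hvS
    refine hfree ((L + 2) * i + j) (Finset.mem_filter.mpr
      ⟨by simpa using hrange j hj, v, hv, hvS⟩) ?_
    rw [Nat.mul_add_div (by omega), Nat.div_eq_of_lt (by omega), add_zero]
  have hokj : ∀ j ≤ L + 1, ok ((L + 2) * i + j) := by
    intro j hj
    by_contra hno
    have hT' := hrange j hj
    have hmem := (hstep _ hT').1
    refine hunb j hj _ hmem (hXS _ ?_)
    rw [hX]
    refine Finset.mem_union_right _ (Finset.mem_biUnion.mpr ⟨_, ?_, hmem⟩)
    exact Finset.mem_filter.mpr ⟨by simpa using hT', hno⟩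
  refine ⟨fun j => B ((L + 2) * i + j), ?_, ?_, ?_, ?_⟩
  · exact fun j hj => (hokj j hj).1.card
  · intro j hj j' hj' hne
    rw [Finset.disjoint_left]
    intro v hv hv'
    exact hne (by
      have := hBuniq _ _ v (hrange j hj).le (hrange j' hj').le hv hv'
      omega)
  · intro j hj v hv w hw
    have hw' : w ∈ B ((L + 2) * i + j + 1) := hw
    rw [← hokB _ (hrange j (by omega)) (hokj j (by omega)) v hv] at hw'
    exact (mem_fwd.mp hw').2
  · intro j h1 hj v hv w hvw
    set l := (L + 2) * i + j with hl
    have hlT : l < T := hrange j (by omega)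
    have hwX : w ∉ X := fun hwX => hunb j (by omega) v hv (Finset.mem_biUnion.mpr
      ⟨w, hwX, by simp [hvw.symm]⟩)
    have hwX' := hwX
    rw [hX] at hwX'
    simp only [Finset.mem_union, Finset.mem_sdiff, Finset.mem_univ, true_and, Finset.mem_biUnion,
        Finset.mem_filter, Finset.mem_range, not_or, not_not, not_exists, not_and] at hwX'
    obtain ⟨⟨hw0, hwT⟩, hwok⟩ := hwX'
    obtain ⟨l', hl', hwl'⟩ := (hcover T le_rfl w hw0).resolve_left hwT
    have hokl' : ok l' := by
      by_contra hno
      exact hwok l' ⟨hl', hno⟩ hwl'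
    -- A neighbour ahead of layer `l` lies in the next layer because layer `l` is good. A neighbour
    -- behind it is treated from its own good layer `l'`, which forces `l = l' + 1`.
    rcases lt_or_ge l l' with h | h
    · have hwQ : w ∈ Q (l + 1) := hanti (l + 1) l' h hl'.le (mem_fwd.mp hwl').1
      have : w ∈ G.fwd v (Q (l + 1)) := mem_fwd.mpr ⟨hwQ, hvw⟩
      rw [hokB l hlT (hokj j (by omega)) v hv] at this
      exact Or.inr (Or.inr this)
    · rcases h.eq_or_lt with h | h
      · exact Or.inr (Or.inl (h ▸ hwl'))
      · left
        have hvQ : v ∈ Q (l' + 1) := hanti (l' + 1) l h hlT.le (mem_fwd.mp hv).1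
        have : v ∈ G.fwd w (Q (l' + 1)) := mem_fwd.mpr ⟨hvQ, hvw.symm⟩
        rw [hokB l' hl' hokl' w hwl'] at this
        have := hBuniq _ _ v (by omega) hlT.le this hv
        have hl'' : l' = (L + 2) * i + (j - 1) := by omega
        exact hl'' ▸ hwl'

/-- A graph of small maximum degree with nearly the maximum number of induced paths between two
neighbours of a vertex contains a long stretch. -/
theorem exists_stretch [Fintype V] {Δ K L : ℕ} {x y : V}
    (hΔ : ∀ v, (G.fwd v Finset.univ).card ≤ Δ)
    (hA : 0 < G.pathCount z y ((G.rem x Finset.univ).erase x))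
    (hK : 32400 * (36 * Δ + 1) * (((G.rem x Finset.univ).erase x).card * (Real.log 3 / 3) -
      Real.log (G.pathCount z y ((G.rem x Finset.univ).erase x)) + 1) ≤ K)
    (hV : (Δ + 1 + 3 * K) + 3 * ((L + 2) * ((Δ + 1) * (Δ + 1 + 3 * K) + 1)) ≤ Fintype.card V) :
    ∃ E, G.IsStretch L E := by
  set R := (G.rem x Finset.univ).erase x with hR
  -- The factor `32400 = 324 * 100` combines the passages from imperfect to unbalanced cost and from
  -- there to the deficit; discord contributes another `36 * Δ` times the imperfect cost.
  obtain ⟨T, p, Q, -, hQ, hstep, hcost⟩ := exists_path_of_accum_le (G := G) (z := z) y R K hA (by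
    have h1 := accum_discordCost_le (z := z) hΔ y R
    have h2 := accum_imperfectCost_le (G := G) (z := z) y R
    have h3 := accum_unbalancedCost_le (G := G) (z := z) y R
    have h4 : G.accum z (G.imperfectCost z) y R + G.accum z (G.discordCost z) y R ≤
        (36 * Δ + 1) * (324 * G.accum z (G.unbalancedCost z) y R) := by
      refine le_trans ?_ (Nat.mul_le_mul_left _ h2)
      rw [add_mul, one_mul]
      omega
    have h5 : ((G.accum z (G.imperfectCost z) y R + G.accum z (G.discordCost z) y R : ℕ) : ℝ) ≤
        K * G.pathCount z y R := by
      refine le_trans (Nat.cast_le.mpr h4) ?_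
      push_cast
      have hc : (0 : ℝ) ≤ (36 * Δ + 1) * 324 := by positivity
      have h6 := mul_le_mul_of_nonneg_left h3 hc
      have h7 := mul_le_mul_of_nonneg_right hK (Nat.cast_nonneg (α := ℝ) (G.pathCount z y R))
      linarith
    exact_mod_cast h5)
  refine exists_stretch_of_path (z := z) hΔ ?_ hstep hcost hV
  rw [hQ]
  refine le_trans (Finset.card_le_card (t := insert x (G.fwd x Finset.univ)) ?_)
    ((Finset.card_insert_le _ _).trans (Nat.add_le_add_right (hΔ x) 1))
  intro v hv
  rw [hR, Finset.mem_sdiff, Finset.mem_erase, mem_rem] at hv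
  rw [Finset.mem_insert, mem_fwd]
  simp only [Finset.mem_univ, true_and] at hv ⊢
  tauto

end SimpleGraph

/-! ### Induced cycles and their parametrisations -/

namespace SimpleGraph

section Cycles

variable {V : Type*} [DecidableEq V] {G : SimpleGraph V}

/-- `S` is the vertex set of an induced cycle. -/
def IsInducedCycle (G : SimpleGraph V) (S : Finset V) : Prop :=
  ∃ l, 3 ≤ l ∧ Nonempty (G.induce (S : Set V) ≃g cycleGraph l)

/-- `ψ 0, …, ψ (l - 1)` are the consecutive vertices of an induced cycle on `S`. -/
structure IsCycleParam (G : SimpleGraph V) (S : Finset V) (l : ℕ) (ψ : ℕ → V) : Prop where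
  three_le : 3 ≤ l
  inj : ∀ s < l, ∀ t < l, ψ s = ψ t → s = t
  image : S = (Finset.range l).image ψ
  adj : ∀ s t, s < t → t < l → (G.Adj (ψ s) (ψ t) ↔ t = s + 1 ∨ (s = 0 ∧ t + 1 = l))

theorem cycleGraph_adj_of_lt {l : ℕ} {i j : Fin l} (h : i < j) :
    (cycleGraph l).Adj i j ↔ j.val = i.val + 1 ∨ (i.val = 0 ∧ j.val + 1 = l) := by
  have h' : i.val < j.val := h
  rw [cycleGraph_adj', Fin.coe_sub_iff_le.mpr h.le, Fin.coe_sub_iff_lt.mpr h]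
  omega

theorem IsInducedCycle.exists_param {S : Finset V} (h : G.IsInducedCycle S) :
    ∃ l ψ, G.IsCycleParam S l ψ := by
  obtain ⟨l, hl, ⟨e⟩⟩ := h
  have hl0 : 0 < l := by omega
  set ψ : ℕ → V := fun t => (e.symm ⟨t % l, Nat.mod_lt _ hl0⟩).1 with hψ
  have hψ' : ∀ t (ht : t < l), ψ t = (e.symm ⟨t, ht⟩).1 := by
    intro t ht
    simp only [hψ, Nat.mod_eq_of_lt ht]
  refine ⟨l, ψ, hl, ?_, ?_, ?_⟩
  · intro s hs t ht hst
    rw [hψ' s hs, hψ' t ht] at hst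
    have := e.symm.injective (Subtype.ext hst)
    simpa using this
  · ext v
    rw [Finset.mem_image]
    constructor
    · intro hv
      refine ⟨(e ⟨v, hv⟩).val, by simp, ?_⟩
      rw [hψ' _ (e ⟨v, hv⟩).isLt]
      simp
    · rintro ⟨t, ht, rfl⟩
      exact (e.symm _).2
  · intro s t hst ht
    rw [hψ' s (hst.trans ht), hψ' t ht]
    have : G.Adj (e.symm ⟨s, hst.trans ht⟩).1 (e.symm ⟨t, ht⟩).1 ↔
        (G.induce (S : Set V)).Adj (e.symm ⟨s, hst.trans ht⟩) (e.symm ⟨t, ht⟩) := Iff.rfl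
    rw [this, e.symm.map_adj_iff, cycleGraph_adj_of_lt (by simpa using hst)]

theorem IsCycleParam.isInducedCycle {S : Finset V} {l : ℕ} {ψ : ℕ → V}
    (h : G.IsCycleParam S l ψ) : G.IsInducedCycle S := by
  refine ⟨l, h.three_le, ⟨RelIso.symm ?_⟩⟩
  have hmem : ∀ i : Fin l, ψ i ∈ S := fun i => by
    rw [h.image]
    exact Finset.mem_image_of_mem _ (by simp)
  refine ⟨Equiv.ofBijective (fun i : Fin l => (⟨ψ i, hmem i⟩ : (S : Set V))) ⟨?_, ?_⟩, ?_⟩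
  · intro i j hij
    exact Fin.ext (h.inj i i.2 j j.2 (congrArg Subtype.val hij))
  · rintro ⟨v, hv⟩
    have hv' : v ∈ S := hv
    rw [h.image, Finset.mem_image] at hv'
    obtain ⟨t, ht, rfl⟩ := hv'
    exact ⟨⟨t, by simpa using ht⟩, rfl⟩
  · intro i j
    change G.Adj (ψ i) (ψ j) ↔ (cycleGraph l).Adj i j
    rcases lt_trichotomy i j with hij | rfl | hij
    · rw [h.adj i j hij j.2, cycleGraph_adj_of_lt hij]
    · simp
    · rw [G.adj_comm, h.adj j i hij i.2, (cycleGraph l).adj_comm, cycleGraph_adj_of_lt hij]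

theorem IsCycleParam.rotate {S : Finset V} {l : ℕ} {ψ : ℕ → V} (h : G.IsCycleParam S l ψ) {i : ℕ}
    (hi : i < l) : G.IsCycleParam S l fun t => ψ (if i + t < l then i + t else i + t - l) := by
  refine ⟨h.three_le, ?_, ?_, ?_⟩
  · intro s hs t ht hst
    have := h.inj _ (by split_ifs <;> omega) _ (by split_ifs <;> omega) hst
    split_ifs at this <;> omega
  · rw [h.image]
    ext v
    simp only [Finset.mem_image, Finset.mem_range]
    constructor
    · rintro ⟨t, ht, rfl⟩
      refine ⟨if i ≤ t then t - i else t + l - i, by split_ifs <;> omega, ?_⟩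
      congr 1
      split_ifs <;> omega
    · rintro ⟨t, ht, rfl⟩
      exact ⟨_, by split_ifs <;> omega, rfl⟩
  · intro s t hst ht
    have := h.three_le
    split_ifs with h1 h2 h2
    · rw [h.adj _ _ (by omega) (by omega)]; omega
    · rw [G.adj_comm, h.adj _ _ (by omega) (by omega)]; omega
    · omega
    · rw [h.adj _ _ (by omega) (by omega)]; omega

theorem IsCycleParam.reflect {S : Finset V} {l : ℕ} {ψ : ℕ → V} (h : G.IsCycleParam S l ψ) :
    G.IsCycleParam S l fun t => ψ (if t = 0 then 0 else l - t) := by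
  refine ⟨h.three_le, ?_, ?_, ?_⟩
  · intro s hs t ht hst
    have := h.inj _ (by split_ifs <;> omega) _ (by split_ifs <;> omega) hst
    split_ifs at this <;> omega
  · rw [h.image]
    ext v
    simp only [Finset.mem_image, Finset.mem_range]
    constructor
    · rintro ⟨t, ht, rfl⟩
      refine ⟨if t = 0 then 0 else l - t, by split_ifs <;> omega, ?_⟩
      congr 1
      split_ifs <;> omega
    · rintro ⟨t, ht, rfl⟩
      exact ⟨_, by split_ifs <;> omega, rfl⟩
  · intro s t hst ht
    have := h.three_le
    split_ifs with h1 h2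
    · omega
    · rw [h.adj _ _ (by omega) (by omega)]; omega
    · omega
    · rw [G.adj_comm, h.adj _ _ (by omega) (by omega)]; omega

theorem IsInducedCycle.exists_param_of_adj {S : Finset V} (h : G.IsInducedCycle S) {x y : V}
    (hx : x ∈ S) (hy : y ∈ S) (hxy : G.Adj x y) :
    ∃ l ψ, G.IsCycleParam S l ψ ∧ ψ 0 = x ∧ ψ 1 = y := by
  obtain ⟨l, ψ₀, h₀⟩ := h.exists_param
  have hx' := hx
  rw [h₀.image, Finset.mem_image] at hx'
  obtain ⟨i, hi, rfl⟩ := hx'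
  have hi' : i < l := by simpa using hi
  have h₁ := h₀.rotate hi'
  set ψ := fun t => ψ₀ (if i + t < l then i + t else i + t - l) with hψ
  have h0 : ψ 0 = ψ₀ i := by simp [hψ, hi']
  rw [← h0] at hxy
  rw [h₁.image, Finset.mem_image] at hy
  obtain ⟨j, hj, rfl⟩ := hy
  have hj' : j < l := by simpa using hj
  have h3 := h₁.three_le
  have hj0 : 0 < j := by
    rcases Nat.eq_zero_or_pos j with rfl | h
    · exact absurd rfl hxy.ne
    · exact h
  rcases (h₁.adj 0 j hj0 hj').mp hxy with h | h
  · refine ⟨l, ψ, h₁, h0, ?_⟩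
    rw [h]
  · refine ⟨l, _, h₁.reflect, by simpa using h0, ?_⟩
    simp only [one_ne_zero, if_false]
    congr 1
    omega

theorem IsCycleParam.mem {S : Finset V} {l : ℕ} {ψ : ℕ → V} (h : G.IsCycleParam S l ψ) {t : ℕ}
    (ht : t < l) : ψ t ∈ S := by
  rw [h.image]
  exact Finset.mem_image_of_mem _ (by simpa using ht)

theorem IsInducedCycle.exists_adj {S : Finset V} (h : G.IsInducedCycle S) {x : V}
    (hx : x ∈ S) : ∃ y ∈ S, G.Adj x y := by
  obtain ⟨l, ψ, hp⟩ := h.exists_param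
  have h3 := hp.three_le
  rw [hp.image, Finset.mem_image] at hx
  obtain ⟨i, hi, rfl⟩ := hx
  have hi' : i < l := by simpa using hi
  by_cases h1 : i + 1 < l
  · exact ⟨ψ (i + 1), hp.mem h1, (hp.adj i (i + 1) (by omega) h1).mpr (Or.inl rfl)⟩
  · exact ⟨ψ 0, hp.mem (by omega),
      ((hp.adj 0 i (by omega) hi').mpr (Or.inr ⟨rfl, by omega⟩)).symm⟩

/-- Removing a vertex and its two neighbours from an induced cycle leaves the interior of an induced
path. -/
theorem IsInducedCycle.exists_indPath {S : Finset V} (h : G.IsInducedCycle S) {x y : V}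
    (hx : x ∈ S) (hy : y ∈ S) (hxy : G.Adj x y) :
    ∃ z P, G.Adj x z ∧ z ≠ y ∧ S = insert x (insert y (insert z P)) ∧ x ∉ P ∧ y ∉ P ∧ z ∉ P ∧
      (∀ p ∈ P, ¬ G.Adj x p) ∧ IndPath G z y P := by
  obtain ⟨l, ψ, hp, rfl, rfl⟩ := h.exists_param_of_adj hx hy hxy
  have h3 := hp.three_le
  have hnot : ∀ s < l, s ∉ Finset.Ico 2 (l - 1) → ψ s ∉ (Finset.Ico 2 (l - 1)).image ψ := by
    intro s hs hns hmem
    obtain ⟨t, ht, hts⟩ := Finset.mem_image.mp hmem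
    rw [Finset.mem_Ico] at ht
    have := hp.inj t (by omega) s hs hts
    subst this
    exact hns (by simpa using ht)
  refine ⟨ψ (l - 1), (Finset.Ico 2 (l - 1)).image ψ, ?_, ?_, ?_, ?_, ?_, ?_, ?_, ?_⟩
  · exact (hp.adj 0 (l - 1) (by omega) (by omega)).mpr (Or.inr ⟨rfl, by omega⟩)
  · intro h
    have := hp.inj _ (by omega) _ (by omega) h
    omega
  · rw [hp.image]
    simp only [← Finset.image_insert]
    congr 1
    ext t
    simp only [Finset.mem_range, Finset.mem_insert, Finset.mem_Ico]
    omega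
  · exact hnot 0 (by omega) (by simp)
  · exact hnot 1 (by omega) (by simp)
  · exact hnot (l - 1) (by omega) (by simp)
  · intro p hpm
    obtain ⟨t, ht, rfl⟩ := Finset.mem_image.mp hpm
    rw [Finset.mem_Ico] at ht
    rw [hp.adj 0 t (by omega) (by omega)]
    omega
  · have key : ∀ k, k ≤ l - 2 → 1 ≤ k →
        IndPath G (ψ (l - 1)) (ψ k) ((Finset.Ico (k + 1) (l - 1)).image ψ) := by
      intro k hk
      induction hk using Nat.decreasingInduction with
      | self =>
        intro _
        rw [Finset.Ico_eq_empty (by omega), Finset.image_empty]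
        exact .nil ((hp.adj _ _ (by omega) (by omega)).mpr (Or.inl (by omega)))
      | of_succ k hk ih =>
        intro h1
        rw [← Finset.insert_Ico_add_one_left_eq_Ico (by omega : k + 1 < l - 1), Finset.image_insert]
        refine .cons ?_ ?_ ?_ ?_ (ih (by omega))
        · rw [hp.adj _ _ (by omega) (by omega)]; omega
        · rw [hp.adj _ _ (by omega) (by omega)]; omega
        · intro hmem
          obtain ⟨t, ht, hts⟩ := Finset.mem_image.mp hmem
          rw [Finset.mem_Ico] at ht
          have := hp.inj t (by omega) (k + 1) (by omega) hts
          omega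
        · intro p hpm
          obtain ⟨t, ht, rfl⟩ := Finset.mem_image.mp hpm
          rw [Finset.mem_Ico] at ht
          rw [hp.adj _ _ (by omega) (by omega)]
          omega
    exact key 1 (by omega) le_rfl

variable [DecidableRel G.Adj]

theorem IsCycleParam.fwd_zero {S : Finset V} {l : ℕ} {ψ : ℕ → V} (h : G.IsCycleParam S l ψ) :
    G.fwd (ψ 0) S = {ψ 1, ψ (l - 1)} := by
  have h3 := h.three_le
  ext v
  rw [mem_fwd, Finset.mem_insert, Finset.mem_singleton]
  constructor
  · rintro ⟨hv, hadj⟩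
    rw [h.image, Finset.mem_image] at hv
    obtain ⟨t, ht, rfl⟩ := hv
    have ht' : t < l := by simpa using ht
    rcases Nat.eq_zero_or_pos t with rfl | h0
    · exact absurd rfl hadj.ne
    · rcases (h.adj 0 t h0 ht').mp hadj with h | h
      · left; rw [h]
      · right; congr 1; omega
  · rintro (rfl | rfl)
    · exact ⟨h.mem (by omega), (h.adj 0 1 (by omega) (by omega)).mpr (Or.inl rfl)⟩
    · exact ⟨h.mem (by omega), (h.adj 0 (l - 1) (by omega) (by omega)).mpr (Or.inr ⟨rfl, by omega⟩)⟩

theorem IsInducedCycle.card_fwd {S : Finset V} (h : G.IsInducedCycle S) {x : V} (hx : x ∈ S) :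
    (G.fwd x S).card = 2 := by
  obtain ⟨y, hy, hxy⟩ := h.exists_adj hx
  obtain ⟨l, ψ, hp, rfl, rfl⟩ := h.exists_param_of_adj hx hy hxy
  have h3 := hp.three_le
  rw [hp.fwd_zero, Finset.card_pair]
  intro h
  have := hp.inj _ (by omega) _ (by omega) h
  omega

/-- A cycle contains no smaller nonempty set that is closed under taking neighbours in it. -/
theorem IsInducedCycle.subset_of_closed {S S' : Finset V} (h : G.IsInducedCycle S)
    (hS' : S' ⊆ S) (hne : S'.Nonempty) (hcl : ∀ x ∈ S', G.fwd x S ⊆ S') : S = S' := by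
  obtain ⟨x, hx⟩ := hne
  obtain ⟨y, hy, hxy⟩ := h.exists_adj (hS' hx)
  obtain ⟨l, ψ, hp, rfl, rfl⟩ := h.exists_param_of_adj (hS' hx) hy hxy
  refine subset_antisymm ?_ hS'
  rw [hp.image]
  intro v hv
  obtain ⟨t, ht, rfl⟩ := Finset.mem_image.mp hv
  have ht' : t < l := by simpa using ht
  clear ht hv
  induction t with
  | zero => exact hx
  | succ t ih =>
    exact hcl _ (ih (by omega)) (mem_fwd.mpr ⟨hp.mem ht',
      (hp.adj t (t + 1) (by omega) ht').mpr (Or.inl rfl)⟩)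

variable (G) in
/-- The number of induced cycles through `x` is at most the sum of path counts. -/
theorem card_cycles_through_le (x : V) (W : Finset V) (F : Finset (Finset V))
    (hF : ∀ S ∈ F, S ⊆ W ∧ x ∈ S ∧ G.IsInducedCycle S) :
    F.card ≤ ∑ y ∈ G.fwd x W, ∑ z ∈ G.fwd x W, G.pathCount z y ((G.rem x W).erase x) := by
  classical
  have hsub : F ⊆ (G.fwd x W).biUnion fun y => (G.fwd x W).biUnion fun z =>
      ({P ∈ ((G.rem x W).erase x).powerset | IndPath G z y P}).image
        fun P => insert x (insert y (insert z P)) := by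
    intro S hS
    obtain ⟨hSW, hx, hc⟩ := hF S hS
    obtain ⟨y, hy, hxy⟩ := hc.exists_adj hx
    obtain ⟨z, P, hxz, -, rfl, hxP, -, -, hP, hind⟩ := hc.exists_indPath hx hy hxy
    simp only [Finset.mem_biUnion, Finset.mem_image, Finset.mem_filter, Finset.mem_powerset]
    refine ⟨y, by simp [hSW hy, hxy], z, ?_, P, ⟨?_, hind⟩, rfl⟩
    · rw [mem_fwd]
      exact ⟨hSW (by simp), hxz⟩
    · intro p hp
      rw [Finset.mem_erase, mem_rem]
      exact ⟨fun h => hxP (h ▸ hp), hSW (by simp [hp]), hP p hp⟩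
  refine (Finset.card_le_card hsub).trans (Finset.card_biUnion_le.trans ?_)
  refine Finset.sum_le_sum fun y _ => Finset.card_biUnion_le.trans ?_
  refine Finset.sum_le_sum fun z _ => Finset.card_image_le.trans (card_indPath_le _ _ _ _ ?_)
  intro P hP
  simpa using hP

/-- In a cycle with more than four vertices a run of clusters does not end inside a braid. -/
theorem IsInducedCycle.inter_nonempty {S X₀ X₁ X₂ X₃ : Finset V} (h : G.IsInducedCycle S)
    (hS : 5 ≤ S.card) (hX₂ : X₂.card ≤ 4)
    (h₁₂ : ∀ v ∈ X₁, ∀ w ∈ X₂, G.Adj v w) (h₀₁ : ∀ v ∈ X₀, ∀ w ∈ X₁, G.Adj v w)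
    (hn₁ : ∀ v ∈ X₁, ∀ w, G.Adj v w → w ∈ X₀ ∨ w ∈ X₁ ∨ w ∈ X₂)
    (hn₂ : ∀ v ∈ X₂, ∀ w, G.Adj v w → w ∈ X₁ ∨ w ∈ X₂ ∨ w ∈ X₃)
    (hdisj : Disjoint X₀ X₂) (hne : (X₂ ∩ S).Nonempty) : (X₃ ∩ S).Nonempty := by
  by_contra h3
  rw [Finset.not_nonempty_iff_eq_empty, ← Finset.disjoint_iff_inter_eq_empty,
    Finset.disjoint_left] at h3
  have hfwd₂ : ∀ c ∈ X₂ ∩ S, G.fwd c S ⊆ (X₁ ∩ S) ∪ (X₂ ∩ S) := by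
    intro c hc v hv
    rw [mem_fwd] at hv
    rw [Finset.mem_inter] at hc
    rw [Finset.mem_union, Finset.mem_inter, Finset.mem_inter]
    rcases hn₂ c hc.1 v hv.2 with hw | hw | hw
    · exact Or.inl ⟨hw, hv.1⟩
    · exact Or.inr ⟨hw, hv.1⟩
    · exact absurd hv.1 (h3 hw)
  have hfwd₁ : ∀ c ∈ X₂ ∩ S, X₁ ∩ S ⊆ G.fwd c S := by
    intro c hc p hp
    rw [Finset.mem_inter] at hc hp
    exact mem_fwd.mpr ⟨hp.2, (h₁₂ p hp.1 c hc.1).symm⟩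
  have hfwd₁' : ∀ p ∈ X₁ ∩ S, X₂ ∩ S ⊆ G.fwd p S := by
    intro p hp c hc
    rw [Finset.mem_inter] at hc hp
    exact mem_fwd.mpr ⟨hc.2, h₁₂ p hp.1 c hc.1⟩
  obtain ⟨c, hc⟩ := hne
  have hcS := (Finset.mem_inter.mp hc).2
  by_cases hX₁ : (X₁ ∩ S).Nonempty
  · obtain ⟨p, hp⟩ := hX₁
    have hpS := (Finset.mem_inter.mp hp).2
    have h1 : (X₁ ∩ S).card ≤ 2 := (Finset.card_le_card (hfwd₁ c hc)).trans (h.card_fwd hcS).le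
    have h2 : (X₂ ∩ S).card ≤ 2 := (Finset.card_le_card (hfwd₁' p hp)).trans (h.card_fwd hpS).le
    -- the part of the cycle in `X₀` as well
    set T := (X₁ ∩ S) ∪ (X₂ ∩ S) with hT
    have hTS : T ⊆ S := Finset.union_subset Finset.inter_subset_right Finset.inter_subset_right
    have hTcard := Finset.card_union_le (X₁ ∩ S) (X₂ ∩ S)
    rw [← hT] at hTcard
    by_cases hcl : ∀ q ∈ X₁ ∩ S, G.fwd q S ⊆ T
    · have := h.subset_of_closed hTS ⟨c, Finset.mem_union_right _ hc⟩ (by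
        intro x hx
        rcases Finset.mem_union.mp hx with hx | hx
        · exact hcl x hx
        · exact hfwd₂ x hx)
      rw [this] at hS
      omega
    · -- some vertex `q` of the cycle in `X₁` has a neighbour `r` in `X₀`
      push Not at hcl
      obtain ⟨q, hq, hqT⟩ := hcl
      obtain ⟨r, hr, hrT⟩ := Finset.not_subset.mp hqT
      rw [mem_fwd] at hr
      have hrX : r ∈ X₀ := by
        rcases hn₁ q (Finset.mem_inter.mp hq).1 r hr.2 with hw | hw | hw
        · exact hw
        · exact absurd (Finset.mem_union_left _ (Finset.mem_inter.mpr ⟨hw, hr.1⟩)) hrT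
        · exact absurd (Finset.mem_union_right _ (Finset.mem_inter.mpr ⟨hw, hr.1⟩)) hrT
      have hrc : r ≠ c := fun hrc =>
        Finset.disjoint_left.mp hdisj hrX (hrc ▸ (Finset.mem_inter.mp hc).1)
      have hfwdq : ∀ q ∈ X₁ ∩ S, G.fwd q S = {c, r} := by
        intro q hq
        symm
        refine Finset.eq_of_subset_of_card_le ?_ ?_
        · intro v hv
          rw [Finset.mem_insert, Finset.mem_singleton] at hv
          rcases hv with rfl | rfl
          · exact hfwd₁' q hq hc
          · exact mem_fwd.mpr ⟨hr.1, (h₀₁ _ hrX q (Finset.mem_inter.mp hq).1).symm⟩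
        · rw [h.card_fwd (Finset.mem_inter.mp hq).2, Finset.card_pair hrc.symm]
      have hX₂c : X₂ ∩ S = {c} := by
        refine Finset.eq_singleton_iff_unique_mem.mpr ⟨hc, fun c' hc' => ?_⟩
        have := hfwd₁' q hq hc'
        rw [hfwdq q hq, Finset.mem_insert, Finset.mem_singleton] at this
        refine this.resolve_right fun h' => ?_
        exact Finset.disjoint_left.mp hdisj hrX (h' ▸ (Finset.mem_inter.mp hc').1)
      have hfc : G.fwd c S ⊆ X₁ ∩ S := by
        intro v hv
        rcases Finset.mem_union.mp (hfwd₂ c hc hv) with h' | h'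
        · exact h'
        · rw [hX₂c, Finset.mem_singleton] at h'
          rw [h', mem_fwd] at hv
          exact absurd rfl hv.2.ne
      have hX₁2 : (X₁ ∩ S).card = 2 :=
        le_antisymm h1 ((h.card_fwd hcS).symm.le.trans (Finset.card_le_card hfc))
      have hfr : G.fwd r S = X₁ ∩ S := by
        symm
        refine Finset.eq_of_subset_of_card_le ?_ (by rw [h.card_fwd hr.1, hX₁2])
        intro v hv
        rw [Finset.mem_inter] at hv
        exact mem_fwd.mpr ⟨hv.2, h₀₁ r hrX v hv.1⟩
      have := h.subset_of_closed (S' := insert r T) (Finset.insert_subset hr.1 hTS)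
        ⟨r, Finset.mem_insert_self _ _⟩ (by
          intro x hx
          rcases Finset.mem_insert.mp hx with rfl | hx
          · rw [hfr]
            exact Finset.subset_union_left.trans (Finset.subset_insert _ _)
          · rcases Finset.mem_union.mp hx with hx | hx
            · rw [hfwdq x hx]
              intro v hv
              rw [Finset.mem_insert, Finset.mem_singleton] at hv
              rcases hv with rfl | rfl
              · exact Finset.mem_insert_of_mem (Finset.mem_union_right _ hc)
              · exact Finset.mem_insert_self _ _
            · exact (hfwd₂ x hx).trans (Finset.subset_insert _ _))
      have hcard := Finset.card_insert_le r T
      rw [hX₂c, Finset.card_singleton] at hTcard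
      rw [this] at hS
      omega
  · rw [Finset.not_nonempty_iff_eq_empty] at hX₁
    have := h.subset_of_closed (S' := X₂ ∩ S) Finset.inter_subset_right ⟨c, hc⟩ (by
      intro x hx
      have := hfwd₂ x hx
      rwa [hX₁, Finset.empty_union] at this)
    have h4 := Finset.card_le_card (Finset.inter_subset_left (s₁ := X₂) (s₂ := S))
    rw [this] at hS
    omega

/-- In a cycle with more than four vertices, two vertices do not have two common neighbours. -/
theorem IsInducedCycle.eq_of_common_nbrs {S : Finset V} (h : G.IsInducedCycle S)
    (hS : 5 ≤ S.card) {c c' p q : V} (hc : c ∈ S) (hc' : c' ∈ S) (hp : p ∈ S) (hq : q ∈ S)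
    (hpq : p ≠ q) (hcp : G.Adj c p) (hcq : G.Adj c q) (hcp' : G.Adj c' p) (hcq' : G.Adj c' q) :
    c = c' := by
  by_contra hne
  have key : ∀ a b b', a ∈ S → b ∈ S → b' ∈ S → b ≠ b' → G.Adj a b → G.Adj a b' →
      G.fwd a S = {b, b'} := by
    intro a b b' ha hb hb' hbb hab hab'
    symm
    refine Finset.eq_of_subset_of_card_le ?_ (by rw [h.card_fwd ha, Finset.card_pair hbb])
    intro v hv
    rw [Finset.mem_insert, Finset.mem_singleton] at hv
    rcases hv with rfl | rfl
    · exact mem_fwd.mpr ⟨hb, hab⟩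
    · exact mem_fwd.mpr ⟨hb', hab'⟩
  have hsub : ({c, c', p, q} : Finset V) ⊆ S := by
    intro v hv
    simp only [Finset.mem_insert, Finset.mem_singleton] at hv
    rcases hv with rfl | rfl | rfl | rfl <;> assumption
  have := h.subset_of_closed hsub ⟨c, by simp⟩ (by
    intro x hx
    simp only [Finset.mem_insert, Finset.mem_singleton] at hx
    rcases hx with rfl | rfl | rfl | rfl
    · rw [key _ p q hc hp hq hpq hcp hcq]; intro v; simp; tauto
    · rw [key _ p q hc' hp hq hpq hcp' hcq']; intro v; simp; tauto
    · rw [key _ c c' hp hc hc' hne hcp.symm hcp'.symm]; intro v; simp; tauto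
    · rw [key _ c c' hq hc hc' hne hcq.symm hcq'.symm]; intro v; simp; tauto)
  rw [this] at hS
  have := Finset.card_le_four (a := c) (b := c') (c := p) (d := q)
  omega

end Cycles

section Count

variable {V : Type*} [Fintype V]

open scoped Classical in
/-- The vertex sets of the induced cycles. -/
noncomputable def inducedCycles (G : SimpleGraph V) : Finset (Finset V) :=
  {S | G.IsInducedCycle S}

@[simp] theorem mem_inducedCycles {G : SimpleGraph V} {S : Finset V} :
    S ∈ G.inducedCycles ↔ G.IsInducedCycle S := by
  simp [inducedCycles]

theorem numInducedCycles_eq_card (G : SimpleGraph V) :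
    numInducedCycles G = G.inducedCycles.card := by
  classical
  rw [numInducedCycles, ← Set.ncard_coe_finset, ← Set.ncard_image_of_injective _
    (Finset.coe_injective (α := V))]
  congr 1
  ext S
  simp only [Set.mem_ofPred_eq, Set.mem_image, Finset.mem_coe, mem_inducedCycles]
  constructor
  · intro h
    refine ⟨S.toFinset, ?_, by simp⟩
    rw [IsInducedCycle, Set.coe_toFinset]
    exact h
  · rintro ⟨S, hS, rfl⟩
    exact hS

theorem numInducedCycles_le_of_iso {V W : Type*} [Finite W] {G : SimpleGraph V}
    {G' : SimpleGraph W} (e : G ≃g G') : numInducedCycles G ≤ numInducedCycles G' := by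
  rw [numInducedCycles, numInducedCycles, ← Set.ncard_image_of_injective _
    (Set.image_injective.mpr e.injective)]
  refine Set.ncard_le_ncard ?_ (Set.toFinite _)
  rintro _ ⟨S, ⟨l, hl, ⟨f⟩⟩, rfl⟩
  exact ⟨l, hl, ⟨(e.induce e.injective.injOn.bijOn_image).symm.trans f⟩⟩

theorem numInducedCycles_congr {V W : Type*} [Finite V] [Finite W] {G : SimpleGraph V}
    {G' : SimpleGraph W} (e : G ≃g G') : numInducedCycles G = numInducedCycles G' :=
  le_antisymm (numInducedCycles_le_of_iso e) (numInducedCycles_le_of_iso e.symm)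

end Count

section

variable {V : Type*} [DecidableEq V] (G : SimpleGraph V) [DecidableRel G.Adj]

theorem card_cycles_subset_le (W : Finset V) (F : Finset (Finset V))
    (hF : ∀ S ∈ F, S ⊆ W ∧ G.IsInducedCycle S) :
    F.card ≤ ∑ x ∈ W, ∑ y ∈ G.fwd x W, ∑ z ∈ G.fwd x W,
      G.pathCount z y ((G.rem x W).erase x) := by
  have hsub : F ⊆ W.biUnion fun x => F.filter (x ∈ ·) := by
    intro S hS
    obtain ⟨hSW, hc⟩ := hF S hS
    obtain ⟨l, ψ, hp⟩ := hc.exists_param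
    have h0 := hp.mem (show 0 < l by have := hp.three_le; omega)
    exact Finset.mem_biUnion.mpr ⟨ψ 0, hSW h0, Finset.mem_filter.mpr ⟨hS, h0⟩⟩
  refine (Finset.card_le_card hsub).trans (Finset.card_biUnion_le.trans ?_)
  refine Finset.sum_le_sum fun x _ => G.card_cycles_through_le x W _ fun S hS => ?_
  rw [Finset.mem_filter] at hS
  exact ⟨(hF S hS.1).1, hS.2, (hF S hS.1).2⟩

end

end SimpleGraph

/-! ### Cycles in a graph with a stretch -/

namespace SimpleGraph

theorem IsCycleParam.card {V : Type*} [DecidableEq V] {G : SimpleGraph V} {S : Finset V} {l : ℕ}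
    {ψ : ℕ → V} (h : G.IsCycleParam S l ψ) : S.card = l := by
  rw [h.image, Finset.card_image_of_injOn, Finset.card_range]
  intro s hs t ht hst
  rw [Finset.coe_range, Set.mem_Iio] at hs ht
  exact h.inj s hs t ht hst

section Stretch

variable {V : Type*} [DecidableEq V] {G : SimpleGraph V} {L : ℕ}
  {E : ℕ → Finset V}

/-- The vertices outside the inner part of a stretch. -/
def outside [Fintype V] (E : ℕ → Finset V) (L : ℕ) : Finset V :=
  Finset.univ \ (Finset.Icc 1 L).biUnion E

theorem IsStretch.card_outside [Fintype V] (hE : G.IsStretch L E) :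
    (outside E L).card + 3 * L = Fintype.card V := by
  have h : ((Finset.Icc 1 L).biUnion E).card = 3 * L := by
    rw [Finset.card_biUnion, Finset.sum_congr rfl fun j hj => hE.card j (by
      rw [Finset.mem_Icc] at hj; omega)]
    · simp [mul_comm]
    · intro i hi j hj hij
      rw [Finset.mem_coe, Finset.mem_Icc] at hi hj
      exact hE.disj i (by omega) j (by omega) hij
  rw [outside, Finset.card_sdiff_of_subset (Finset.subset_univ _), h, Finset.card_univ]
  have := Finset.card_le_univ ((Finset.Icc 1 L).biUnion E)
  omega

variable [DecidableRel G.Adj]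

/-- `IsInducedCycle.inter_nonempty` carries the cycle from one cluster to the next. Read with the
clusters reversed, it carries the cycle backwards as well. -/
theorem IsStretch.inter_nonempty_of_mem (hE : G.IsStretch L E) {S : Finset V}
    (hS : G.IsInducedCycle S) (h5 : 5 ≤ S.card) {j₀ : ℕ} (h2 : 2 ≤ j₀) (hL : j₀ + 1 ≤ L)
    (hne : (E j₀ ∩ S).Nonempty) (j : ℕ) (hj : j ≤ L + 1) : (E j ∩ S).Nonempty := by
  have up : ∀ j, 2 ≤ j → j ≤ L → (E j ∩ S).Nonempty → (E (j + 1) ∩ S).Nonempty := by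
    intro j h2 hL hne
    obtain ⟨i, rfl⟩ : ∃ i, j = i + 2 := ⟨j - 2, by omega⟩
    refine hS.inter_nonempty h5 (X₀ := E i) (X₁ := E (i + 1)) (X₂ := E (i + 2)) ?_ ?_ ?_ ?_ ?_ ?_ hne
    · rw [hE.card _ (by omega)]; omega
    · exact hE.adj (i + 1) (by omega)
    · exact hE.adj i (by omega)
    · exact hE.nbr (i + 1) (by omega) (by omega)
    · exact hE.nbr (i + 2) (by omega) (by omega)
    · exact hE.disj _ (by omega) _ (by omega) (by omega)
  have down : ∀ j, j + 2 ≤ L → (E (j + 1) ∩ S).Nonempty → (E j ∩ S).Nonempty := by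
    intro j hL hne
    refine hS.inter_nonempty h5 (X₀ := E (j + 3)) (X₁ := E (j + 2)) (X₂ := E (j + 1))
      ?_ ?_ ?_ ?_ ?_ ?_ hne
    · rw [hE.card _ (by omega)]; omega
    · exact fun v hv w hw => (hE.adj (j + 1) (by omega) w hw v hv).symm
    · exact fun v hv w hw => (hE.adj (j + 2) (by omega) w hw v hv).symm
    · intro v hv w hvw
      have := hE.nbr (j + 2) (by omega) (by omega) v hv w hvw
      rw [show j + 2 - 1 = j + 1 by omega] at this
      tauto
    · intro v hv w hvw
      have := hE.nbr (j + 1) (by omega) (by omega) v hv w hvw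
      rw [show j + 1 - 1 = j by omega] at this
      tauto
    · exact hE.disj _ (by omega) _ (by omega) (by omega)
  rcases le_total j₀ j with h | h
  · induction h with
    | refl => exact hne
    | step h ih =>
      have h' : j₀ ≤ _ := h
      exact up _ (by omega) (by omega) (ih (by omega))
  · induction h using Nat.decreasingInduction with
    | self => exact hne
    | of_succ k hk ih => exact down k (by omega) (ih (by omega))

/-- Two vertices of the cycle in one inner cluster would have common neighbours on the cycle in both
adjacent clusters, which makes a 4-cycle. -/
theorem IsStretch.eq_of_mem (hE : G.IsStretch L E) {S : Finset V}
    (hS : G.IsInducedCycle S) (h5 : 5 ≤ S.card) (hne : ∀ j ≤ L + 1, (E j ∩ S).Nonempty)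
    {j : ℕ} (h1 : 1 ≤ j) (hL : j ≤ L) {c c' : V} (hc : c ∈ E j) (hc' : c' ∈ E j) (hcS : c ∈ S)
    (hcS' : c' ∈ S) : c = c' := by
  obtain ⟨i, rfl⟩ : ∃ i, j = i + 1 := ⟨j - 1, by omega⟩
  obtain ⟨p, hp⟩ := hne i (by omega)
  obtain ⟨q, hq⟩ := hne (i + 2) (by omega)
  rw [Finset.mem_inter] at hp hq
  refine hS.eq_of_common_nbrs h5 hcS hcS' hp.2 hq.2 ?_ (hE.adj i (by omega) p hp.1 c hc).symm
    (hE.adj (i + 1) hL c hc q hq.1) (hE.adj i (by omega) p hp.1 c' hc').symm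
    (hE.adj (i + 1) hL c' hc' q hq.1)
  exact fun h => Finset.disjoint_left.mp (hE.disj i (by omega) (i + 2) (by omega) (by omega))
    hp.1 (h ▸ hq.1)

/-- A long cycle that meets the inner part of a stretch passes through all of it, and the rest of
the cycle is an induced path. -/
theorem IsStretch.exists_transversal (hE : G.IsStretch L E) (hL4 : 4 ≤ L) {S : Finset V}
    (hS : G.IsInducedCycle S) (h5 : 5 ≤ S.card) {j₀ : ℕ} (h2 : 2 ≤ j₀) (hL : j₀ + 1 ≤ L)
    (hne : (E j₀ ∩ S).Nonempty) :
    ∃ e : ℕ → V, (∀ j, 1 ≤ j → j ≤ L → e j ∈ E j) ∧ (Finset.Icc 1 L).image e ⊆ S ∧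
      (∀ j, 1 ≤ j → j ≤ L → ∀ v ∈ E j, v ∈ S → v = e j) ∧
      IndPath G (e 1) (e L) (S \ (Finset.Icc 1 L).image e) := by
  have hall := fun j hj => hE.inter_nonempty_of_mem hS h5 h2 hL hne j hj
  have hchoose : ∀ j, ∃ v, j ≤ L + 1 → v ∈ E j ∧ v ∈ S := by
    intro j
    by_cases hj : j ≤ L + 1
    · obtain ⟨v, hv⟩ := hall j hj
      exact ⟨v, fun _ => Finset.mem_inter.mp hv⟩
    · exact ⟨(hall 0 (by omega)).choose, fun h => absurd h hj⟩
  choose e he using hchoose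
  have huniq : ∀ j, 1 ≤ j → j ≤ L → ∀ v ∈ E j, v ∈ S → v = e j := fun j h1 hj v hv hvS =>
    hE.eq_of_mem hS h5 hall h1 hj hv (he j (by omega)).1 hvS (he j (by omega)).2
  have hinj : ∀ i j, i ≤ L + 1 → j ≤ L + 1 → e i = e j → i = j := by
    intro i j hi hj hij
    by_contra hne
    exact Finset.disjoint_left.mp (hE.disj i hi j hj hne) (he i hi).1 (hij ▸ (he j hj).1)
  refine ⟨e, fun j h1 hj => (he j (by omega)).1, ?_, huniq, ?_⟩
  · intro v hv
    obtain ⟨j, hj, rfl⟩ := Finset.mem_image.mp hv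
    rw [Finset.mem_Icc] at hj
    exact (he j (by omega)).2
  -- The neighbours of `e 2` on the cycle are `e 1` and `e 3`. Removing these three vertices leaves
  -- a path from `e 3` to `e 1`, and its first vertices `e 4, …, e L` are then peeled off one by
  -- one.
  have key : ∀ k, 3 ≤ k → k ≤ L → IndPath G (e 1) (e k) (S \ (Finset.Icc 1 k).image e) := by
    intro k h3
    induction h3 with
    | refl =>
      intro _
      obtain ⟨z, P, hz, hzne, hSeq, hx, hy, hzP, -, hind⟩ := hS.exists_indPath (he 2 (by omega)).2
        (he 3 (by omega)).2 (hE.adj 2 (by omega) _ (he 2 (by omega)).1 _ (he 3 (by omega)).1)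
      have hzS : z ∈ S := by rw [hSeq]; simp
      have hz1 : z = e 1 := by
        rcases hE.nbr 2 (by omega) (by omega) _ (he 2 (by omega)).1 z hz with h | h | h
        · exact huniq 1 le_rfl (by omega) z h hzS
        · exact absurd (huniq 2 (by omega) (by omega) z h hzS).symm hz.ne
        · exact absurd (huniq 3 (by omega) (by omega) z h hzS) hzne
      subst hz1
      convert hind using 1
      have himg : (Finset.Icc 1 3).image e = {e 1, e 2, e 3} := by
        rw [show Finset.Icc 1 3 = {1, 2, 3} by rfl]
        simp [Finset.image_insert]
      rw [himg, hSeq]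
      ext v
      simp only [Finset.mem_sdiff, Finset.mem_insert, Finset.mem_singleton]
      constructor
      · tauto
      · intro hv
        refine ⟨by tauto, ?_⟩
        rintro (rfl | rfl | rfl) <;> contradiction
    | @step k h3 ih =>
      intro hkL
      have h3' : 3 ≤ k := h3
      have hprev := ih (by omega)
      have hmem : e (k + 1) ∈ S \ (Finset.Icc 1 k).image e := by
        rw [Finset.mem_sdiff]
        refine ⟨(he _ (by omega)).2, fun h => ?_⟩
        obtain ⟨j, hj, hje⟩ := Finset.mem_image.mp h
        rw [Finset.mem_Icc] at hj
        have := hinj j (k + 1) (by omega) (by omega) hje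
        omega
      have hadj := hE.adj k (by omega) _ (he k (by omega)).1 _ (he (k + 1) (by omega)).1
      have himg : S \ (Finset.Icc 1 (k + 1)).image e =
          (S \ (Finset.Icc 1 k).image e).erase (e (k + 1)) := by
        rw [← Finset.insert_Icc_right_eq_Icc_add_one (by omega), Finset.image_insert]
        ext v
        simp only [Finset.mem_sdiff, Finset.mem_insert, Finset.mem_erase]
        tauto
      rw [himg]
      generalize S \ (Finset.Icc 1 k).image e = P at *
      cases hprev with
      | nil h => simp at hmem
      | @cons _ w P' hz hw hwP hP h =>
        have : e (k + 1) = w := by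
          rcases Finset.mem_insert.mp hmem with h' | h'
          · exact h'
          · exact absurd hadj (hP _ h')
        subst this
        rwa [Finset.erase_insert hwP]
  exact key L (by omega) le_rfl

variable [Fintype V]

/-- There are `3 ^ L` ways to choose one vertex in each inner triple, and the rest of the cycle is
an induced path outside between the two chosen ends. -/
theorem IsStretch.card_cycles_through_le (hE : G.IsStretch L E) (hL4 : 4 ≤ L) (B : ℕ)
    (hB : ∀ u ∈ E L, ∀ z ∈ E 1, G.pathCount z u (outside E L) ≤ B) (F : Finset (Finset V))
    (hF : ∀ S ∈ F, G.IsInducedCycle S ∧ 5 ≤ S.card ∧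
      ∃ j, 2 ≤ j ∧ j + 1 ≤ L ∧ (E j ∩ S).Nonempty) :
    F.card ≤ 3 ^ L * B := by
  classical
  have hsub : F ⊆ (Fintype.piFinset fun j : Fin L => E (j + 1)).biUnion fun f =>
      ({P ∈ (outside E L).powerset |
        IndPath G (f ⟨0, by omega⟩) (f ⟨L - 1, by omega⟩) P}).image
          fun P => P ∪ Finset.univ.image f := by
    intro S hS
    obtain ⟨hc, h5, j₀, h2, hL, hne⟩ := hF S hS
    obtain ⟨e, he, heS, huniq, hind⟩ := hE.exists_transversal hL4 hc h5 h2 hL hne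
    simp only [Finset.mem_biUnion, Finset.mem_image, Finset.mem_filter, Finset.mem_powerset,
      Fintype.mem_piFinset]
    have himg : Finset.univ.image (fun j : Fin L => e (j + 1)) = (Finset.Icc 1 L).image e := by
      ext v
      simp only [Finset.mem_image, Finset.mem_univ, true_and, Finset.mem_Icc]
      constructor
      · rintro ⟨j, rfl⟩
        exact ⟨j + 1, ⟨by omega, j.2⟩, rfl⟩
      · rintro ⟨j, hj, rfl⟩
        exact ⟨⟨j - 1, by omega⟩, by simp only; congr 1; omega⟩
    refine ⟨fun j => e (j + 1), fun j => he _ (by omega) j.2, S \ (Finset.Icc 1 L).image e,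
      ⟨?_, ?_⟩, ?_⟩
    · intro v hv
      rw [Finset.mem_sdiff] at hv
      rw [outside, Finset.mem_sdiff]
      refine ⟨Finset.mem_univ _, fun hmem => hv.2 ?_⟩
      obtain ⟨j, hj, hvj⟩ := Finset.mem_biUnion.mp hmem
      have hj' := Finset.mem_Icc.mp hj
      rw [huniq j hj'.1 hj'.2 v hvj hv.1]
      exact Finset.mem_image_of_mem _ hj
    · have hL1 : L - 1 + 1 = L := by omega
      simpa only [zero_add, hL1] using hind
    · rw [himg]
      exact Finset.sdiff_union_of_subset heS
  refine (Finset.card_le_card hsub).trans ((Finset.card_biUnion_le_card_mul _ _ B ?_).trans ?_)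
  · intro f hf
    rw [Fintype.mem_piFinset] at hf
    refine Finset.card_image_le.trans ((card_indPath_le _ (f ⟨L - 1, by omega⟩) (outside E L) _
      ?_).trans (hB _ ?_ _ (hf ⟨0, by omega⟩)))
    · intro P hP
      simpa using hP
    · have := hf ⟨L - 1, by omega⟩
      have hL1 : L - 1 + 1 = L := by omega
      simpa only [hL1] using this
  · rw [Fintype.card_piFinset, Finset.prod_congr rfl fun (j : Fin L) _ =>
      hE.card (j + 1) (by have := j.2; omega),
      Finset.prod_const, Finset.card_univ, Fintype.card_fin]

theorem card_cycles_le_pow (G : SimpleGraph V) [DecidableRel G.Adj] (W : Finset V)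
    (F : Finset (Finset V)) (hF : ∀ S ∈ F, S ⊆ W ∧ G.IsInducedCycle S) :
    F.card ≤ W.card ^ 3 * maxProd W.card := by
  refine (G.card_cycles_subset_le W F hF).trans ?_
  have h1 : ∀ x, (G.fwd x W).card ≤ W.card := fun x => Finset.card_filter_le _ _
  calc ∑ x ∈ W, ∑ y ∈ G.fwd x W, ∑ z ∈ G.fwd x W, G.pathCount z y ((G.rem x W).erase x)
      ≤ ∑ x ∈ W, ∑ y ∈ G.fwd x W, ∑ z ∈ G.fwd x W, maxProd W.card := by
        refine Finset.sum_le_sum fun x _ => Finset.sum_le_sum fun y _ =>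
          Finset.sum_le_sum fun z _ => (pathCount_le _ _ _).trans (maxProd_mono ?_)
        exact (Finset.card_le_card (Finset.erase_subset _ _)).trans (Finset.card_filter_le _ _)
    _ ≤ ∑ x ∈ W, ∑ y ∈ W, ∑ z ∈ W, maxProd W.card := by
        refine Finset.sum_le_sum fun x _ => ?_
        exact (Finset.sum_le_sum fun y _ => Finset.sum_le_sum_of_subset
          (Finset.filter_subset _ _)).trans (Finset.sum_le_sum_of_subset (Finset.filter_subset _ _))
    _ = _ := by simp only [Finset.sum_const, smul_eq_mul]; ring

theorem card_short_cycles_le (G : SimpleGraph V) (F : Finset (Finset V))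
    (hF : ∀ S ∈ F, G.IsInducedCycle S ∧ S.card ≤ 4) :
    F.card ≤ Fintype.card V ^ 3 + Fintype.card V ^ 4 := by
  have hsub : F ⊆ Finset.univ.powersetCard 3 ∪ Finset.univ.powersetCard 4 := by
    intro S hS
    obtain ⟨hc, h4⟩ := hF S hS
    obtain ⟨l, ψ, hp⟩ := hc.exists_param
    have h3 := hp.three_le
    have hcard := hp.card
    simp only [Finset.mem_union, Finset.mem_powersetCard, Finset.subset_univ, true_and]
    omega
  refine (Finset.card_le_card hsub).trans ((Finset.card_union_le _ _).trans ?_)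
  rw [Finset.card_powersetCard, Finset.card_powersetCard, Finset.card_univ]
  exact Nat.add_le_add (Nat.choose_le_pow _ _) (Nat.choose_le_pow _ _)

/-- An upper bound for the number of induced cycles of a graph with a stretch. -/
theorem IsStretch.card_inducedCycles_le (hE : G.IsStretch L E) (hL4 : 4 ≤ L) (B : ℕ)
    (hB : ∀ u ∈ E L, ∀ z ∈ E 1, G.pathCount z u (outside E L) ≤ B) :
    G.inducedCycles.card ≤ 3 ^ L * B + (Fintype.card V ^ 3 + Fintype.card V ^ 4) +
      Fintype.card V ^ 3 * maxProd (Fintype.card V - 3 * (L - 2)) := by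
  classical
  -- Cycles that meet only the first or the last inner triple need not cross the stretch, so only `L
  -- - 2` triples are removed here.
  set W : Finset V := Finset.univ \ (Finset.Icc 2 (L - 1)).biUnion E with hW
  have hWcard : W.card = Fintype.card V - 3 * (L - 2) := by
    have h : ((Finset.Icc 2 (L - 1)).biUnion E).card = 3 * (L - 2) := by
      rw [Finset.card_biUnion, Finset.sum_congr rfl fun j hj => hE.card j (by
        rw [Finset.mem_Icc] at hj; omega)]
      · simp only [Finset.sum_const, Nat.card_Icc, smul_eq_mul]
        omega
      · intro i hi j hj hij
        rw [Finset.mem_coe, Finset.mem_Icc] at hi hj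
        exact hE.disj i (by omega) j (by omega) hij
    rw [hW, Finset.card_sdiff_of_subset (Finset.subset_univ _), h, Finset.card_univ]
  have hsub : G.inducedCycles ⊆
      {S ∈ G.inducedCycles | 5 ≤ S.card ∧ ∃ j, 2 ≤ j ∧ j + 1 ≤ L ∧ (E j ∩ S).Nonempty} ∪
      {S ∈ G.inducedCycles | S.card ≤ 4} ∪ {S ∈ G.inducedCycles | S ⊆ W} := by
    intro S hS
    simp only [Finset.mem_union, Finset.mem_filter, hS, true_and]
    by_cases h4 : S.card ≤ 4
    · tauto
    by_cases hex : ∃ j, 2 ≤ j ∧ j + 1 ≤ L ∧ (E j ∩ S).Nonempty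
    · exact Or.inl (Or.inl ⟨by omega, hex⟩)
    · right
      intro v hv
      rw [hW, Finset.mem_sdiff]
      refine ⟨Finset.mem_univ _, fun hmem => hex ?_⟩
      obtain ⟨j, hj, hvj⟩ := Finset.mem_biUnion.mp hmem
      rw [Finset.mem_Icc] at hj
      exact ⟨j, hj.1, by omega, v, Finset.mem_inter.mpr ⟨hvj, hv⟩⟩
  refine (Finset.card_le_card hsub).trans ((Finset.card_union_le _ _).trans
    (Nat.add_le_add ((Finset.card_union_le _ _).trans (Nat.add_le_add ?_ ?_)) ?_))
  · refine hE.card_cycles_through_le hL4 B hB _ fun S hS => ?_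
    simpa using hS
  · refine G.card_short_cycles_le _ fun S hS => ?_
    simpa using hS
  · refine (G.card_cycles_le_pow W _ fun S hS => ?_).trans ?_
    · rw [Finset.mem_filter, mem_inducedCycles] at hS
      exact ⟨hS.2, hS.1⟩
    · rw [← hWcard]
      exact Nat.mul_le_mul_right _ (Nat.pow_le_pow_left (Finset.card_le_univ _) 3)

end Stretch

end SimpleGraph

/-! ### Closing a stretch to a cyclic braid -/

namespace SimpleGraph

/-- The fibres of `c` are the clusters of a cyclic braid of length `k`, and the product of their
sizes is as large as possible. -/
structure IsOptimalBraid {V : Type*} [Fintype V] {k : ℕ} (G : SimpleGraph V) (c : V → Fin k) :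
    Prop where
  adj : ∀ v w, c v ≠ c w → (G.Adj v w ↔ (cycleGraph k).Adj (c v) (c w))
  prod : ∏ i, ({v | c v = i} : Finset V).card = maxProd (Fintype.card V)

variable {V : Type*} [DecidableEq V] [Fintype V] {G : SimpleGraph V} {L : ℕ} {E : ℕ → Finset V}

theorem mem_outside_or (E : ℕ → Finset V) (L : ℕ) (v : V) :
    v ∈ outside E L ∨ ∃ j, 1 ≤ j ∧ j ≤ L ∧ v ∈ E j := by
  by_cases h : v ∈ (Finset.Icc 1 L).biUnion E
  · obtain ⟨j, hj, hv⟩ := Finset.mem_biUnion.mp h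
    rw [Finset.mem_Icc] at hj
    exact Or.inr ⟨j, hj.1, hj.2, hv⟩
  · exact Or.inl (by simpa [outside] using h)

theorem notMem_of_mem_outside {v : V} (hv : v ∈ outside E L) {j : ℕ} (h1 : 1 ≤ j) (hL : j ≤ L) :
    v ∉ E j := by
  intro h
  rw [outside, Finset.mem_sdiff] at hv
  exact hv.2 (Finset.mem_biUnion.mpr ⟨j, Finset.mem_Icc.mpr ⟨h1, hL⟩, h⟩)

theorem IsStretch.eq_of_mem_of_mem {V : Type*} {G : SimpleGraph V} {L : ℕ} {E : ℕ → Finset V}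
    (hE : G.IsStretch L E) {v : V} {i j : ℕ} (hi : i ≤ L + 1)
    (hj : j ≤ L + 1) (hvi : v ∈ E i) (hvj : v ∈ E j) : i = j := by
  by_contra hne
  exact Finset.disjoint_left.mp (hE.disj i hi j hj hne) hvi hvj

theorem IsStretch.adj_iff_of_mem (hE : G.IsStretch L E) {i j : ℕ} (hi : 1 ≤ i) (hij : i < j)
    (hj : j ≤ L) {v w : V} (hv : v ∈ E i) (hw : w ∈ E j) : G.Adj v w ↔ j = i + 1 := by
  constructor
  · intro h
    rcases hE.nbr i hi (by omega) v hv w h with h | h | h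
    · have := hE.eq_of_mem_of_mem (by omega) (by omega) h hw; omega
    · have := hE.eq_of_mem_of_mem (by omega) (by omega) h hw; omega
    · exact (hE.eq_of_mem_of_mem (by omega) (by omega) h hw).symm
  · rintro rfl
    exact hE.adj i (by omega) v hv w hw

theorem IsStretch.adj_outside_iff (hE : G.IsStretch L E) {i : ℕ} (hi : 1 ≤ i) (hiL : i ≤ L)
    {v w : V} (hv : v ∈ E i) (hw : w ∈ outside E L) :
    G.Adj v w ↔ (i = L ∧ w ∈ E (L + 1)) ∨ (i = 1 ∧ w ∈ E 0) := by
  constructor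
  · intro h
    rcases hE.nbr i hi hiL v hv w h with h | h | h
    · rcases Nat.lt_or_ge 1 i with h1 | h1
      · exact absurd h (notMem_of_mem_outside hw (by omega) (by omega))
      · obtain rfl : i = 1 := by omega
        exact Or.inr ⟨rfl, h⟩
    · exact absurd h (notMem_of_mem_outside hw hi hiL)
    · rcases Nat.lt_or_ge i L with h1 | h1
      · exact absurd h (notMem_of_mem_outside hw (by omega) (by omega))
      · obtain rfl : i = L := by omega
        exact Or.inl ⟨rfl, h⟩
  · rintro (⟨rfl, h⟩ | ⟨rfl, h⟩)
    · exact hE.adj i le_rfl v hv w h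
    · exact (hE.adj 0 (by omega) w h v hv).symm

/-- A stretch closes up to a cyclic braid if the vertices outside form an optimal chain. -/
theorem IsStretch.exists_isOptimalBraid (hE : G.IsStretch L E) (hL : 2 ≤ L) {u z : V} (hu : u ∈ E L)
    (hz : z ∈ E 1) (hR : 2 ≤ (outside E L).card) {h : V → ℕ} {M : ℕ}
    (hc : IsOptimalChainFrom G z u (outside E L) h M) :
    ∃ c : V → Fin (L + M), G.IsOptimalBraid c := by
  have hfirst : ∀ w ∈ outside E L, (w ∈ E (L + 1) ↔ h w = 0) := by
    intro w hw
    rw [← hc.adj_start w hw, hE.adj_outside_iff (by omega) le_rfl hu hw]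
    constructor
    · exact fun h => Or.inl ⟨rfl, h⟩
    · rintro (h | h)
      · exact h.2
      · omega
  have hlast : ∀ w ∈ outside E L, (w ∈ E 0 ↔ h w + 1 = M) := by
    intro w hw
    rw [← hc.adj_end w hw, G.adj_comm, hE.adj_outside_iff le_rfl (by omega) hz hw]
    constructor
    · exact fun h => Or.inr ⟨rfl, h⟩
    · rintro (h | h)
      · omega
      · exact h.2
  have hM : 0 < M := by
    obtain ⟨v, hv⟩ := Finset.card_pos.mp (show 0 < (outside E L).card by omega)
    exact (Nat.zero_le _).trans_lt (hc.lt v hv)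
  -- Cyclic positions: the triple `E j` is at `j - 1` and the chain level `i` outside is at `L + i`.
  have hex : ∀ v, ∃ d, d < L + M ∧ (v ∈ outside E L → d = L + h v) ∧
      (∀ j, 1 ≤ j → j ≤ L → v ∈ E j → d + 1 = j) := by
    intro v
    rcases mem_outside_or E L v with hv | ⟨j, h1, hj, hv⟩
    · exact ⟨L + h v, by have := hc.lt v hv; omega, fun _ => rfl,
        fun j h1 hj hvj => absurd hvj (notMem_of_mem_outside hv h1 hj)⟩
    · refine ⟨j - 1, by omega, fun h => absurd hv (notMem_of_mem_outside h h1 hj), ?_⟩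
      intro i h1 hi hvi
      have := hE.eq_of_mem_of_mem (by omega) (by omega) hv hvi
      omega
  choose d hd hout hin using hex
  have hadj : ∀ v w, d v < d w → (G.Adj v w ↔ d w = d v + 1 ∨ (d v = 0 ∧ d w + 1 = L + M)) := by
    intro v w hvw
    rcases mem_outside_or E L v with hv | ⟨i, hi1, hiL, hv⟩
    · rcases mem_outside_or E L w with hw | ⟨j, hj1, hjL, hw⟩
      · have h1 := hout v hv
        have h2 := hout w hw
        rw [hc.adj v hv w hw (by omega)]
        omega
      · have h1 := hout v hv
        have h2 := hin w j hj1 hjL hw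
        omega
    · have h1 := hin v i hi1 hiL hv
      rcases mem_outside_or E L w with hw | ⟨j, hj1, hjL, hw⟩
      · have h2 := hout w hw
        rw [hE.adj_outside_iff hi1 hiL hv hw, hfirst w hw, hlast w hw]
        omega
      · have h2 := hin w j hj1 hjL hw
        rw [hE.adj_iff_of_mem hi1 (by omega) hjL hv hw]
        omega
  refine ⟨fun v => ⟨d v, hd v⟩, ?_, ?_⟩
  · intro v w hvw
    rcases lt_or_gt_of_ne (fun h => hvw (Fin.ext h) : d v ≠ d w) with hlt | hlt
    · rw [hadj v w hlt, cycleGraph_adj_of_lt (show (⟨d v, hd v⟩ : Fin (L + M)) < ⟨d w, hd w⟩ from hlt)]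
    · rw [G.adj_comm, (cycleGraph _).adj_comm, hadj w v hlt,
        cycleGraph_adj_of_lt (show (⟨d w, hd w⟩ : Fin (L + M)) < ⟨d v, hd v⟩ from hlt)]
  · have hfib : ∀ i : Fin (L + M), ({v | (⟨d v, hd v⟩ : Fin (L + M)) = i} : Finset V).card =
        ({v | d v = i.val} : Finset V).card := by
      intro i
      congr 1
      ext v
      simp [Fin.ext_iff]
    rw [Finset.prod_congr rfl fun i _ => hfib i,
      Fin.prod_univ_eq_prod_range (fun i => ({v | d v = i} : Finset V).card) (L + M),
      Finset.prod_range_add]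
    have h1 : ∏ i ∈ Finset.range L, ({v | d v = i} : Finset V).card = 3 ^ L := by
      rw [Finset.prod_congr rfl (g := fun _ => 3), Finset.prod_const, Finset.card_range]
      intro i hi
      rw [Finset.mem_range] at hi
      rw [← hE.card (i + 1) (by omega)]
      congr 1
      ext v
      rw [Finset.mem_filter]
      constructor
      · rintro ⟨-, rfl⟩
        rcases mem_outside_or E L v with hv | ⟨j, hj1, hjL, hv⟩
        · have := hout v hv; omega
        · rwa [hin v j hj1 hjL hv]
      · intro hv
        have := hin v (i + 1) (by omega) (by omega) hv
        exact ⟨Finset.mem_univ _, by omega⟩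
    have h2 : ∏ i ∈ Finset.range M, ({v | d v = L + i} : Finset V).card =
        maxProd (outside E L).card := by
      rw [← hc.prod]
      refine Finset.prod_congr rfl fun i hi => ?_
      congr 1
      ext v
      rw [Finset.mem_filter, Finset.mem_filter]
      constructor
      · rintro ⟨-, hi⟩
        rcases mem_outside_or E L v with hv | ⟨j, hj1, hjL, hv⟩
        · have := hout v hv; exact ⟨hv, by omega⟩
        · have := hin v j hj1 hjL hv; omega
      · rintro ⟨hv, hi⟩
        have := hout v hv
        exact ⟨Finset.mem_univ _, by omega⟩
    rw [h1, h2, ← hE.card_outside, maxProd_add_mul hR]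

/-- The dichotomy for graphs with a stretch. -/
theorem IsStretch.isOptimalBraid_or (hE : G.IsStretch L E) [DecidableRel G.Adj] (hL : 4 ≤ L)
    (hR : 2 ≤ (outside E L).card) :
    (∃ M, ∃ c : V → Fin (L + M), G.IsOptimalBraid c) ∨
    32 * G.inducedCycles.card ≤ 31 * maxProd (Fintype.card V) +
      32 * (Fintype.card V ^ 3 + Fintype.card V ^ 4 +
        Fintype.card V ^ 3 * maxProd (Fintype.card V - 3 * (L - 2))) := by
  by_cases hB : ∀ u ∈ E L, ∀ z ∈ E 1,
      32 * G.pathCount z u (outside E L) ≤ 31 * maxProd (outside E L).card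
  · right
    have := hE.card_inducedCycles_le hL (31 * maxProd (outside E L).card / 32) fun u hu z hz => by
      have := hB u hu z hz
      omega
    -- Triples are optimal parts, so the stretch multiplies the optimum outside to the optimum of
    -- the whole graph, and the loss of 1/32 outside persists.
    have h2 : 3 ^ L * maxProd (outside E L).card = maxProd (Fintype.card V) := by
      rw [← hE.card_outside, maxProd_add_mul hR]
    have h3 : 32 * (3 ^ L * (31 * maxProd (outside E L).card / 32)) ≤
        31 * maxProd (Fintype.card V) := by
      calc _ = 3 ^ L * (32 * (31 * maxProd (outside E L).card / 32)) := by ring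
        _ ≤ 3 ^ L * (31 * maxProd (outside E L).card) :=
          Nat.mul_le_mul_left _ (Nat.mul_div_le _ _)
        _ = _ := by rw [← h2]; ring
    omega
  · left
    push Not at hB
    obtain ⟨u, hu, z, hz, hlt⟩ := hB
    rcases G.pathCount_gap z u (outside E L) (by omega) with h | ⟨h, M, hc⟩
    · omega
    · exact ⟨M, hE.exists_isOptimalBraid (by omega) hu hz hR hc⟩

end SimpleGraph

/-! ### Polynomial factors and vertices of high degree -/

namespace SimpleGraph

theorem exists_forall_mul_pow_le (C : ℕ) : ∃ n₀, ∀ n ≥ n₀, C * (n + 1) ^ 4 ≤ 3 ^ n := by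
  have h := (tendsto_pow_const_div_const_pow_of_one_lt 4 (show (1 : ℝ) < 3 by norm_num)).comp
    (Filter.tendsto_add_atTop_nat 1)
  have hpos : (0 : ℝ) < 1 / (3 * (C + 1)) := by positivity
  obtain ⟨n₀, hn₀⟩ := Filter.eventually_atTop.mp (h.eventually (gt_mem_nhds hpos))
  refine ⟨n₀, fun n hn => ?_⟩
  have := hn₀ n hn
  simp only [Function.comp_apply] at this
  rw [div_lt_div_iff₀ (by positivity) (by positivity), pow_succ (3 : ℝ)] at this
  have h2 : (C : ℝ) * (n + 1) ^ 4 ≤ 3 ^ n := by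
    push_cast at this
    nlinarith [pow_nonneg (show (0 : ℝ) ≤ n + 1 by positivity) 4]
  exact_mod_cast h2

theorem mul_log_three_le (n : ℕ) : n * (Real.log 3 / 3) ≤ Real.log (maxProd n) + 1 := by
  have h1 : ((3 : ℝ) ^ n) ≤ 8 * (maxProd n : ℝ) ^ 3 := by exact_mod_cast three_pow_le_maxProd n
  have hpos : (0 : ℝ) < maxProd n := by exact_mod_cast maxProd_pos n
  have h2 := Real.log_le_log (by positivity) h1
  rw [Real.log_pow, Real.log_mul (by norm_num) (by positivity), Real.log_pow,
    show (8 : ℝ) = 2 ^ 3 by norm_num, Real.log_pow] at h2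
  have h3 := Real.log_le_sub_one_of_pos (show (0 : ℝ) < 2 by norm_num)
  push_cast at h2
  linarith

/-- Some vertices `y`, `z` are joined by at least a fraction `1 / N ^ 3` of the number of induced
cycles of induced paths that avoid a vertex `x` and its neighbours. -/
theorem exists_pathCount_large {V : Type*} [Fintype V] [DecidableEq V] (G : SimpleGraph V)
    [DecidableRel G.Adj] (h : 0 < G.inducedCycles.card) :
    ∃ x y z, G.inducedCycles.card ≤
      Fintype.card V ^ 3 * G.pathCount z y ((G.rem x Finset.univ).erase x) := by
  by_contra! hcon
  have h1 := G.card_cycles_subset_le Finset.univ G.inducedCycles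
    fun S hS => ⟨Finset.subset_univ _, mem_inducedCycles.mp hS⟩
  have hV : Nonempty V := by
    by_contra hV
    rw [not_nonempty_iff] at hV
    simp at h1
    simp [h1] at h
  have hN : 0 < Fintype.card V := Fintype.card_pos
  set f := G.inducedCycles.card with hf
  have h2 : ∑ x ∈ Finset.univ, ∑ y ∈ G.fwd x Finset.univ, ∑ z ∈ G.fwd x Finset.univ,
      G.pathCount z y ((G.rem x Finset.univ).erase x) ≤
      ∑ x : V, ∑ y : V, ∑ z : V, G.pathCount z y ((G.rem x Finset.univ).erase x) := by
    refine Finset.sum_le_sum fun x _ => ?_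
    exact (Finset.sum_le_sum fun y _ => Finset.sum_le_sum_of_subset
      (Finset.filter_subset _ _)).trans (Finset.sum_le_sum_of_subset (Finset.filter_subset _ _))
  have h3 : Fintype.card V ^ 3 *
      ∑ x : V, ∑ y : V, ∑ z : V, G.pathCount z y ((G.rem x Finset.univ).erase x) <
      Fintype.card V ^ 3 * f := by
    calc _ = ∑ x : V, ∑ y : V, ∑ z : V, Fintype.card V ^ 3 *
          G.pathCount z y ((G.rem x Finset.univ).erase x) := by
          simp only [Finset.mul_sum]
      _ < ∑ x : V, ∑ y : V, ∑ z : V, f := by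
          refine Finset.sum_lt_sum_of_nonempty Finset.univ_nonempty fun x _ =>
            Finset.sum_lt_sum_of_nonempty Finset.univ_nonempty fun y _ =>
            Finset.sum_lt_sum_of_nonempty Finset.univ_nonempty fun z _ => hcon x y z
      _ = _ := by simp only [Finset.sum_const, Finset.card_univ, smul_eq_mul]; ring
  have := Nat.lt_of_mul_lt_mul_left h3
  omega

/-- The edges of `G` between vertices of degree at most `Δ`. -/
def lowDegreePart {V : Type*} [Fintype V] (G : SimpleGraph V) [DecidableRel G.Adj] (Δ : ℕ) :
    SimpleGraph V where
  Adj v w := G.Adj v w ∧ (G.fwd v Finset.univ).card ≤ Δ ∧ (G.fwd w Finset.univ).card ≤ Δ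
  symm := ⟨fun _ _ h => ⟨h.1.symm, h.2.2, h.2.1⟩⟩
  loopless := ⟨fun _ h => h.1.ne rfl⟩

variable {V : Type*} [Fintype V] [DecidableEq V] {G : SimpleGraph V} [DecidableRel G.Adj]

/-- For a cycle through a vertex of degree greater than `Δ`, the path left after removing that
vertex and its two cycle neighbours avoids all its neighbours, so fewer than `N - Δ` vertices are
available for it. All other cycles keep their edges in the low-degree part. -/
theorem card_inducedCycles_le_lowDegreePart (Δ : ℕ) :
    G.inducedCycles.card ≤ (G.lowDegreePart Δ).inducedCycles.card +
      Fintype.card V ^ 3 * maxProd (Fintype.card V - Δ) := by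
  classical
  set F : V → Finset (Finset V) := fun x => {S ∈ G.inducedCycles | x ∈ S} with hF
  set X : Finset V := {x | Δ < (G.fwd x Finset.univ).card} with hX
  have hsub : G.inducedCycles ⊆ (G.lowDegreePart Δ).inducedCycles ∪ X.biUnion F := by
    intro S hS
    rw [Finset.mem_union]
    by_cases hlow : ∀ v ∈ S, (G.fwd v Finset.univ).card ≤ Δ
    · left
      rw [mem_inducedCycles] at hS ⊢
      obtain ⟨l, ψ, hp⟩ := hS.exists_param
      refine IsCycleParam.isInducedCycle (l := l) (ψ := ψ) ⟨hp.three_le, hp.inj, hp.image, ?_⟩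
      intro s t hst ht
      rw [← hp.adj s t hst ht]
      exact ⟨fun h => h.1, fun h => ⟨h, hlow _ (hp.mem (hst.trans ht)), hlow _ (hp.mem ht)⟩⟩
    · right
      push Not at hlow
      obtain ⟨v, hv, hlt⟩ := hlow
      exact Finset.mem_biUnion.mpr ⟨v, by simpa [hX] using hlt, Finset.mem_filter.mpr ⟨hS, hv⟩⟩
  refine (Finset.card_le_card hsub).trans ((Finset.card_union_le _ _).trans
    (Nat.add_le_add_left ?_ _))
  refine (Finset.card_biUnion_le_card_mul X F (Fintype.card V ^ 2 *
    maxProd (Fintype.card V - Δ)) fun x hx => ?_).trans ?_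
  · refine (G.card_cycles_through_le x Finset.univ (F x) fun S hS => ?_).trans ?_
    · simp only [hF, Finset.mem_filter, mem_inducedCycles] at hS
      exact ⟨Finset.subset_univ _, hS.2, hS.1⟩
    · have hx' : Δ < (G.fwd x Finset.univ).card := by simpa [hX] using hx
      have hle : ∀ y z, G.pathCount z y ((G.rem x Finset.univ).erase x) ≤
          maxProd (Fintype.card V - Δ) := by
        intro y z
        refine (pathCount_le _ _ _).trans (maxProd_mono ?_)
        have h1 := G.card_fwd_add_card_rem x Finset.univ
        rw [Finset.card_univ] at h1
        have h2 := Finset.card_le_card (Finset.erase_subset x (G.rem x Finset.univ))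
        omega
      have hcard : (G.fwd x Finset.univ).card ≤ Fintype.card V := Finset.card_le_univ _
      calc _ ≤ ∑ y ∈ G.fwd x Finset.univ, ∑ z ∈ G.fwd x Finset.univ,
              maxProd (Fintype.card V - Δ) :=
            Finset.sum_le_sum fun y _ => Finset.sum_le_sum fun z _ => hle y z
        _ = (G.fwd x Finset.univ).card * ((G.fwd x Finset.univ).card *
              maxProd (Fintype.card V - Δ)) := by simp only [Finset.sum_const, smul_eq_mul]
        _ ≤ Fintype.card V * (Fintype.card V * maxProd (Fintype.card V - Δ)) :=
            Nat.mul_le_mul hcard (Nat.mul_le_mul_right _ hcard)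
        _ = _ := by ring
  · calc _ ≤ Fintype.card V * (Fintype.card V ^ 2 * maxProd (Fintype.card V - Δ)) :=
          Nat.mul_le_mul_right _ (Finset.card_le_univ _)
      _ = _ := by ring

theorem lowDegreePart_card_fwd_le (Δ : ℕ) [DecidableRel (G.lowDegreePart Δ).Adj] (v : V) :
    ((G.lowDegreePart Δ).fwd v Finset.univ).card ≤ Δ := by
  by_cases hv : (G.fwd v Finset.univ).card ≤ Δ
  · refine (Finset.card_le_card fun w hw => ?_).trans hv
    rw [mem_fwd] at hw ⊢
    exact ⟨hw.1, hw.2.1⟩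
  · rw [Finset.card_eq_zero.mpr]
    · omega
    · rw [Finset.eq_empty_iff_forall_notMem]
      intro w hw
      rw [mem_fwd] at hw
      exact hv hw.2.2.1

theorem exists_cycleGraph_adj {k : ℕ} (hk : 3 ≤ k) (i : Fin k) : ∃ j, (cycleGraph k).Adj i j := by
  by_cases h : i.val + 1 < k
  · exact ⟨⟨i.val + 1, h⟩, (cycleGraph_adj_of_lt (Fin.lt_def.mpr (by simp))).mpr (Or.inl rfl)⟩
  · refine ⟨⟨0, by omega⟩, Adj.symm ?_⟩
    have := i.2
    exact (cycleGraph_adj_of_lt (Fin.lt_def.mpr (by simp only; omega))).mpr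
      (Or.inr ⟨rfl, by omega⟩)

theorem IsOptimalBraid.exists_eq {V : Type*} [Fintype V] {G : SimpleGraph V} {k : ℕ} {c : V → Fin k}
    (h : G.IsOptimalBraid c)
    (i : Fin k) : ∃ v, c v = i := by
  have h1 : ({v | c v = i} : Finset V).card ≠ 0 := by
    have := maxProd_pos (Fintype.card V)
    rw [← h.prod] at this
    exact Finset.prod_ne_zero_iff.mp this.ne' i (Finset.mem_univ i)
  obtain ⟨v, hv⟩ := Finset.card_ne_zero.mp h1
  exact ⟨v, by simpa using hv⟩

/-- In a braid every vertex has an edge, so in the low-degree part every vertex is an end of a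
retained edge. Thus all degrees are at most `Δ` and no edge was deleted. -/
theorem IsOptimalBraid.of_lowDegreePart {k Δ : ℕ} {c : V → Fin k} (hk : 3 ≤ k)
    (h : (G.lowDegreePart Δ).IsOptimalBraid c) : G.IsOptimalBraid c := by
  have hlow : ∀ v, (G.fwd v Finset.univ).card ≤ Δ := by
    intro v
    obtain ⟨j, hj⟩ := exists_cycleGraph_adj hk (c v)
    obtain ⟨w, rfl⟩ := h.exists_eq j
    exact ((h.adj v w fun h => hj.ne h).mpr hj).2.1
  refine ⟨fun v w hvw => ?_, h.prod⟩
  rw [← h.adj v w hvw]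
  exact ⟨fun h => ⟨h, hlow v, hlow w⟩, fun h => h.1⟩

end SimpleGraph

/-! ### Choice of parameters and the reduction to braids -/

namespace SimpleGraph

theorem stretch_bound {μ Δ K L N : ℕ} (h1 : 1 ≤ μ) (hΔ : Δ + 1 ≤ 60 * μ)
    (hK : K = 32400 * (36 * Δ + 1) * (9 * μ)) (hL : L = 20 * μ) (hN : 10 ^ 14 * μ ^ 4 ≤ N) :
    (Δ + 1 + 3 * K) + 3 * ((L + 2) * ((Δ + 1) * (Δ + 1 + 3 * K) + 1)) ≤ N := by
  have p2 : μ ≤ μ ^ 2 := by nlinarith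
  have p3 : μ ^ 2 ≤ μ ^ 3 := Nat.pow_le_pow_right h1 (by norm_num)
  have p4 : μ ^ 3 ≤ μ ^ 4 := Nat.pow_le_pow_right h1 (by norm_num)
  have hK' : K ≤ 630000000 * μ ^ 2 := by
    rw [hK]
    calc 32400 * (36 * Δ + 1) * (9 * μ) ≤ 32400 * (2160 * μ) * (9 * μ) :=
          Nat.mul_le_mul_right _ (Nat.mul_le_mul_left _ (by omega))
      _ = 629856000 * μ ^ 2 := by ring
      _ ≤ _ := by omega
  have ha : Δ + 1 + 3 * K ≤ 2000000000 * μ ^ 2 := by omega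
  have hb : (Δ + 1) * (Δ + 1 + 3 * K) + 1 ≤ 130000000000 * μ ^ 3 := by
    have := Nat.mul_le_mul hΔ ha
    have h2 : 60 * μ * (2000000000 * μ ^ 2) = 120000000000 * μ ^ 3 := by ring
    omega
  have hc : (L + 2) * ((Δ + 1) * (Δ + 1 + 3 * K) + 1) ≤ 22 * μ * (130000000000 * μ ^ 3) :=
    Nat.mul_le_mul (by omega) hb
  have h2 : 22 * μ * (130000000000 * μ ^ 3) = 2860000000000 * μ ^ 4 := by ring
  omega

/-- The polynomial factor `2 * N ^ 3` becomes `log 2 + 3 * log N ≤ 1 + 6 * μ`. Two further units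
come from `mul_log_three_le` and from the end of the path, and `3 + 6 * μ ≤ 9 * μ`. -/
theorem log_deficit_le {N μ r A : ℕ} (hμ : 1 ≤ μ) (hN : N ≤ 3 ^ μ) (hN0 : 0 < N) (hA : 0 < A)
    (hr : r ≤ N) (hle : maxProd N ≤ 2 * (N ^ 3 * A)) :
    r * (Real.log 3 / 3) - Real.log A + 1 ≤ 9 * μ := by
  have hrN : (r : ℝ) ≤ N := by exact_mod_cast hr
  have hlog3 := Real.log_le_sub_one_of_pos (show (0 : ℝ) < 3 by norm_num)
  have hlog3pos := Real.log_pos (show (1 : ℝ) < 3 by norm_num)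
  have hlog2 := Real.log_le_sub_one_of_pos (show (0 : ℝ) < 2 by norm_num)
  have hNR : (0 : ℝ) < N := by exact_mod_cast hN0
  have hA' : (0 : ℝ) < A := by exact_mod_cast hA
  have hμR : (1 : ℝ) ≤ μ := by exact_mod_cast hμ
  have hlogN : Real.log N ≤ 2 * μ := by
    have h1 : (N : ℝ) ≤ 3 ^ μ := by exact_mod_cast hN
    have h2 := Real.log_le_log hNR h1
    rw [Real.log_pow] at h2
    nlinarith
  have hlogA : Real.log (maxProd N) ≤ Real.log 2 + (3 * Real.log N + Real.log A) := by
    have h1 : (maxProd N : ℝ) ≤ 2 * ((N : ℝ) ^ 3 * A) := by exact_mod_cast hle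
    have h2 := Real.log_le_log (by exact_mod_cast maxProd_pos N) h1
    rw [Real.log_mul (by norm_num) (by positivity), Real.log_mul (by positivity) (by positivity),
      Real.log_pow] at h2
    push_cast at h2
    exact h2
  have hmain := mul_log_three_le N
  have h1 : r * (Real.log 3 / 3) ≤ N * (Real.log 3 / 3) :=
    mul_le_mul_of_nonneg_right hrN (by positivity)
  linarith

theorem mul_deficit_le {Δ K μ : ℕ} {t : ℝ} (hK : K = 32400 * (36 * Δ + 1) * (9 * μ))
    (ht : t ≤ 9 * μ) : 32400 * (36 * Δ + 1) * t ≤ K := by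
  have h : (K : ℝ) = 32400 * (36 * Δ + 1) * (9 * μ) := by
    rw [hK]
    push_cast
    ring
  rw [h]
  gcongr

/-- A large graph with at least as many induced cycles as the maximum product is a braid. -/
theorem exists_isOptimalBraid : ∃ n₀, ∀ {V : Type} [Fintype V] [DecidableEq V]
    (G : SimpleGraph V), n₀ ≤ Fintype.card V →
    maxProd (Fintype.card V) ≤ G.inducedCycles.card →
    ∃ k, 5 ≤ k ∧ ∃ c : V → Fin k, G.IsOptimalBraid c := by
  obtain ⟨l₀, hl₀⟩ := exists_forall_mul_pow_le (10 ^ 14)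
  refine ⟨3 ^ l₀, fun {V} _ _ G hN hG => ?_⟩
  classical
  set N := Fintype.card V with hNdef
  set l := Nat.log 3 N with hl
  have hN0 : N ≠ 0 := by
    have := pow_pos (show 0 < 3 by norm_num) l₀
    omega
  have hl0 : l₀ ≤ l := by
    rw [hl, ← Nat.log_pow (show 1 < 3 by norm_num) l₀]
    exact Nat.log_mono_right hN
  have hbig : 10 ^ 14 * (l + 1) ^ 4 ≤ N := (hl₀ l hl0).trans (Nat.pow_log_le_self 3 hN0)
  have hsmall : N < 3 ^ (l + 1) := Nat.lt_pow_succ_log_self (by norm_num) N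
  set μ := l + 1 with hμ
  have hμ1 : 1 ≤ μ := by omega
  have hμ4 : μ ≤ μ ^ 4 := Nat.le_self_pow (by norm_num) μ
  -- With `μ` just above `log N` to base 3, `L - 2 ≥ 18 * μ`, so the loss `3 ^ (L - 2)` exceeds `N ^
  -- 18` and beats all polynomial factors. The choice `Δ = 3 * (L - 2)` makes the high-degree loss
  -- and the loss from avoiding the stretch the same quantity `g`.
  set L := 20 * μ with hL
  set Δ := 3 * (L - 2) with hΔ
  set K := 32400 * (36 * Δ + 1) * (9 * μ) with hK
  have hbound := stretch_bound (N := N) hμ1 (show Δ + 1 ≤ 60 * μ by omega) hK hL hbig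
  set g := maxProd (N - Δ) with hg
  have hgpos : 0 < g := maxProd_pos _
  have hgN : N ^ 18 * g ≤ maxProd N := by
    have h1 : maxProd N = 3 ^ (L - 2) * g := by
      rw [hg, ← maxProd_add_mul (by omega)]
      congr 1
      omega
    rw [h1]
    refine Nat.mul_le_mul_right _ ?_
    calc N ^ 18 ≤ (3 ^ μ) ^ 18 := Nat.pow_le_pow_left hsmall.le 18
      _ = 3 ^ (μ * 18) := (pow_mul _ _ _).symm
      _ ≤ 3 ^ (L - 2) := Nat.pow_le_pow_right (by norm_num) (by omega)
  have hN5 : 1000 * (N ^ 4 * g) < maxProd N := by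
    refine lt_of_lt_of_le ?_ hgN
    rw [← mul_assoc]
    refine Nat.mul_lt_mul_of_pos_right ?_ hgpos
    calc 1000 * N ^ 4 < N * N ^ 4 := Nat.mul_lt_mul_of_pos_right (by omega) (by positivity)
      _ = N ^ 5 := by ring
      _ ≤ N ^ 18 := Nat.pow_le_pow_right (by omega) (by norm_num)
  have hN34 : N ^ 3 * g ≤ N ^ 4 * g :=
    Nat.mul_le_mul_right _ (Nat.pow_le_pow_right (by omega) (by norm_num))
  have hN4 : N ^ 4 ≤ N ^ 4 * g := Nat.le_mul_of_pos_right _ hgpos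
  have hN3 : N ^ 3 ≤ N ^ 4 := Nat.pow_le_pow_right (by omega) (by norm_num)
  set G' := G.lowDegreePart Δ with hG'
  have hf : G.inducedCycles.card ≤ G'.inducedCycles.card + N ^ 3 * g :=
    card_inducedCycles_le_lowDegreePart Δ
  clear_value K
  obtain ⟨x, y, z, hA⟩ := exists_pathCount_large G' (by omega)
  have hstretch : ∃ E, G'.IsStretch L E := by
    set R := (G'.rem x Finset.univ).erase x with hR
    set A := G'.pathCount z y R with hAdef
    have hApos : 0 < A := by
      rcases Nat.eq_zero_or_pos A with h | h
      · rw [h, mul_zero] at hA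
        omega
      · exact h
    refine exists_stretch (Δ := Δ) (K := K) (x := x) (y := y) (z := z)
      (lowDegreePart_card_fwd_le Δ) hApos ?_ hbound
    have hκ := log_deficit_le hμ1 hsmall.le (Nat.pos_of_ne_zero hN0) hApos
      (Finset.card_le_univ R) (show maxProd N ≤ 2 * (N ^ 3 * A) by
        have h2 : G'.inducedCycles.card ≤ N ^ 3 * A := hA
        omega)
    exact mul_deficit_le hK hκ
  obtain ⟨E, hE⟩ := hstretch
  have hout := hE.card_outside
  rcases hE.isOptimalBraid_or (by omega) (by omega) with ⟨M, c, hc⟩ | h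
  · exact ⟨L + M, by omega, c, hc.of_lowDegreePart (by omega)⟩
  -- Here at least 1/32 of `maxProd N` would be missing, while the error terms are multiples of `N ^
  -- 4 * g` and hence too small to make up for it.
  · exfalso
    rw [← hNdef, ← hΔ, ← hg] at h
    omega

end SimpleGraph

/-! ### Arithmetic of cluster indices -/

namespace SimpleGraph

section Cyclic

variable {k : ℕ} [NeZero k]

theorem cycleGraph_adj_iff (hk : 5 ≤ k) {i j : Fin k} :
    (cycleGraph k).Adj i j ↔ j = i + 1 ∨ i = j + 1 := by
  obtain ⟨k, rfl⟩ : ∃ l, k = l + 2 := ⟨k - 2, by omega⟩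
  rw [cycleGraph_adj, sub_eq_iff_eq_add, sub_eq_iff_eq_add, add_comm 1 j, add_comm 1 i]
  tauto

theorem fin_natCast_ne_zero {a : ℕ} (ha : 0 < a) (hak : a < k) : Fin.ofNat k a ≠ 0 := by
  intro h
  have := congrArg Fin.val h
  rw [Fin.val_ofNat, Nat.mod_eq_of_lt hak] at this
  simp at this
  omega

theorem fin_add_one_ne (hk : 5 ≤ k) (i : Fin k) : i + 1 ≠ i := by
  intro h
  refine fin_natCast_ne_zero (k := k) (a := 1) (by norm_num) (by omega) ?_
  exact left_eq_add.mp h.symm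

theorem fin_add_two_ne (hk : 5 ≤ k) (i : Fin k) : i + 1 + 1 ≠ i := by
  intro h
  refine fin_natCast_ne_zero (k := k) (a := 2) (by norm_num) (by omega) ?_
  rw [add_assoc] at h
  rw [← left_eq_add.mp h.symm]
  exact Fin.ext (by simp [Fin.val_add])

theorem fin_add_three_ne (hk : 5 ≤ k) (i : Fin k) : i + 1 + 1 + 1 ≠ i := by
  intro h
  refine fin_natCast_ne_zero (k := k) (a := 3) (by norm_num) (by omega) ?_
  rw [add_assoc, add_assoc] at h
  rw [← left_eq_add.mp h.symm]
  exact Fin.ext (by simp [Fin.val_add])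

theorem fin_induction_add_one {p : Fin k → Prop} (hne : ∃ i, p i) (hs : ∀ i, p i → p (i + 1))
    (j : Fin k) : p j := by
  obtain ⟨i, hi⟩ := hne
  have h : ∀ n : ℕ, p (i + Fin.ofNat k n) := by
    intro n
    induction n with
    | zero =>
      have : Fin.ofNat k 0 = 0 := rfl
      rw [this, add_zero]; exact hi
    | succ n ih =>
      have : Fin.ofNat k (n + 1) = Fin.ofNat k n + 1 := by
        apply Fin.ext; simp [Fin.val_add]
      rw [this, ← add_assoc]
      exact hs _ ih
  have := h (j - i).val
  rwa [Fin.ofNat_val_eq_self, add_sub_cancel] at this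

end Cyclic
end SimpleGraph

/-! ### Upper bound for the number of cycles of a braid -/

namespace SimpleGraph

section Braid

open scoped Classical in
/-- The set of vertices of colour `i`. -/
noncomputable def cluster {V : Type*} [Fintype V] {k : ℕ} (c : V → Fin k) (i : Fin k) : Finset V :=
  {v | c v = i}

variable {V : Type*} [Fintype V] [DecidableEq V] {k : ℕ} {G : SimpleGraph V}
  {c : V → Fin k}

@[simp] theorem mem_cluster {V : Type*} [Fintype V] {c : V → Fin k} {v : V} {i : Fin k} :
    v ∈ cluster c i ↔ c v = i := by
  simp [cluster]

open scoped Classical in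
/-- The pairs of nonadjacent vertices in a cluster. -/
noncomputable def nonadjPairs (G : SimpleGraph V) (c : V → Fin k) (i : Fin k) :
    Finset (Finset V) :=
  {Q ∈ (cluster c i).powersetCard 2 | ∀ u ∈ Q, ∀ v ∈ Q, ¬ G.Adj u v}

open scoped Classical in
/-- The pairs of adjacent vertices in a cluster. -/
noncomputable def adjPairs (G : SimpleGraph V) (c : V → Fin k) (i : Fin k) :
    Finset (Finset V) :=
  {Q ∈ (cluster c i).powersetCard 2 | ¬ ∀ u ∈ Q, ∀ v ∈ Q, ¬ G.Adj u v}

open scoped Classical in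
/-- The induced cycles inside a cluster. -/
noncomputable def innerCycles (G : SimpleGraph V) (c : V → Fin k) (i : Fin k) :
    Finset (Finset V) :=
  {S ∈ G.inducedCycles | S ⊆ cluster c i}

theorem pair_mem_nonadjPairs {u v : V} {i : Fin k} (hu : c u = i) (hv : c v = i) (huv : u ≠ v)
    (h : ¬ G.Adj u v) : {u, v} ∈ nonadjPairs G c i := by
  classical
  rw [nonadjPairs, Finset.mem_filter, Finset.mem_powersetCard]
  refine ⟨⟨?_, Finset.card_pair huv⟩, ?_⟩
  · intro x hx
    rw [Finset.mem_insert, Finset.mem_singleton] at hx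
    rcases hx with rfl | rfl <;> simpa
  · simp [h, G.adj_comm v u]

theorem pair_mem_adjPairs {u v : V} {i : Fin k} (hu : c u = i) (hv : c v = i)
    (h : G.Adj u v) : {u, v} ∈ adjPairs G c i := by
  classical
  rw [adjPairs, Finset.mem_filter, Finset.mem_powersetCard]
  refine ⟨⟨?_, Finset.card_pair h.ne⟩, ?_⟩
  · intro x hx
    rw [Finset.mem_insert, Finset.mem_singleton] at hx
    rcases hx with rfl | rfl <;> simpa
  · simp [h]

theorem card_nonadjPairs_add_card_adjPairs (G : SimpleGraph V) (c : V → Fin k) (i : Fin k) :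
    (nonadjPairs G c i).card + (adjPairs G c i).card = (cluster c i).card.choose 2 := by
  rw [nonadjPairs, adjPairs, Finset.card_filter_add_card_filter_not, Finset.card_powersetCard]

theorem card_innerCycles_le (G : SimpleGraph V) (c : V → Fin k) (i : Fin k)
    (hi : (cluster c i).card ≤ 4) : (innerCycles G c i).card ≤
      (cluster c i).card.choose 3 + (cluster c i).card.choose 4 := by
  have hsub : innerCycles G c i ⊆
      (cluster c i).powersetCard 3 ∪ (cluster c i).powersetCard 4 := by
    intro S hS
    rw [innerCycles, Finset.mem_filter, mem_inducedCycles] at hS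
    obtain ⟨l, ψ, hp⟩ := hS.1.exists_param
    have h3 := hp.three_le
    have hcard := hp.card
    have hle := Finset.card_le_card hS.2
    simp only [Finset.mem_union, Finset.mem_powersetCard, hS.2, true_and]
    omega
  refine (Finset.card_le_card hsub).trans ((Finset.card_union_le _ _).trans ?_)
  rw [Finset.card_powersetCard, Finset.card_powersetCard]

theorem three_le_card_adjPairs {i : Fin k} (h : (innerCycles G c i).Nonempty) :
    3 ≤ (adjPairs G c i).card := by
  obtain ⟨S, hS⟩ := h
  rw [innerCycles, Finset.mem_filter, mem_inducedCycles] at hS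
  obtain ⟨l, ψ, hp⟩ := hS.1.exists_param
  have h3 := hp.three_le
  have hcol : ∀ t < l, c (ψ t) = i := fun t ht => mem_cluster.mp (hS.2 (hp.mem ht))
  have hne : ∀ s t, s < l → t < l → s ≠ t → ψ s ≠ ψ t :=
    fun s t hs ht hst h => hst (hp.inj s hs t ht h)
  have h01 : ({ψ 0, ψ 1} : Finset V) ∈ adjPairs G c i :=
    pair_mem_adjPairs (hcol 0 (by omega)) (hcol 1 (by omega))
      ((hp.adj 0 1 (by omega) (by omega)).mpr (Or.inl rfl))
  have h12 : ({ψ 1, ψ 2} : Finset V) ∈ adjPairs G c i :=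
    pair_mem_adjPairs (hcol 1 (by omega)) (hcol 2 (by omega))
      ((hp.adj 1 2 (by omega) (by omega)).mpr (Or.inl rfl))
  have h0l : ({ψ 0, ψ (l - 1)} : Finset V) ∈ adjPairs G c i :=
    pair_mem_adjPairs (hcol 0 (by omega)) (hcol _ (by omega))
      ((hp.adj 0 (l - 1) (by omega) (by omega)).mpr (Or.inr ⟨rfl, by omega⟩))
  have key : ({{ψ 0, ψ 1}, {ψ 1, ψ 2}, {ψ 0, ψ (l - 1)}} : Finset (Finset V)).card = 3 := by
    rw [Finset.card_eq_three]
    refine ⟨_, _, _, ?_, ?_, ?_, rfl⟩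
    · intro h
      have : ψ 0 ∈ ({ψ 1, ψ 2} : Finset V) := h ▸ Finset.mem_insert_self _ _
      rw [Finset.mem_insert, Finset.mem_singleton] at this
      exact this.elim (hne 0 1 (by omega) (by omega) (by omega))
        (hne 0 2 (by omega) (by omega) (by omega))
    · intro h
      have : ψ (l - 1) ∈ ({ψ 0, ψ 1} : Finset V) := by rw [h]; simp
      rw [Finset.mem_insert, Finset.mem_singleton] at this
      exact this.elim (hne _ 0 (by omega) (by omega) (by omega))
        (hne _ 1 (by omega) (by omega) (by omega))
    · intro h
      have : ψ 0 ∈ ({ψ 1, ψ 2} : Finset V) := h ▸ Finset.mem_insert_self _ _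
      rw [Finset.mem_insert, Finset.mem_singleton] at this
      exact this.elim (hne 0 1 (by omega) (by omega) (by omega))
        (hne 0 2 (by omega) (by omega) (by omega))
  rw [← key]
  refine Finset.card_le_card ?_
  intro Q hQ
  simp only [Finset.mem_insert, Finset.mem_singleton] at hQ
  rcases hQ with rfl | rfl | rfl <;> assumption

variable [NeZero k]

/-- A cycle with at most one vertex in each cluster of a braid meets all clusters. -/
theorem IsInducedCycle.exists_section (hk : 5 ≤ k)
    (hc : ∀ v w, c v ≠ c w → (G.Adj v w ↔ (cycleGraph k).Adj (c v) (c w))) {S : Finset V}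
    (hS : G.IsInducedCycle S) (hinj : Set.InjOn c S) :
    ∃ f : Fin k → V, (∀ i, c (f i) = i) ∧ S = Finset.univ.image f := by
  classical
  have hall : ∀ i, ∃ v ∈ S, c v = i := by
    refine fin_induction_add_one ?_ ?_
    · obtain ⟨l, ψ, hp⟩ := hS.exists_param
      exact ⟨_, ψ 0, hp.mem (by have := hp.three_le; omega), rfl⟩
    -- If the cycle avoids the next cluster, both cycle neighbours of `v` lie in the previous one,
    -- which holds at most one vertex of the cycle.
    · rintro i ⟨v, hv, rfl⟩
      by_contra! hcon
      have h2 := hS.card_fwd hv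
      obtain ⟨w, w', hww, hw⟩ := Finset.card_eq_two.mp h2
      have hcol : ∀ w ∈ G.fwd v S, c v = c w + 1 := by
        intro w hw
        rw [mem_fwd] at hw
        have hne : c v ≠ c w := fun h => hw.2.ne (hinj hv hw.1 h)
        rcases (cycleGraph_adj_iff hk).mp ((hc v w hne).mp hw.2) with h | h
        · exact absurd h (hcon w hw.1)
        · exact h
      have h1 : w ∈ G.fwd v S := by rw [hw]; simp
      have h1' : w' ∈ G.fwd v S := by rw [hw]; simp
      have := (hcol w h1).symm.trans (hcol w' h1')
      exact hww (hinj (mem_fwd.mp h1).1 (mem_fwd.mp h1').1 (add_right_cancel this))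
  choose f hf hfc using hall
  refine ⟨f, hfc, ?_⟩
  ext v
  simp only [Finset.mem_image, Finset.mem_univ, true_and]
  constructor
  · intro hv
    exact ⟨c v, hinj (hf _) hv (hfc _)⟩
  · rintro ⟨i, rfl⟩
    exact hf i

theorem IsInducedCycle.eq_pair_of_mem {S : Finset V} (hS : G.IsInducedCycle S) {x u v : V}
    (hx : x ∈ S) (hu : u ∈ S) (hv : v ∈ S) (huv : u ≠ v) (hxu : G.Adj x u) (hxv : G.Adj x v)
    {w : V} (hw : w ∈ S) (hxw : G.Adj x w) : w = u ∨ w = v := by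
  classical
  have h2 := hS.card_fwd hx
  have hsub : ({u, v} : Finset V) ⊆ G.fwd x S := by
    intro y hy
    rw [Finset.mem_insert, Finset.mem_singleton] at hy
    rcases hy with rfl | rfl <;> simp [mem_fwd, *]
  have heq := Finset.eq_of_subset_of_card_le hsub (by rw [h2, Finset.card_pair huv])
  have : w ∈ ({u, v} : Finset V) := by rw [heq, mem_fwd]; exact ⟨hw, hxw⟩
  simpa using this

/-- A cycle of a braid with two vertices in a cluster lies in at most three clusters. -/
theorem IsInducedCycle.local_cases (hk : 5 ≤ k)
    (hc : ∀ v w, c v ≠ c w → (G.Adj v w ↔ (cycleGraph k).Adj (c v) (c w))) {S : Finset V}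
    (hS : G.IsInducedCycle S) {u v : V} (hu : u ∈ S) (hv : v ∈ S) (huv : u ≠ v) {j : Fin k}
    (hcu : c u = j + 1) (hcv : c v = j + 1) :
    S ∈ innerCycles G c (j + 1) ∨
    (∃ Q ∈ adjPairs G c (j + 1), ∃ p ∈ cluster c j ∪ cluster c (j + 1 + 1), S = Q ∪ {p}) ∨
    (∃ Q ∈ nonadjPairs G c (j + 1), ∃ p ∈ cluster c j, ∃ q ∈ cluster c (j + 1 + 1),
      S = Q ∪ {p, q}) ∨
    (∃ Q ∈ nonadjPairs G c j, ∃ Q' ∈ nonadjPairs G c (j + 1), S = Q ∪ Q') ∨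
    (∃ Q ∈ nonadjPairs G c (j + 1), ∃ Q' ∈ nonadjPairs G c (j + 1 + 1), S = Q ∪ Q') := by
  classical
  have hcol : ∀ x y, c x = j + 1 → c y ≠ j + 1 → G.Adj x y → c y = j ∨ c y = j + 1 + 1 := by
    intro x y hx hy hxy
    rcases (cycleGraph_adj_iff hk).mp ((hc x y (by rw [hx]; exact hy.symm)).mp hxy) with h | h
    · right; rw [h, hx]
    · left; rw [hx] at h; exact (add_right_cancel h).symm
  have hadj : ∀ x y z, c x = j + 1 → c z = j + 1 → c y ≠ j + 1 → G.Adj x y → G.Adj z y := by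
    intro x y z hx hz hy hxy
    rw [hc z y (by rw [hz]; exact hy.symm), hz, ← hx]
    exact (hc x y (by rw [hx]; exact hy.symm)).mp hxy
  by_cases hin : S ⊆ cluster c (j + 1)
  · left
    rw [innerCycles, Finset.mem_filter, mem_inducedCycles]
    exact ⟨hS, hin⟩
  right
  obtain ⟨x, p, hx, hp, hcx, hcp, hxp⟩ : ∃ x p, x ∈ S ∧ p ∈ S ∧ c x = j + 1 ∧ c p ≠ j + 1 ∧
      G.Adj x p := by
    by_contra! hcon
    refine hin ?_
    have : S = {w ∈ S | c w = j + 1} := by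
      refine hS.subset_of_closed (Finset.filter_subset _ _) ⟨u, by simp [hu, hcu]⟩ ?_
      intro x hx w hw
      rw [Finset.mem_filter] at hx ⊢
      rw [mem_fwd] at hw
      refine ⟨hw.1, ?_⟩
      by_contra hcw
      exact hcon x w hx.1 hw.1 hx.2 hcw hw.2
    intro w hw
    rw [this, Finset.mem_filter] at hw
    exact mem_cluster.mpr hw.2
  -- A cycle vertex `p` in an adjacent cluster is joined to both `u` and `v`, so these are its only
  -- neighbours on the cycle. If `u` and `v` are adjacent, the cycle is a triangle; otherwise a
  -- second such vertex `q` closes a 4-cycle.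
  have hup : G.Adj u p := hadj x p u hcx hcu hcp hxp
  have hvp : G.Adj v p := hadj x p v hcx hcv hcp hxp
  have hpnbr : ∀ w ∈ S, G.Adj p w → w = u ∨ w = v := fun w hw hpw =>
    hS.eq_pair_of_mem hp hu hv huv hup.symm hvp.symm hw hpw
  have hpcol := hcol u p hcu hcp hup
  by_cases huv' : G.Adj u v
  · left
    refine ⟨{u, v}, pair_mem_adjPairs hcu hcv huv', p, by simpa using hpcol, ?_⟩
    refine hS.subset_of_closed ?_ ⟨u, by simp⟩ ?_
    · intro w hw
      simp only [Finset.mem_union, Finset.mem_insert, Finset.mem_singleton] at hw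
      rcases hw with (rfl | rfl) | rfl <;> assumption
    · intro y hy w hw
      rw [mem_fwd] at hw
      simp only [Finset.mem_union, Finset.mem_insert, Finset.mem_singleton] at hy ⊢
      rcases hy with (rfl | rfl) | rfl
      · rcases hS.eq_pair_of_mem hu hv hp hvp.ne huv' hup hw.1 hw.2 with h | h <;> tauto
      · rcases hS.eq_pair_of_mem hv hu hp hup.ne huv'.symm hvp hw.1 hw.2 with h | h <;> tauto
      · have := hpnbr w hw.1 hw.2; tauto
  right
  obtain ⟨q, hq, hqp, huq⟩ : ∃ q ∈ S, q ≠ p ∧ G.Adj u q := by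
    obtain ⟨a, ha, hap⟩ := Finset.exists_mem_ne (by rw [hS.card_fwd hu]; norm_num :
      1 < (G.fwd u S).card) p
    rw [mem_fwd] at ha
    exact ⟨a, ha.1, hap, ha.2⟩
  have hcq : c q ≠ j + 1 := by
    intro hcq
    rcases hpnbr q hq (hadj x p q hcx hcq hcp hxp).symm with rfl | rfl
    · exact huq.ne rfl
    · exact huv' huq
  have hvq : G.Adj v q := hadj u q v hcu hcv hcq huq
  have hqnbr : ∀ w ∈ S, G.Adj q w → w = u ∨ w = v := fun w hw hqw =>
    hS.eq_pair_of_mem hq hu hv huv huq.symm hvq.symm hw hqw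
  have hqcol := hcol u q hcu hcq huq
  have hpq : ¬ G.Adj p q := by
    intro h
    rcases hpnbr q hq h with rfl | rfl
    · exact hcq hcu
    · exact hcq hcv
  have hSeq : S = {u, v} ∪ {p, q} := by
    refine hS.subset_of_closed ?_ ⟨u, by simp⟩ ?_
    · intro w hw
      simp only [Finset.mem_union, Finset.mem_insert, Finset.mem_singleton] at hw
      rcases hw with (rfl | rfl) | rfl | rfl <;> assumption
    · intro y hy w hw
      rw [mem_fwd] at hw
      simp only [Finset.mem_union, Finset.mem_insert, Finset.mem_singleton] at hy ⊢
      rcases hy with (rfl | rfl) | rfl | rfl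
      · have := hS.eq_pair_of_mem hu hp hq hqp.symm hup huq hw.1 hw.2; tauto
      · have := hS.eq_pair_of_mem hv hp hq hqp.symm hvp hvq hw.1 hw.2; tauto
      · have := hpnbr w hw.1 hw.2; tauto
      · have := hqnbr w hw.1 hw.2; tauto
  have hQ := pair_mem_nonadjPairs hcu hcv huv huv'
  rcases hpcol with h1 | h1 <;> rcases hqcol with h2 | h2
  · right; left
    exact ⟨{p, q}, pair_mem_nonadjPairs h1 h2 hqp.symm hpq, _, hQ, by rw [hSeq, Finset.union_comm]⟩
  · left
    exact ⟨_, hQ, p, by simpa using h1, q, by simpa using h2, hSeq⟩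
  · left
    exact ⟨_, hQ, q, by simpa using h2, p, by simpa using h1, by rw [hSeq, Finset.pair_comm p q]⟩
  · right; right
    exact ⟨_, hQ, {p, q}, pair_mem_nonadjPairs h1 h2 hqp.symm hpq, hSeq⟩

/-- An upper bound for the number of induced cycles of a braid. -/
theorem card_inducedCycles_le_of_braid (hk : 5 ≤ k)
    (hc : ∀ v w, c v ≠ c w → (G.Adj v w ↔ (cycleGraph k).Adj (c v) (c w))) :
    G.inducedCycles.card ≤ ∏ i, (cluster c i).card + ∑ j : Fin k,
      ((innerCycles G c (j + 1)).card +
        (adjPairs G c (j + 1)).card * ((cluster c j).card + (cluster c (j + 1 + 1)).card) +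
        (nonadjPairs G c (j + 1)).card * ((cluster c j).card * (cluster c (j + 1 + 1)).card) +
        (nonadjPairs G c j).card * (nonadjPairs G c (j + 1)).card) := by
  classical
  have hsub : G.inducedCycles ⊆
      (Fintype.piFinset (cluster c)).image (fun f => Finset.univ.image f) ∪
      Finset.univ.biUnion fun j => innerCycles G c (j + 1) ∪
        (adjPairs G c (j + 1) ×ˢ (cluster c j ∪ cluster c (j + 1 + 1))).image
          (fun x => x.1 ∪ {x.2}) ∪
        (nonadjPairs G c (j + 1) ×ˢ (cluster c j ×ˢ cluster c (j + 1 + 1))).image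
          (fun x => x.1 ∪ {x.2.1, x.2.2}) ∪
        (nonadjPairs G c j ×ˢ nonadjPairs G c (j + 1)).image (fun x => x.1 ∪ x.2) := by
    intro S hS
    rw [mem_inducedCycles] at hS
    rw [Finset.mem_union]
    by_cases hinj : Set.InjOn c S
    · left
      obtain ⟨f, hf, rfl⟩ := hS.exists_section hk hc hinj
      exact Finset.mem_image.mpr ⟨f, Fintype.mem_piFinset.mpr fun i => mem_cluster.mpr (hf i), rfl⟩
    · right
      rw [Set.InjOn] at hinj
      push Not at hinj
      obtain ⟨u, hu, v, hv, hcuv, huv⟩ := hinj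
      have hcu : c u = (c u - 1) + 1 := (sub_add_cancel _ _).symm
      have hcv : c v = (c u - 1) + 1 := hcuv ▸ hcu
      generalize c u - 1 = j at hcu hcv
      simp only [Finset.mem_biUnion, Finset.mem_univ, true_and, Finset.mem_union (s := _ ∪ _),
        Finset.mem_union (s := innerCycles _ _ _)]
      rcases hS.local_cases hk hc hu hv huv hcu hcv with h | ⟨Q, hQ, p, hp, h⟩ |
        ⟨Q, hQ, p, hp, q, hq, h⟩ | ⟨Q, hQ, Q', hQ', h⟩ | ⟨Q, hQ, Q', hQ', h⟩
      · exact ⟨j, Or.inl (Or.inl (Or.inl h))⟩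
      · exact ⟨j, Or.inl (Or.inl (Or.inr (Finset.mem_image.mpr
          ⟨(Q, p), Finset.mem_product.mpr ⟨hQ, hp⟩, h.symm⟩)))⟩
      · exact ⟨j, Or.inl (Or.inr (Finset.mem_image.mpr ⟨(Q, p, q),
          Finset.mem_product.mpr ⟨hQ, Finset.mem_product.mpr ⟨hp, hq⟩⟩, h.symm⟩))⟩
      · exact ⟨j, Or.inr (Finset.mem_image.mpr
          ⟨(Q, Q'), Finset.mem_product.mpr ⟨hQ, hQ'⟩, h.symm⟩)⟩
      · exact ⟨j + 1, Or.inr (Finset.mem_image.mpr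
          ⟨(Q, Q'), Finset.mem_product.mpr ⟨hQ, hQ'⟩, h.symm⟩)⟩
  refine (Finset.card_le_card hsub).trans ((Finset.card_union_le _ _).trans
    (Nat.add_le_add (Finset.card_image_le.trans (Fintype.card_piFinset _).le)
      (Finset.card_biUnion_le.trans (Finset.sum_le_sum fun j _ => ?_))))
  refine (Finset.card_union_le _ _).trans (Nat.add_le_add ((Finset.card_union_le _ _).trans
    (Nat.add_le_add ((Finset.card_union_le _ _).trans (Nat.add_le_add le_rfl ?_)) ?_)) ?_)
  · refine Finset.card_image_le.trans ?_
    rw [Finset.card_product]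
    exact Nat.mul_le_mul_left _ (Finset.card_union_le _ _)
  · refine Finset.card_image_le.trans ?_
    rw [Finset.card_product, Finset.card_product]
  · refine Finset.card_image_le.trans ?_
    rw [Finset.card_product]

end Braid

end SimpleGraph

/-! ### Lower bound for the number of cycles of an empty braid -/

namespace SimpleGraph

theorem isInducedCycle_four {V : Type*} [DecidableEq V] {G : SimpleGraph V} {u p v q : V}
    (huv : u ≠ v) (hpq : p ≠ q) (hup : G.Adj u p) (hpv : G.Adj p v) (hvq : G.Adj v q)
    (huq : G.Adj u q) (huv' : ¬ G.Adj u v) (hpq' : ¬ G.Adj p q) :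
    G.IsInducedCycle {u, p, v, q} := by
  set ψ : ℕ → V := fun t => if t = 0 then u else if t = 1 then p else if t = 2 then v else q with hψ
  have hne := hup.ne
  have hne1 := hpv.ne
  have hne2 := hvq.ne
  have hne3 := huq.ne
  refine IsCycleParam.isInducedCycle (l := 4) (ψ := ψ) ⟨by norm_num, ?_, ?_, ?_⟩
  · intro s hs t ht hst
    interval_cases s <;> interval_cases t <;> simp_all [eq_comm]
  · rw [show Finset.range 4 = {0, 1, 2, 3} by decide]
    simp [hψ, Finset.image_insert]
  · intro s t hst ht
    interval_cases t <;> interval_cases s <;> simp_all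

section Braid

variable {V : Type*} [Fintype V] [DecidableEq V] {k : ℕ} [NeZero k] {G : SimpleGraph V}
  {c : V → Fin k}

theorem isInducedCycle_image_of_section (hk : 3 ≤ k)
    (hc : ∀ v w, G.Adj v w ↔ (cycleGraph k).Adj (c v) (c w)) {f : Fin k → V}
    (hf : ∀ i, c (f i) = i) : G.IsInducedCycle (Finset.univ.image f) := by
  refine IsCycleParam.isInducedCycle (l := k) (ψ := fun t => f (Fin.ofNat k t)) ⟨hk, ?_, ?_, ?_⟩
  · intro s hs t ht hst
    have := congrArg (fun v => (c v).val) hst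
    simp only [hf, Fin.val_ofNat] at this
    rwa [Nat.mod_eq_of_lt hs, Nat.mod_eq_of_lt ht] at this
  · ext v
    simp only [Finset.mem_image, Finset.mem_univ, true_and, Finset.mem_range]
    constructor
    · rintro ⟨i, rfl⟩
      exact ⟨i.val, i.2, by rw [Fin.ofNat_val_eq_self]⟩
    · rintro ⟨t, -, rfl⟩
      exact ⟨_, rfl⟩
  · intro s t hst ht
    have hs : s < k := hst.trans ht
    rw [hc, hf, hf, cycleGraph_adj_of_lt]
    · simp only [Fin.val_ofNat, Nat.mod_eq_of_lt hs, Nat.mod_eq_of_lt ht]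
    · rw [Fin.lt_def, Fin.val_ofNat, Fin.val_ofNat, Nat.mod_eq_of_lt hs, Nat.mod_eq_of_lt ht]
      exact hst

/-- The clusters that contain exactly two vertices of `S`. -/
noncomputable def doubles (c : V → Fin k) (S : Finset V) : Finset (Fin k) :=
  {i | (S ∩ cluster c i).card = 2}

theorem inter_cluster_of_subset {Q : Finset V} {a : Fin k} (hQ : Q ⊆ cluster c a) (i : Fin k) :
    Q ∩ cluster c i = if a = i then Q else ∅ := by
  split_ifs with h
  · exact Finset.inter_eq_left.mpr (h ▸ hQ)
  · rw [Finset.eq_empty_iff_forall_notMem]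
    intro v hv
    rw [Finset.mem_inter, mem_cluster] at hv
    exact h ((mem_cluster.mp (hQ hv.1)).symm.trans hv.2)

theorem image_section_inter_cluster {f : Fin k → V} (hf : ∀ i, c (f i) = i) (i : Fin k) :
    Finset.univ.image f ∩ cluster c i = {f i} := by
  ext v
  simp only [Finset.mem_inter, Finset.mem_image, Finset.mem_univ, true_and, mem_cluster,
    Finset.mem_singleton]
  constructor
  · rintro ⟨⟨j, rfl⟩, h⟩
    rw [hf] at h
    rw [h]
  · rintro rfl
    exact ⟨⟨i, rfl⟩, hf i⟩

/-- The number of induced cycles of an empty braid is at least the number of those with one vertex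
in each cluster, plus the number of those of length `4` with two vertices in some cluster. -/
theorem le_card_inducedCycles_of_empty_braid (hk : 5 ≤ k)
    (hc : ∀ v w, G.Adj v w ↔ (cycleGraph k).Adj (c v) (c w)) :
    ∏ i, (cluster c i).card + ∑ j : Fin k,
      ((cluster c (j + 1)).card.choose 2 *
        ((cluster c j).card * (cluster c (j + 1 + 1)).card) +
        (cluster c j).card.choose 2 * (cluster c (j + 1)).card.choose 2) ≤
    G.inducedCycles.card := by
  classical
  have n1 := fin_add_one_ne hk
  have n2 := fin_add_two_ne hk
  have n3 := fin_add_three_ne hk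
  have hadj : ∀ v w, c w = c v + 1 → G.Adj v w := fun v w h =>
    (hc v w).mpr ((cycleGraph_adj_iff hk).mpr (Or.inl h))
  have hnadj : ∀ v w, c w = c v → ¬ G.Adj v w := fun v w h h' => by
    rcases (cycleGraph_adj_iff hk).mp ((hc v w).mp h') with h1 | h1
    · exact n1 _ (h1.symm.trans h)
    · exact n1 _ (h1.symm.trans h.symm)
  have hnadj2 : ∀ v w, c w = c v + 1 + 1 → ¬ G.Adj v w := fun v w h h' => by
    rcases (cycleGraph_adj_iff hk).mp ((hc v w).mp h') with h1 | h1
    · exact n1 _ (h.symm.trans h1)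
    · rw [h] at h1; exact n3 _ h1.symm
  set P : Fin k → Finset (Finset V) := fun i => (cluster c i).powersetCard 2 with hP
  have hPsub : ∀ i, ∀ Q ∈ P i, Q ⊆ cluster c i ∧ Q.card = 2 := fun i Q hQ =>
    Finset.mem_powersetCard.mp hQ
  set T : Finset (Finset V) :=
    (Fintype.piFinset (cluster c)).image (fun f => Finset.univ.image f) with hT
  set A : Fin k → Finset (Finset V) := fun j =>
    (P (j + 1) ×ˢ (cluster c j ×ˢ cluster c (j + 1 + 1))).image
      (fun x => x.1 ∪ ({x.2.1} ∪ {x.2.2})) with hA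
  set B : Fin k → Finset (Finset V) := fun j =>
    (P j ×ˢ P (j + 1)).image (fun x => x.1 ∪ x.2) with hB
  have interA : ∀ j, ∀ Q ∈ P (j + 1), ∀ p ∈ cluster c j, ∀ q ∈ cluster c (j + 1 + 1), ∀ i,
      (Q ∪ ({p} ∪ {q})) ∩ cluster c i = (if j + 1 = i then Q else ∅) ∪
        ((if j = i then {p} else ∅) ∪ (if j + 1 + 1 = i then {q} else ∅)) := by
    intro j Q hQ p hp q hq i
    rw [Finset.union_inter_distrib_right, Finset.union_inter_distrib_right,
      inter_cluster_of_subset (hPsub _ Q hQ).1,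
      inter_cluster_of_subset (Finset.singleton_subset_iff.mpr hp),
      inter_cluster_of_subset (Finset.singleton_subset_iff.mpr hq)]
  have interB : ∀ j, ∀ Q ∈ P j, ∀ Q' ∈ P (j + 1), ∀ i,
      (Q ∪ Q') ∩ cluster c i = (if j = i then Q else ∅) ∪ (if j + 1 = i then Q' else ∅) := by
    intro j Q hQ Q' hQ' i
    rw [Finset.union_inter_distrib_right, inter_cluster_of_subset (hPsub _ Q hQ).1,
      inter_cluster_of_subset (hPsub _ Q' hQ').1]
  -- The set of doubled clusters is empty, `{j + 1}` or `{j, j + 1}` for the three families. It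
  -- tells them apart and determines `j`, so the families are disjoint and their sizes add up.
  have dT : ∀ S ∈ T, doubles c S = ∅ := by
    intro S hS
    obtain ⟨f, hf, rfl⟩ := Finset.mem_image.mp hS
    have hf' : ∀ i, c (f i) = i := fun i => mem_cluster.mp (Fintype.mem_piFinset.mp hf i)
    simp [doubles, image_section_inter_cluster hf']
  have dA : ∀ j, ∀ S ∈ A j, doubles c S = {j + 1} := by
    intro j S hS
    obtain ⟨⟨Q, p, q⟩, hx, rfl⟩ := Finset.mem_image.mp hS
    simp only [Finset.mem_product] at hx
    obtain ⟨hQ, hp, hq⟩ := hx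
    ext i
    simp only [doubles, Finset.mem_filter, Finset.mem_univ, true_and, Finset.mem_singleton]
    rw [interA j Q hQ p hp q hq]
    by_cases h1 : j + 1 = i
    · subst h1
      simp [(n1 j).symm, n1 (j + 1), (hPsub _ Q hQ).2]
    · by_cases h2 : j = i
      · subst h2
        simp [n1, n2, (n1 _).symm]
      · by_cases h3 : j + 1 + 1 = i
        · subst h3
          simp [(n1 _).symm, (n2 _).symm, n1]
        · simp [h1, h2, h3, Ne.symm h1]
  have dB : ∀ j, ∀ S ∈ B j, doubles c S = {j, j + 1} := by
    intro j S hS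
    obtain ⟨⟨Q, Q'⟩, hx, rfl⟩ := Finset.mem_image.mp hS
    simp only [Finset.mem_product] at hx
    obtain ⟨hQ, hQ'⟩ := hx
    ext i
    simp only [doubles, Finset.mem_filter, Finset.mem_univ, true_and, Finset.mem_singleton,
      Finset.mem_insert]
    rw [interB j Q hQ Q' hQ']
    by_cases h1 : j = i
    · subst h1
      simp [n1, (hPsub _ Q hQ).2]
    · by_cases h2 : j + 1 = i
      · subst h2
        simp [(n1 _).symm, (hPsub _ Q' hQ').2]
      · simp [h1, h2, Ne.symm h1, Ne.symm h2]
  have cT : T.card = ∏ i, (cluster c i).card := by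
    rw [hT, Finset.card_image_of_injOn, Fintype.card_piFinset]
    intro f hf g hg hfg
    have hf' : ∀ i, c (f i) = i := fun i =>
      mem_cluster.mp (Fintype.mem_piFinset.mp (Finset.mem_coe.mp hf) i)
    have hg' : ∀ i, c (g i) = i := fun i =>
      mem_cluster.mp (Fintype.mem_piFinset.mp (Finset.mem_coe.mp hg) i)
    funext i
    have := congrArg (· ∩ cluster c i) hfg
    simp only [image_section_inter_cluster hf', image_section_inter_cluster hg'] at this
    exact Finset.singleton_injective this
  have cA : ∀ j, (A j).card = (cluster c (j + 1)).card.choose 2 *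
      ((cluster c j).card * (cluster c (j + 1 + 1)).card) := by
    intro j
    simp only [hA]
    rw [Finset.card_image_of_injOn, Finset.card_product, Finset.card_product,
      Finset.card_powersetCard]
    rintro ⟨Q, p, q⟩ hx ⟨Q', p', q'⟩ hx' hxx
    simp only [Finset.coe_product, Set.mem_prod, Finset.mem_coe] at hx hx' hxx
    have key := fun i => congrArg (· ∩ cluster c i) hxx
    simp only [interA j Q hx.1 p hx.2.1 q hx.2.2, interA j Q' hx'.1 p' hx'.2.1 q' hx'.2.2] at key
    have k1 := key (j + 1)
    have k2 := key j
    have k3 := key (j + 1 + 1)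
    simp [n1, n2, (n1 _).symm, (n2 _).symm] at k1 k2 k3
    rw [k1, k2, k3]
  have cB : ∀ j, (B j).card = (cluster c j).card.choose 2 * (cluster c (j + 1)).card.choose 2 := by
    intro j
    simp only [hB]
    rw [Finset.card_image_of_injOn, Finset.card_product, Finset.card_powersetCard,
      Finset.card_powersetCard]
    rintro ⟨Q, Q'⟩ hx ⟨R, R'⟩ hx' hxx
    simp only [Finset.coe_product, Set.mem_prod, Finset.mem_coe] at hx hx' hxx
    have key := fun i => congrArg (· ∩ cluster c i) hxx
    simp only [interB j Q hx.1 Q' hx.2, interB j R hx'.1 R' hx'.2] at key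
    have k1 := key (j + 1)
    have k2 := key j
    simp [n1, (n1 _).symm] at k1 k2
    rw [k1, k2]
  have hsub : T ∪ (Finset.univ.biUnion A ∪ Finset.univ.biUnion B) ⊆ G.inducedCycles := by
    refine Finset.union_subset ?_ (Finset.union_subset ?_ ?_)
    · intro S hS
      obtain ⟨f, hf, rfl⟩ := Finset.mem_image.mp hS
      exact mem_inducedCycles.mpr (isInducedCycle_image_of_section (by omega) hc
        fun i => mem_cluster.mp (Fintype.mem_piFinset.mp hf i))
    · intro S hS
      obtain ⟨j, -, hS⟩ := Finset.mem_biUnion.mp hS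
      obtain ⟨⟨Q, p, q⟩, hx, rfl⟩ := Finset.mem_image.mp hS
      simp only [Finset.mem_product, mem_cluster] at hx
      obtain ⟨hQ, hp, hq⟩ := hx
      obtain ⟨hQs, hQ2⟩ := hPsub _ Q hQ
      obtain ⟨u, v, huv, rfl⟩ := Finset.card_eq_two.mp hQ2
      have hu := mem_cluster.mp (hQs (Finset.mem_insert_self u _))
      have hv := mem_cluster.mp (hQs (Finset.mem_insert_of_mem (Finset.mem_singleton_self v)))
      rw [mem_inducedCycles, show ({u, v} ∪ ({p} ∪ {q}) : Finset V) = {u, p, v, q} by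
        ext; simp; tauto]
      refine isInducedCycle_four huv ?_ (hadj p u (by rw [hu, hp])).symm (hadj p v (by rw [hv, hp]))
        (hadj v q (by rw [hv, hq])) (hadj u q (by rw [hu, hq])) (hnadj _ _ (by rw [hu, hv]))
        (hnadj2 _ _ (by rw [hp, hq]))
      rintro rfl
      exact n2 j (hq.symm.trans hp)
    · intro S hS
      obtain ⟨j, -, hS⟩ := Finset.mem_biUnion.mp hS
      obtain ⟨⟨Q, Q'⟩, hx, rfl⟩ := Finset.mem_image.mp hS
      simp only [Finset.mem_product] at hx
      obtain ⟨hQs, hQ2⟩ := hPsub _ Q hx.1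
      obtain ⟨hQs', hQ2'⟩ := hPsub _ Q' hx.2
      obtain ⟨u, v, huv, rfl⟩ := Finset.card_eq_two.mp hQ2
      obtain ⟨p, q, hpq, rfl⟩ := Finset.card_eq_two.mp hQ2'
      have hu := mem_cluster.mp (hQs (Finset.mem_insert_self u _))
      have hv := mem_cluster.mp (hQs (Finset.mem_insert_of_mem (Finset.mem_singleton_self v)))
      have hp := mem_cluster.mp (hQs' (Finset.mem_insert_self p _))
      have hq := mem_cluster.mp (hQs' (Finset.mem_insert_of_mem (Finset.mem_singleton_self q)))
      rw [mem_inducedCycles, show ({u, v} ∪ {p, q} : Finset V) = {u, p, v, q} by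
        ext; simp; tauto]
      exact isInducedCycle_four huv hpq (hadj u p (by rw [hu, hp])) (hadj v p (by rw [hv, hp])).symm
        (hadj v q (by rw [hv, hq])) (hadj u q (by rw [hu, hq])) (hnadj _ _ (by rw [hu, hv]))
        (hnadj _ _ (by rw [hp, hq]))
  refine le_trans (le_of_eq ?_) (Finset.card_le_card hsub)
  rw [Finset.card_union_of_disjoint, Finset.card_union_of_disjoint, Finset.card_biUnion,
    Finset.card_biUnion, cT, Finset.sum_congr rfl fun j _ => cA j,
    Finset.sum_congr rfl fun j _ => cB j, Finset.sum_add_distrib]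
  · intro i _ j _ hij
    refine Finset.disjoint_left.mpr fun S hi hj => hij ?_
    have h := (dB i S hi).symm.trans (dB j S hj)
    have h1 : i ∈ ({j, j + 1} : Finset (Fin k)) := h ▸ Finset.mem_insert_self _ _
    have h2 : j ∈ ({i, i + 1} : Finset (Fin k)) := h.symm ▸ Finset.mem_insert_self _ _
    simp only [Finset.mem_insert, Finset.mem_singleton] at h1 h2
    rcases h1 with h1 | h1
    · exact h1
    · rcases h2 with h2 | h2
      · exact h2.symm
      · rw [h1] at h2
        exact absurd h2.symm (n2 j)
  · intro i _ j _ hij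
    refine Finset.disjoint_left.mpr fun S hi hj => hij ?_
    have h := (dA i S hi).symm.trans (dA j S hj)
    exact add_right_cancel (Finset.singleton_injective h)
  · refine Finset.disjoint_left.mpr fun S hi hj => ?_
    obtain ⟨i, -, hi⟩ := Finset.mem_biUnion.mp hi
    obtain ⟨j, -, hj⟩ := Finset.mem_biUnion.mp hj
    have h := congrArg Finset.card ((dA i S hi).symm.trans (dB j S hj))
    rw [Finset.card_singleton, Finset.card_pair (n1 j).symm] at h
    omega
  · refine Finset.disjoint_left.mpr fun S hi hj => ?_
    have h0 := dT S hi
    rcases Finset.mem_union.mp hj with hj | hj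
    · obtain ⟨j, -, hj⟩ := Finset.mem_biUnion.mp hj
      have h := h0.symm.trans (dA j S hj)
      exact (Finset.singleton_ne_empty _) h.symm
    · obtain ⟨j, -, hj⟩ := Finset.mem_biUnion.mp hj
      have h := h0.symm.trans (dB j S hj)
      exact (Finset.insert_ne_empty _ _) h.symm

end Braid

end SimpleGraph

/-! ### Optimal cluster sizes and local counts -/

/-- In an optimal partition, no selection of parts can be improved. -/
theorem maxProd_le_of_prod_eq {ι : Type*} [Fintype ι] [DecidableEq ι] {b : ι → ℕ}
    (h : ∏ i, b i = maxProd (∑ i, b i)) (s : Finset ι) :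
    maxProd (∑ i ∈ s, b i + ∑ i ∈ sᶜ, b i) ≤ (∏ i ∈ s, b i) * maxProd (∑ i ∈ sᶜ, b i) := by
  rw [Finset.sum_add_sum_compl, ← h, ← Finset.prod_mul_prod_compl s]
  exact Nat.mul_le_mul_left _ (prod_le_maxProd _ _)

theorem nine_mul_maxProd_le (r : ℕ) : 9 * maxProd r ≤ maxProd (6 + r) := by
  have h1 := mul_maxProd_le 3 r
  have h2 := mul_maxProd_le 3 (3 + r)
  rw [show 3 + (3 + r) = 6 + r by ring] at h2
  omega

/-- The parts of an optimal partition are equal to `3`, with at most one exception or with two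
exceptions equal to `2`. -/
theorem eq_three_of_prod_eq_maxProd {ι : Type*} [Fintype ι] [Nonempty ι] {b : ι → ℕ}
    (h : ∏ i, b i = maxProd (∑ i, b i)) (hb : ∀ i, 2 ≤ b i ∧ b i ≤ 4) :
    (∃ i₀, ∀ i, i ≠ i₀ → b i = 3) ∨
    ∃ i₀ i₁, i₀ ≠ i₁ ∧ b i₀ = 2 ∧ b i₁ = 2 ∧ ∀ i, i ≠ i₀ → i ≠ i₁ → b i = 3 := by
  classical
  have hpos := maxProd_pos
  -- A 2 and a 4 can be improved from 8 to `3 * 3`, and two 4s from 16 to `3 * 3 * 2`.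
  have pair : ∀ i j, i ≠ j → b i ≠ 3 → b j ≠ 3 → b i = 2 ∧ b j = 2 := by
    intro i j hij hi hj
    have key := maxProd_le_of_prod_eq h {i, j}
    rw [Finset.sum_pair hij, Finset.prod_pair hij] at key
    generalize ∑ i ∈ ({i, j} : Finset ι)ᶜ, b i = r at key
    have h9 := nine_mul_maxProd_le r
    have h9' := nine_mul_maxProd_le (2 + r)
    have h2 := mul_maxProd_le 2 r
    have hr := hpos r
    rw [show 6 + (2 + r) = 8 + r by ring] at h9'
    have hbi := hb i
    have hbj := hb j
    rcases (show b i = 2 ∨ b i = 4 by omega) with hi' | hi' <;>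
      rcases (show b j = 2 ∨ b j = 4 by omega) with hj' | hj' <;>
      simp only [hi', hj', Nat.reduceAdd, Nat.reduceMul] at key <;> omega
  by_cases ha : ∃ i₀, ∀ i, i ≠ i₀ → b i = 3
  · exact Or.inl ha
  right
  push Not at ha
  obtain ⟨i₀, -, h0⟩ := ha (Classical.arbitrary ι)
  obtain ⟨i₁, h10, h1⟩ := ha i₀
  obtain ⟨hb0, hb1⟩ := pair i₀ i₁ h10.symm h0 h1
  refine ⟨i₀, i₁, h10.symm, hb0, hb1, fun i hi0 hi1 => ?_⟩
  by_contra hi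
  have hb2 := (pair i₀ i hi0.symm h0 hi).2
  have key := maxProd_le_of_prod_eq h {i₀, i₁, i}
  have hnot : i₀ ∉ ({i₁, i} : Finset ι) := by simp [h10.symm, hi0.symm]
  -- Three parts equal to 2 are excluded by `2 * 2 * 2 < 3 * 3`.
  rw [Finset.sum_insert hnot, Finset.prod_insert hnot, Finset.sum_pair hi1.symm,
    Finset.prod_pair hi1.symm, hb0, hb1, hb2] at key
  generalize ∑ i ∈ ({i₀, i₁, i} : Finset ι)ᶜ, b i = r at key
  have h9 := nine_mul_maxProd_le r
  have hr := hpos r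
  norm_num at key
  omega

/-- The cycles of a braid near a cluster of size `b₁` are at most as many as in the empty braid. -/
theorem local_count_le {b₀ b₁ b₂ n e D : ℕ} (h0 : 2 ≤ b₀ ∧ b₀ ≤ 4) (h1 : 2 ≤ b₁ ∧ b₁ ≤ 4)
    (h2 : 2 ≤ b₂ ∧ b₂ ≤ 4) (hne : n + e = b₁.choose 2) (hD : D ≤ b₁.choose 3 + b₁.choose 4)
    (hD3 : 0 < D → 3 ≤ e) (h4 : b₁ = 4 → b₀ = 3 ∧ b₂ = 3) (h22 : ¬ (b₀ = 2 ∧ b₂ = 2)) :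
    D + e * (b₀ + b₂) + n * (b₀ * b₂) ≤ b₁.choose 2 * (b₀ * b₂) ∧
    (0 < e → D + e * (b₀ + b₂) + n * (b₀ * b₂) < b₁.choose 2 * (b₀ * b₂)) := by
  -- An adjacent pair accounts for at most `b₀ + b₂` triangles, where a nonadjacent one could give
  -- `b₀ * b₂` cycles of length 4. The former is smaller unless `b₀ = b₂ = 2`. The few cycles inside
  -- the cluster require at least three adjacent pairs, whose losses outweigh them.
  obtain ⟨h0, h0'⟩ := h0
  obtain ⟨h1, h1'⟩ := h1
  obtain ⟨h2, h2'⟩ := h2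
  interval_cases b₁
  · simp only [show Nat.choose 2 2 = 1 by rfl, show Nat.choose 2 3 = 0 by rfl,
      show Nat.choose 2 4 = 0 by rfl] at hne hD ⊢
    clear h4
    interval_cases b₀ <;> interval_cases b₂ <;> omega
  · simp only [show Nat.choose 3 2 = 3 by rfl, show Nat.choose 3 3 = 1 by rfl,
      show Nat.choose 3 4 = 0 by rfl] at hne hD ⊢
    clear h4
    interval_cases b₀ <;> interval_cases b₂ <;> omega
  · obtain ⟨rfl, rfl⟩ := h4 rfl
    simp only [show Nat.choose 4 2 = 6 by rfl, show Nat.choose 4 3 = 4 by rfl,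
      show Nat.choose 4 4 = 1 by rfl] at hne hD ⊢
    omega

theorem local_count_le_of_le_three {b₀ b₁ b₂ n e D : ℕ} (h0 : 2 ≤ b₀ ∧ b₀ ≤ 3)
    (h1 : 2 ≤ b₁ ∧ b₁ ≤ 3) (h2 : 2 ≤ b₂ ∧ b₂ ≤ 3) (hne : n + e = b₁.choose 2)
    (hD : D ≤ b₁.choose 3 + b₁.choose 4)
    (hD3 : 0 < D → 3 ≤ e) :
    D + e * (b₀ + b₂) + n * (b₀ * b₂) ≤ 27 := by
  obtain ⟨h0, h0'⟩ := h0
  obtain ⟨h1, h1'⟩ := h1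
  obtain ⟨h2, h2'⟩ := h2
  interval_cases b₁
  · simp only [show Nat.choose 2 2 = 1 by rfl, show Nat.choose 2 3 = 0 by rfl,
      show Nat.choose 2 4 = 0 by rfl] at hne hD
    interval_cases b₀ <;> interval_cases b₂ <;> omega
  · simp only [show Nat.choose 3 2 = 3 by rfl, show Nat.choose 3 3 = 1 by rfl,
      show Nat.choose 3 4 = 0 by rfl] at hne hD
    interval_cases b₀ <;> interval_cases b₂ <;> omega

theorem prod_hSize {n : ℕ} (hn : 8 ≤ n) : ∏ i, hSize n i = maxProd n := by
  obtain ⟨k, hk⟩ : ∃ k, hLength n = k + 1 := ⟨hLength n - 1, by unfold hLength; omega⟩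
  have h : ∏ i : Fin (hLength n), hSize n i
      = ∏ i ∈ Finset.range (hLength n),
        if i = 0 then (if n % 3 = 0 then 3 else if n % 3 = 1 then 4 else 2) else 3 :=
    Fin.prod_univ_eq_prod_range
      (fun i : ℕ => if i = 0 then (if n % 3 = 0 then 3 else if n % 3 = 1 then 4 else 2) else 3) _
  rw [h, hk, Finset.prod_range_succ']
  simp only [Nat.succ_ne_zero, if_false, if_true, Finset.prod_const, Finset.card_range]
  unfold hLength at hk
  split_ifs with h0 h1
  · rw [show n = 3 + 3 * k by omega, maxProd_add_mul (by norm_num)]; rfl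
  · rw [show n = 4 + 3 * k by omega, maxProd_add_mul (by norm_num)]; rfl
  · rw [show n = 2 + 3 * k by omega, maxProd_add_mul (by norm_num)]; rfl

namespace SimpleGraph

theorem card_cluster_H (n : ℕ) (i : Fin (hLength n)) :
    (cluster (V := Σ i : Fin (hLength n), Fin (hSize n i)) Sigma.fst i).card = hSize n i := by
  classical
  rw [cluster, ← Fintype.card_subtype, Fintype.card_congr (Equiv.sigmaSubtype i), Fintype.card_fin]

theorem le_card_inducedCycles_H {n : ℕ} (hn : 14 ≤ n) [NeZero (hLength n)] :
    maxProd n + ∑ j : Fin (hLength n),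
      ((hSize n (j + 1)).choose 2 * (hSize n j * hSize n (j + 1 + 1)) +
        (hSize n j).choose 2 * (hSize n (j + 1)).choose 2) ≤ (H n).inducedCycles.card := by
  have h := le_card_inducedCycles_of_empty_braid (G := H n) (c := Sigma.fst)
    (by unfold hLength; omega) (fun v w => Iff.rfl)
  simp only [card_cluster_H] at h
  rwa [prod_hSize (by omega)] at h

theorem maxProd_le_card_inducedCycles_H {n : ℕ} (hn : 14 ≤ n) :
    maxProd n ≤ (H n).inducedCycles.card := by
  have : NeZero (hLength n) := ⟨by unfold hLength; omega⟩
  exact (Nat.le_add_right _ _).trans (le_card_inducedCycles_H hn)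

/-- A generic position contributes `3 * 9 + 3 * 3 = 36` short cycles. The position before the
cluster of size 4 gives at least 72 and the position at that cluster at least 37, so the total
exceeds what `hLength n + 1` clusters of size at most 3 can reach. -/
theorem lt_card_inducedCycles_H {n : ℕ} (hn : 14 ≤ n) (h1 : n % 3 = 1) :
    maxProd n + 36 * (hLength n + 1) < (H n).inducedCycles.card := by
  have hk : 5 ≤ hLength n := by unfold hLength; omega
  have : NeZero (hLength n) := ⟨by omega⟩
  have hs0 : hSize n 0 = 4 := by simp [hSize, h1]
  have hs : ∀ i, i ≠ 0 → hSize n i = 3 := by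
    intro i hi
    rw [hSize, if_neg]
    exact fun h => hi (Fin.ext h)
  have hs3 : ∀ i, 3 ≤ hSize n i := by
    intro i
    by_cases hi : i = 0
    · rw [hi, hs0]; norm_num
    · rw [hs i hi]
  have hc3 : ∀ i, 3 ≤ (hSize n i).choose 2 := fun i =>
    (show 3 = (3).choose 2 by rfl).le.trans (Nat.choose_le_choose 2 (hs3 i))
  refine lt_of_lt_of_le ?_ (le_card_inducedCycles_H hn)
  refine Nat.add_lt_add_left ?_ _
  calc 36 * (hLength n + 1) < ∑ j : Fin (hLength n),
        (36 + (if j = -1 then 36 else 0) + (if j = 0 then 1 else 0)) := by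
        rw [Finset.sum_add_distrib, Finset.sum_add_distrib, Finset.sum_ite_eq' Finset.univ,
          Finset.sum_ite_eq' Finset.univ]
        simp
        omega
    _ ≤ _ := by
      refine Finset.sum_le_sum fun j _ => ?_
      have e1 := fin_add_one_ne hk j
      have e2 := fin_add_two_ne hk j
      have hprod : 9 ≤ hSize n j * hSize n (j + 1 + 1) := Nat.mul_le_mul (hs3 j) (hs3 _)
      have hch : 9 ≤ (hSize n j).choose 2 * (hSize n (j + 1)).choose 2 :=
        Nat.mul_le_mul (hc3 j) (hc3 _)
      have hmul : 27 ≤ (hSize n (j + 1)).choose 2 * (hSize n j * hSize n (j + 1 + 1)) :=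
        Nat.mul_le_mul (hc3 _) hprod
      by_cases hj : j = -1
      · have hj1 : j + 1 = 0 := by rw [hj, neg_add_cancel]
        have hj0 : j ≠ 0 := fun h => e1 (hj1.trans h.symm)
        rw [if_pos hj, if_neg hj0]
        have h6 : (hSize n (j + 1)).choose 2 = 6 := by rw [hj1, hs0]; rfl
        have := hc3 j
        rw [h6]
        omega
      · rw [if_neg hj]
        by_cases hj0 : j = 0
        · rw [if_pos hj0]
          have h6 : (hSize n j).choose 2 = 6 := by rw [hj0, hs0]; rfl
          have := hc3 (j + 1)
          rw [h6]
          omega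
        · rw [if_neg hj0]
          omega

end SimpleGraph

/-! ### Identification of the extremal braid -/

namespace SimpleGraph

section Braid

variable {V : Type*} [Fintype V] [DecidableEq V] {k : ℕ} [NeZero k] {G : SimpleGraph V}
  {c : V → Fin k}

theorem sum_card_cluster (c : V → Fin k) : ∑ i, (cluster c i).card = Fintype.card V := by
  rw [← Finset.card_univ, Finset.card_eq_sum_card_fiberwise (t := Finset.univ) (f := c)
    (fun _ _ => Finset.mem_coe.mpr (Finset.mem_univ _))]
  exact Finset.sum_congr rfl fun i _ => by congr 1

theorem IsOptimalBraid.prod_card_cluster (h : G.IsOptimalBraid c) :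
    ∏ i, (cluster c i).card = maxProd (∑ i, (cluster c i).card) := by
  rw [sum_card_cluster, ← h.prod]
  exact Finset.prod_congr rfl fun i _ => by congr 1

/-- Emptying the clusters of a braid with almost all clusters of size `3` increases the number of
induced cycles. -/
theorem card_inducedCycles_lt_of_adj (hk : 5 ≤ k)
    (hc : ∀ v w, c v ≠ c w → (G.Adj v w ↔ (cycleGraph k).Adj (c v) (c w)))
    (hb : ∀ i, 2 ≤ (cluster c i).card ∧ (cluster c i).card ≤ 4) {i₀ : Fin k}
    (h3 : ∀ i, i ≠ i₀ → (cluster c i).card = 3) {u v : V} (huv : G.Adj u v) (hcuv : c u = c v) :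
    G.inducedCycles.card < ((cycleGraph k).comap c).inducedCycles.card := by
  have n1 := fin_add_one_ne hk
  have n2 := fin_add_two_ne hk
  refine (card_inducedCycles_le_of_braid hk hc).trans_lt (lt_of_lt_of_le ?_
    (le_card_inducedCycles_of_empty_braid hk (c := c) fun v w => Iff.rfl))
  refine Nat.add_lt_add_left ?_ _
  have hloc := fun j : Fin k => local_count_le (hb j) (hb (j + 1)) (hb (j + 1 + 1))
    (card_nonadjPairs_add_card_adjPairs G c (j + 1)) (card_innerCycles_le G c (j + 1) (hb _).2)
    (fun h => three_le_card_adjPairs (Finset.card_pos.mp h))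
    (fun h => by
      have hj : j + 1 = i₀ := by
        by_contra hne
        rw [h3 _ hne] at h
        omega
      exact ⟨h3 _ fun h => n1 j (hj.trans h.symm), h3 _ fun h => n1 _ (h.trans hj.symm)⟩)
    (fun h => by
      have h1 : j = i₀ := by
        by_contra hne
        rw [h3 _ hne] at h
        omega
      have h2 := h3 (j + 1 + 1) fun h => n2 j (h.trans h1.symm)
      omega)
  have hnn : ∀ j : Fin k, (nonadjPairs G c j).card * (nonadjPairs G c (j + 1)).card ≤
      (cluster c j).card.choose 2 * (cluster c (j + 1)).card.choose 2 := by
    intro j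
    have h1 := card_nonadjPairs_add_card_adjPairs G c j
    have h2 := card_nonadjPairs_add_card_adjPairs G c (j + 1)
    exact Nat.mul_le_mul (by omega) (by omega)
  refine Finset.sum_lt_sum (fun j _ => Nat.add_le_add (hloc j).1 (hnn j))
    -- The summand with index `j` treats cluster `j + 1` as the middle one, so the strict loss at
    -- the cluster of `u` occurs at `c u - 1`.
    ⟨c u - 1, Finset.mem_univ _, Nat.add_lt_add_of_lt_of_le ((hloc _).2 ?_) (hnn _)⟩
  rw [sub_add_cancel]
  exact Finset.card_pos.mpr ⟨_, pair_mem_adjPairs rfl hcuv.symm huv⟩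

/-- This bounds the competitor with two clusters of size 2: each position gives at most 27 cycles
around its middle cluster and at most `3 * 3` made of two nonadjacent pairs. -/
theorem card_inducedCycles_le_of_le_three (hk : 5 ≤ k)
    (hc : ∀ v w, c v ≠ c w → (G.Adj v w ↔ (cycleGraph k).Adj (c v) (c w)))
    (hb : ∀ i, 2 ≤ (cluster c i).card ∧ (cluster c i).card ≤ 3) :
    G.inducedCycles.card ≤ ∏ i, (cluster c i).card + 36 * k := by
  refine (card_inducedCycles_le_of_braid hk hc).trans (Nat.add_le_add_left ?_ _)
  calc _ ≤ ∑ j : Fin k, 36 := by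
        refine Finset.sum_le_sum fun j _ => ?_
        have h := local_count_le_of_le_three (hb j) (hb (j + 1)) (hb (j + 1 + 1))
          (card_nonadjPairs_add_card_adjPairs G c (j + 1))
          (card_innerCycles_le G c (j + 1) (by have := (hb (j + 1)).2; omega))
          (fun h => three_le_card_adjPairs (Finset.card_pos.mp h))
        have hn : ∀ i, (nonadjPairs G c i).card ≤ 3 := by
          intro i
          have h1 := card_nonadjPairs_add_card_adjPairs G c i
          have h2 : (cluster c i).card.choose 2 ≤ (3).choose 2 :=
            Nat.choose_le_choose 2 (hb i).2
          have h3 : (3).choose 2 = 3 := rfl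
          omega
        have := Nat.mul_le_mul (hn j) (hn (j + 1))
        omega
    _ = 36 * k := by simp [mul_comm]

/-- An empty braid with the right cluster sizes is isomorphic to `H n`. -/
theorem nonempty_iso_H {n : ℕ} [NeZero (hLength n)] (hk : 5 ≤ hLength n) {c : V → Fin (hLength n)}
    (i₀ : Fin (hLength n)) (hs : ∀ i, (cluster c i).card = hSize n (i - i₀)) :
    Nonempty ((cycleGraph (hLength n)).comap c ≃g H n) := by
  classical
  have hfib : ∀ i, Nonempty ({v // c v - i₀ = i} ≃
      {x : Σ i : Fin (hLength n), Fin (hSize n i) // x.1 = i}) := by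
    intro i
    refine ⟨Fintype.equivOfCardEq ?_⟩
    rw [Fintype.card_congr (Equiv.sigmaSubtype i), Fintype.card_fin, Fintype.card_subtype]
    have := hs (i + i₀)
    rw [add_sub_cancel_right] at this
    rw [← this]
    congr 1
    ext v
    simp [sub_eq_iff_eq_add]
  set E := Equiv.ofFiberEquiv (fun i => (hfib i).some) with hE
  have hmap : ∀ v, (E v).1 = c v - i₀ := fun v => Equiv.ofFiberEquiv_map (fun i => (hfib i).some) v
  refine ⟨⟨E, ?_⟩⟩
  intro v w
  change (cycleGraph (hLength n)).Adj (E v).1 (E w).1 ↔ (cycleGraph (hLength n)).Adj (c v) (c w)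
  rw [hmap, hmap, cycleGraph_adj_iff hk, cycleGraph_adj_iff hk, sub_eq_iff_eq_add,
    sub_eq_iff_eq_add, add_right_comm, add_right_comm (c w - i₀), sub_add_cancel, sub_add_cancel]

theorem sum_eq_of_forall_ne {b : Fin k → ℕ} {i₀ : Fin k} (h3 : ∀ i, i ≠ i₀ → b i = 3) :
    ∑ i, b i + 3 = b i₀ + 3 * k := by
  rw [← Finset.add_sum_erase _ _ (Finset.mem_univ i₀),
    Finset.sum_congr rfl fun i hi => h3 i (Finset.ne_of_mem_erase hi), Finset.sum_const,
    Finset.card_erase_of_mem (Finset.mem_univ i₀), Finset.card_univ, Fintype.card_fin, smul_eq_mul]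
  have := NeZero.pos k
  omega

theorem sum_eq_of_forall_ne_ne {b : Fin k → ℕ} {i₀ i₁ : Fin k} (hne : i₀ ≠ i₁)
    (h3 : ∀ i, i ≠ i₀ → i ≠ i₁ → b i = 3) : ∑ i, b i + 6 = b i₀ + b i₁ + 3 * k := by
  have hmem : i₁ ∈ Finset.univ.erase i₀ := Finset.mem_erase.mpr ⟨hne.symm, Finset.mem_univ _⟩
  have hcard := Finset.card_erase_of_mem hmem
  have hcard' := Finset.card_pos.mpr ⟨i₁, hmem⟩
  rw [Finset.card_erase_of_mem (Finset.mem_univ i₀), Finset.card_univ, Fintype.card_fin]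
    at hcard hcard'
  rw [← Finset.add_sum_erase _ _ (Finset.mem_univ i₀), ← Finset.add_sum_erase _ _ hmem,
    Finset.sum_congr rfl fun i hi => h3 i (Finset.ne_of_mem_erase (Finset.mem_of_mem_erase hi))
      (Finset.ne_of_mem_erase hi), Finset.sum_const, hcard, smul_eq_mul]
  omega

/-- A cyclic braid with optimal cluster sizes and as many induced cycles as `H n` is `H n`. -/
theorem IsOptimalBraid.nonempty_iso_H (hk : 5 ≤ k) (h : G.IsOptimalBraid c)
    (hn : 14 ≤ Fintype.card V)
    (hG : (H (Fintype.card V)).inducedCycles.card ≤ G.inducedCycles.card) :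
    Nonempty (G ≃g H (Fintype.card V)) := by
  have hprod := h.prod_card_cluster
  have hsum := sum_card_cluster c
  have hb : ∀ i, 2 ≤ (cluster c i).card ∧ (cluster c i).card ≤ 4 := fun i =>
    bounds_of_prod_eq_maxProd Finset.univ _ hprod (by omega) (Finset.mem_univ i)
  rcases eq_three_of_prod_eq_maxProd hprod hb with ⟨i₀, h3⟩ | ⟨i₀, i₁, hne, h0, h1, h3⟩
  · have hs := sum_eq_of_forall_ne (b := fun i => (cluster c i).card) h3
    have hb0 := hb i₀
    simp only [hsum] at hs
    have hkn : k = hLength (Fintype.card V) := by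
      unfold hLength
      omega
    generalize Fintype.card V = n at *
    subst hkn
    -- Rotating the clusters moves the exceptional one to index 0, where `hSize` has its exception.
    have hiso : Nonempty ((cycleGraph (hLength n)).comap c ≃g H n) := by
      refine SimpleGraph.nonempty_iso_H hk i₀ fun i => ?_
      by_cases hi : i = i₀
      · rw [hi, sub_self, hSize, if_pos (Fin.val_zero _)]
        split_ifs <;> omega
      · rw [h3 i hi, hSize, if_neg]
        intro hval
        exact hi (sub_eq_zero.mp (Fin.ext hval))
    have hcard : ((cycleGraph (hLength n)).comap c).inducedCycles.card =
        (H n).inducedCycles.card := by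
      obtain ⟨e⟩ := hiso
      rw [← numInducedCycles_eq_card, ← numInducedCycles_eq_card, numInducedCycles_congr e]
    have hempty : ∀ v w, c v = c w → ¬ G.Adj v w := by
      intro v w hvw hadj
      have := card_inducedCycles_lt_of_adj hk h.adj hb h3 hadj hvw
      omega
    have hGeq : G = (cycleGraph (hLength n)).comap c := by
      ext v w
      rw [comap_adj]
      by_cases hvw : c v = c w
      · rw [hvw]
        simp [hempty v w hvw]
      · exact h.adj v w hvw
    rw [hGeq]
    exact hiso
  -- Two clusters of size 2 have the same product as one of size 4 and use one cluster more, so the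
  -- main terms agree and the number of short cycles decides.
  · exfalso
    have hs := sum_eq_of_forall_ne_ne (b := fun i => (cluster c i).card) hne h3
    simp only [hsum, h0, h1] at hs
    have hlt := lt_card_inducedCycles_H hn (by omega)
    have hle := card_inducedCycles_le_of_le_three hk h.adj fun i => by
      by_cases hi0 : i = i₀
      · rw [hi0, h0]; omega
      · by_cases hi1 : i = i₁
        · rw [hi1, h1]; omega
        · rw [h3 i hi0 hi1]; omega
    rw [hprod, hsum] at hle
    have hkn : hLength (Fintype.card V) + 1 = k := by
      unfold hLength
      omega
    rw [hkn] at hlt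
    omega

end Braid

end SimpleGraph

/-! ### The theorem -/

theorem theorem1p1 :
    ∃ n₀ : ℕ, ∀ n : ℕ, n₀ ≤ n → ∀ G : SimpleGraph (Fin n),
      numInducedCycles G = m n ↔ Nonempty (G ≃g H n) := by
  obtain ⟨n₀, hn₀⟩ := SimpleGraph.exists_isOptimalBraid
  refine ⟨max n₀ 14, fun n hn => ?_⟩
  have hn0 : n₀ ≤ n := (le_max_left _ _).trans hn
  have hn14 : 14 ≤ n := (le_max_right _ _).trans hn
  -- Every graph that does at least as well as `H n` is `H n`. Applied to a maximiser, this also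
  -- shows that `H n` attains `m n`.
  have hmain : ∀ G : SimpleGraph (Fin n), numInducedCycles (H n) ≤ numInducedCycles G →
      Nonempty (G ≃g H n) := by
    intro G hG
    rw [SimpleGraph.numInducedCycles_eq_card, SimpleGraph.numInducedCycles_eq_card] at hG
    have hle := (SimpleGraph.maxProd_le_card_inducedCycles_H hn14).trans hG
    obtain ⟨k, hk, c, hc⟩ := hn₀ G (by rwa [Fintype.card_fin]) (by rwa [Fintype.card_fin])
    have : NeZero k := ⟨by omega⟩
    have h := hc.nonempty_iso_H hk
    rw [Fintype.card_fin] at h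
    exact h hn14 hG
  obtain ⟨⟨G₀, hG₀⟩, hmax⟩ := m_isGreatest n
  have hHm : numInducedCycles (H n) ≤ m n := by
    have e : (Σ i : Fin (hLength n), Fin (hSize n i)) ≃ Fin n :=
      Fintype.equivFinOfCardEq (card_H n (by omega))
    rw [← SimpleGraph.numInducedCycles_congr (SimpleGraph.Iso.comap e.symm (H n))]
    exact hmax ⟨_, rfl⟩
  intro G
  constructor
  · intro hG
    exact hmain G (hG ▸ hHm)
  · rintro ⟨e⟩
    simp only at hG₀
    obtain ⟨e₀⟩ := hmain G₀ (by rw [hG₀]; exact hHm)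
    rw [← hG₀, SimpleGraph.numInducedCycles_congr e, SimpleGraph.numInducedCycles_congr e₀]
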